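/- Let $p$ be a prime number, let $G$ be a cyclic group of order $p$, and let $k$ be a field admitting a $G$-extension, i.e. there is a Galois extension $K/k$ with $\mathrm{Gal}(K/k)\simeq G$. Let $h_p$ be the class number of the cyclotomic field $\mathbb{Q}(\zeta_p)$. A $G$-torus over $k$ is an affine algebraic group $T$ over $k$ for which there are a finite Galois extension $K/k$ with $\mathrm{Gal}(K/k)\simeq G$ and an integer $d\ge 1$ such that $T\times_k K\simeq \mathbb{G}_{m,K}^d$ as algebraic groups over $K$. A field extension $L/k$ is $k$-rational if $L\simeq k(X_1,\dots,X_n)$ over $k$ for some $n\geq 0$, and stably $k$-rational if $L(Y_1,\dots,Y_m)$ is $k$-rational for some $m\ge 0$, where $Y_1,\dots,Y_m$ are algebraically independent over $L$. A torus over $k$ is $k$-rational (resp. stably $k$-rational) if its function field $k(T)$ is. (1) Every $G$-torus over $k$ that is stably $k$-rational is $k$-rational. (2) $h_p=1$ if and only if all $G$-tori over $k$ are stably $k$-rational; moreover, $h_p=1$ if and only if all $G$-tori over $k$ are $k$-rational. -/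

import Mathlib

open scoped TensorProduct

universe u v

/-- `k` admits a `G`-extension: there is a finite Galois extension `K / k` with
`Gal(K/k) ≃ G`.  (Such a `K` is finite over `k`, so it may be taken in the universe of `k`.) -/
def AdmitsExtension (G : Type v) [Group G] (k : Type u) [Field k] : Prop :=
  ∃ (K : Type u) (_ : Field K) (_ : Algebra k K),
    FiniteDimensional k K ∧ IsGalois k K ∧ Nonempty ((K ≃ₐ[k] K) ≃* G)

/-- An affine algebraic group `T` over `k` is given by its coordinate ring `A = k[T]`, a commutative
Hopf algebra over `k`.  The base change `T ×_k K` has coordinate ring `K ⊗[k] A`, and the `d`-fold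
power of the multiplicative group over `K` has coordinate ring `K[x₁^{±1}, …, x_d^{±1}]` with every
`x_i` group-like, that is, the group algebra of `ℤ^d`.  The predicate says that `T` is a torus with
splitting field `K`: for some positive `d`, there is an isomorphism of Hopf algebras over `K`
(an isomorphism of bialgebras preserves the antipodes) between these two coordinate rings.
That `A` is finitely generated over `k` follows from this by descent. -/
def IsTorusSplitBy (k : Type u) [Field k] (A : Type u) [CommRing A] [HopfAlgebra k A]
    (K : Type u) [Field K] [Algebra k K] : Prop :=
  ∃ d : ℕ, 0 < d ∧ Nonempty ((K ⊗[k] A) ≃ₐc[K] AddMonoidAlgebra K (Fin d → ℤ))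

/-- The algebraic group over `k` with coordinate ring `A` is a `G`-torus: an algebraic torus that
has a splitting field `K`, finite Galois over `k`, with `Gal(K/k) ≃ G`. -/
def IsGTorus (G : Type v) [Group G] (k : Type u) [Field k]
    (A : Type u) [CommRing A] [HopfAlgebra k A] : Prop :=
  ∃ (K : Type u) (_ : Field K) (_ : Algebra k K),
    FiniteDimensional k K ∧ IsGalois k K ∧ Nonempty ((K ≃ₐ[k] K) ≃* G) ∧ IsTorusSplitBy k A K

/-- The coordinate ring of a torus is an integral domain, so that its fraction ring is a field,
the function field of the torus. -/
theorem IsTorusSplitBy.isDomain {k : Type u} [Field k] {A : Type u} [CommRing A] [HopfAlgebra k A]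
    {K : Type u} [Field K] [Algebra k K] (h : IsTorusSplitBy k A K) : IsDomain A := by
  obtain ⟨d, -, ⟨e⟩⟩ := h
  let f : A →+* AddMonoidAlgebra K (Fin d → ℤ) :=
    (e.toAlgEquiv : (K ⊗[k] A) →+* AddMonoidAlgebra K (Fin d → ℤ)).comp
      (Algebra.TensorProduct.includeRight (R := k) (A := K) (B := A)).toRingHom
  have hf : Function.Injective f :=
    e.injective.comp (Algebra.TensorProduct.includeRight_injective
      (FaithfulSMul.algebraMap_injective k K))
  exact hf.isDomain f

/-- The field of rational functions `L(X₁, …, X_n)` (for a field `L`). -/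
abbrev RatFunField (n : ℕ) (L : Type u) [CommRing L] : Type u :=
  FractionRing (MvPolynomial (Fin n) L)

/-- The extension field `L` of `k` is `k`-rational: `L ≃ k(X₁, …, X_n)` over `k`, for some `n`. -/
def IsRationalOver (k : Type u) [Field k] (L : Type u) [CommRing L] [Algebra k L] : Prop :=
  ∃ n : ℕ, Nonempty (L ≃ₐ[k] RatFunField n k)

/-- The extension field `L` of `k` is stably `k`-rational: `L(Y₁, …, Y_m)` is `k`-rational for
some `m`. -/
def IsStablyRationalOver (k : Type u) [Field k] (L : Type u) [CommRing L] [Algebra k L] : Prop :=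
  ∃ m : ℕ, IsRationalOver k (RatFunField m L)

/-- The torus with coordinate ring `A` is `k`-rational: its function field `Frac A` is. -/
def IsRationalTorus (k : Type u) [Field k] (A : Type u) [CommRing A] [HopfAlgebra k A] : Prop :=
  IsRationalOver k (FractionRing A)

/-- The torus with coordinate ring `A` is stably `k`-rational: its function field `Frac A` is. -/
def IsStablyRationalTorus (k : Type u) [Field k]
    (A : Type u) [CommRing A] [HopfAlgebra k A] : Prop :=
  IsStablyRationalOver k (FractionRing A)

/-!
Let `σ` generate the Galois group of `K / k`, cyclic of order `p`. A torus split by `K` is a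
`k`-form of `K[ℤ^d]` (`nonempty_twistedForm`), so it has a lattice of exponents `M = ℤ^d` on which
`σ` acts; with `X` acting as `σ`, it is a module over `ℤ[X]` annihilated by `X^p - 1`. All
questions of rationality are decided by the sublattice `CycPart p M` annihilated by the cyclotomic
polynomial `Φ_p`. It is a finite torsion-free module over the Dedekind domain `R = ℤ[X] / (Φ_p)`,
the ring of integers of `ℚ(ζ_p)`, hence zero or `R^n × I` for a nonzero ideal `I`
(`Module.exists_linearEquiv_pi_prod_ideal`), and it is free as soon as `I` is principal.

*If `CycPart p M` is free, the torus is rational* (`TwistedForm.isRationalOver`). A summand `R e`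
of `CycPart p M` gives monomials `t_i` with exponents `(1 + X + ⋯ + X^(i-1)) e`, where
`t_0 = t_p = 1`. The map `x ↦ t_1 σ(x)` permutes them cyclically, and descent for the `K`-space
they span provides `p - 1` fixed elements generating the same field
(`exists_fixed_generators_of_cyclic`). On `M / CycPart p M` the action is trivial, so that
Hilbert's Theorem 90, over the field generated so far, makes each remaining monomial fixed after
multiplication by a nonzero element of that field (`exists_fixed_of_conjugates`). Thus `K(ℤ^d)` is
generated over `K` by `d` fixed elements. They are algebraically independent and generate the
fixed field over `k`, which is the function field.

*If the torus is stably rational, `I` is principal*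
(`TwistedForm.isPrincipal_of_isStablyRationalOver`). Now `K(ℤ^d)(Y_1, …, Y_m)` is at the same time
the fraction field of `K[ℤ^d][Y_1, …, Y_m]`, with units `Kˣ × M`, and of a polynomial ring over
`K` in fixed variables, with units `Kˣ`. Both rings are factorial, and they have a common
localization `D` stable under `σ`. Modulo the units of either ring, the units of `D` are a lattice
with a basis of primes permuted by `σ` (`exists_unitValuation`), whence an exact sequence
`0 → M → Q → P → 0` with permutation lattices `P` and `Q` (`isPrincipal_of_birational`). The part
of a permutation lattice annihilated by `Φ_p` is free over `R`, up to a cokernel killed by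
`ζ - 1`, and so `R^n × I` becomes free after adding a free module, up to a cokernel killed by a
power of `ζ - 1` (`CycPart.isPrincipal_of_exact`). As `ζ - 1` generates a prime ideal, a
determinant then shows that `I` is principal (`Ideal.isPrincipal_of_comp_eq_smul`).

Together these prove that stably rational tori are rational, and that all tori are rational if `R`
is principal. Conversely, each nonzero ideal of `R` is itself the lattice of a torus
(`exists_torus_of_lattice`): the fixed ring of the corresponding semilinear action on `K[ℤ^d]` is
a Hopf algebra by Galois descent (`exists_hopfAlgebra_of_isBaseChange`). If it is stably rational,
then the ideal is principal.
-/

/-! ### The ring of integers of the cyclotomic field -/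

/-- The ring `ℤ[X] / (Φ_p)`, the ring of integers of `ℚ(ζ_p)`.  It is defined as a quotient of
`ℤ[X]` so that the kernel of `Φ_p` on a `ℤ[X]`-module is a module over it by a Mathlib instance. -/
abbrev CycRing (p : ℕ) : Type := Polynomial ℤ ⧸ Ideal.span {Polynomial.cyclotomic p ℤ}

namespace CycRing

open Polynomial

variable (p : ℕ)

/-- The class of `X` in `ℤ[X] / (Φ_p)`: a primitive `p`-th root of unity. -/
noncomputable def zeta : CycRing p := Ideal.Quotient.mk _ X

theorem cyclotomic_zeta : aeval (zeta p) (cyclotomic p ℤ) = 0 := by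
  have h : ∀ f : ℤ[X], aeval (zeta p) f = Ideal.Quotient.mk _ f := fun f => by
    conv_rhs => rw [← aeval_X_left_apply f]
    exact (aeval_algHom_apply (Ideal.Quotient.mkₐ ℤ (Ideal.span {cyclotomic p ℤ})) X f)
  rw [h, Ideal.Quotient.eq_zero_iff_mem]
  exact Ideal.mem_span_singleton_self _

variable [hp : Fact p.Prime]

/-- `ℤ[X] / (Φ_p)` is the ring of integers of `ℚ(ζ_p)`, in which `ζ - 1` is prime. -/
theorem exists_algEquiv : ∃ e : CycRing p ≃ₐ[ℤ] NumberField.RingOfIntegers (CyclotomicField p ℚ),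
    Prime (e (zeta p - 1)) := by
  have : NeZero p := ⟨hp.out.ne_zero⟩
  -- The two `ℚ`-algebra structures on the field need not be equal by definition.
  have : @IsCyclotomicExtension {p} ℚ (CyclotomicField p ℚ) _ _ DivisionRing.toRatAlgebra := by
    convert CyclotomicField.isCyclotomicExtension p ℚ
    all_goals rfl
  have hζ := IsCyclotomicExtension.zeta_spec p ℚ (CyclotomicField p ℚ)
  have hmin : minpoly ℤ hζ.integralPowerBasis.gen = cyclotomic p ℤ := by
    rw [hζ.integralPowerBasis_gen, cyclotomic_eq_minpoly hζ hp.out.pos]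
    exact (minpoly.algebraMap_eq NumberField.RingOfIntegers.coe_injective hζ.toInteger).symm
  let e : AdjoinRoot (cyclotomic p ℤ) ≃ₐ[ℤ] NumberField.RingOfIntegers (CyclotomicField p ℚ) :=
    AdjoinRoot.equiv' (cyclotomic p ℤ) hζ.integralPowerBasis
      (by rw [hmin]; simp [AdjoinRoot.aeval_eq])
      (by rw [← hmin]; exact minpoly.aeval _ _)
  refine ⟨e, ?_⟩
  have h1 : e (AdjoinRoot.root _) = hζ.toInteger := by
    rw [← hζ.integralPowerBasis_gen]
    simp [e]
  have h2 : e (AdjoinRoot.root _ - 1) = hζ.toInteger - 1 := by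
    rw [map_sub, map_one, h1]
  exact (congrArg Prime h2).mpr hζ.zeta_sub_one_prime'

instance : IsDomain (CycRing p) := by
  obtain ⟨e, -⟩ := exists_algEquiv p
  exact e.toMulEquiv.isDomain _

instance : IsDedekindDomain (CycRing p) := by
  obtain ⟨e, -⟩ := exists_algEquiv p
  let _ : Algebra (NumberField.RingOfIntegers (CyclotomicField p ℚ)) (CycRing p) :=
    e.symm.toRingEquiv.toRingHom.toAlgebra
  have hbot : IsLocalization (⊥ : Submonoid (NumberField.RingOfIntegers (CyclotomicField p ℚ)))
      (NumberField.RingOfIntegers (CyclotomicField p ℚ)) :=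
    IsLocalization.of_le_isUnit fun x hx => by simp [Submonoid.mem_bot.1 hx]
  have : IsLocalization (⊥ : Submonoid (NumberField.RingOfIntegers (CyclotomicField p ℚ)))
      (CycRing p) := by
    refine IsLocalization.isLocalization_of_algEquiv ⊥
      (AlgEquiv.ofBijective (Algebra.ofId (NumberField.RingOfIntegers (CyclotomicField p ℚ))
        (CycRing p)) e.symm.bijective)
  exact IsLocalization.isDedekindDomain (NumberField.RingOfIntegers (CyclotomicField p ℚ))
    (M := ⊥) bot_le _

/-- The class number of `ℚ(ζ_p)` is one if and only if `ℤ[X] / (Φ_p)` is principal. -/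
theorem classNumber_eq_one_iff : NumberField.classNumber (CyclotomicField p ℚ) = 1 ↔
    IsPrincipalIdealRing (CycRing p) := by
  obtain ⟨e, -⟩ := exists_algEquiv p
  rw [NumberField.classNumber_eq_one_iff]
  exact ⟨fun _ => .of_surjective e.symm e.symm.surjective,
    fun _ => .of_surjective e e.surjective⟩

theorem prime_zeta_sub_one : Prime (zeta p - 1) := by
  obtain ⟨e, he⟩ := exists_algEquiv p
  exact (MulEquiv.prime_iff e).1 he

theorem zeta_pow : zeta p ^ p = 1 := by
  have := congrArg (aeval (zeta p)) (cyclotomic_prime_mul_X_sub_one ℤ p)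
  rw [map_mul, cyclotomic_zeta, zero_mul] at this
  simpa [sub_eq_zero, eq_comm (a := (0 : CycRing p))] using this

/-- Every prime divisor of `p` divides `ζ - 1`, because `(1 + (ζ - 1))^p = 1`. -/
theorem natCast_dvd_zeta_sub_one_pow : (p : CycRing p) ∣ (zeta p - 1) ^ p := by
  obtain ⟨r, hr⟩ := exists_add_pow_prime_eq hp.out (zeta p - 1) 1
  rw [sub_add_cancel, zeta_pow, one_pow] at hr
  refine ⟨-((zeta p - 1) * 1 * r), ?_⟩
  linear_combination -hr

/-- The powers `1, ζ, …, ζ^(p-2)` form a `ℤ`-basis. -/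
noncomputable def powerBasis : PowerBasis ℤ (CycRing p) :=
  AdjoinRoot.powerBasis' (cyclotomic.monic p ℤ)

instance : Module.Finite ℤ (CycRing p) := (powerBasis p).finite

instance : Module.Free ℤ (CycRing p) := .of_basis (powerBasis p).basis

theorem finrank_int : Module.finrank ℤ (CycRing p) = p - 1 := by
  rw [(powerBasis p).finrank]
  simp [powerBasis, natDegree_cyclotomic, Nat.totient_prime hp.out]

end CycRing

/-! ### Modules over a Dedekind domain -/

section Ideal

variable {R : Type*} [CommRing R]

theorem Ideal.nonempty_linearEquiv_span_mul [IsDomain R] {a : R} (ha : a ≠ 0) (I : Ideal R) :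
    Nonempty (I ≃ₗ[R] ↥(Ideal.span {a} * I)) := by
  let f : I →ₗ[R] ↥(Ideal.span {a} * I) :=
    LinearMap.codRestrict _ (a • I.subtype) fun x =>
      Ideal.mul_mem_mul (Ideal.mem_span_singleton_self a) x.2
  refine ⟨LinearEquiv.ofBijective f ⟨fun x y h => ?_, fun ⟨y, hy⟩ => ?_⟩⟩
  · have := congrArg Subtype.val h
    exact Subtype.ext (mul_left_cancel₀ ha this)
  · obtain ⟨z, hz, rfl⟩ := Ideal.mem_span_singleton_mul.1 hy
    exact ⟨⟨z, hz⟩, rfl⟩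

theorem Matrix.det_mem_of_row_mem {ι : Type*} [Fintype ι] [DecidableEq ι] {I : Ideal R}
    (A : Matrix ι ι R) (i : ι) (h : ∀ j, A i j ∈ I) : A.det ∈ I := by
  rw [← Matrix.det_transpose, Matrix.det_apply]
  refine sum_mem fun σ _ => Submodule.smul_of_tower_mem _ _ ?_
  rw [← Finset.mul_prod_erase _ _ (Finset.mem_univ i)]
  exact I.mul_mem_right _ (h _)

/-- For comaximal ideals, `I × J ≃ R × I J`. -/
theorem Ideal.nonempty_prod_linearEquiv_of_isCoprime {I J : Ideal R} (h : IsCoprime I J) :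
    Nonempty ((I × J) ≃ₗ[R] (R × ↥(I * J))) := by
  obtain ⟨a, ha, b, hb, hab⟩ := Ideal.isCoprime_iff_exists.1 h
  let f : (I × J) →ₗ[R] R := I.subtype.coprod J.subtype
  let g : (I × J) →ₗ[R] ↥(I * J) := LinearMap.codRestrict (I * J)
    ((a • J.subtype) ∘ₗ LinearMap.snd R I J - (b • I.subtype) ∘ₗ LinearMap.fst R I J) fun z =>
      sub_mem (Ideal.mul_mem_mul ha z.2.2)
        (by rw [mul_comm]; exact Ideal.mul_mem_mul hb z.1.2)
  have hf : ∀ z, f z = z.1 + z.2 := fun z => rfl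
  have hg : ∀ z, (g z : R) = a * z.2 - b * z.1 := fun z => rfl
  refine ⟨LinearEquiv.ofBijective (f.prod g)
    ⟨(injective_iff_map_eq_zero _).2 fun z hz => ?_, fun w => ?_⟩⟩
  · have h1 : (z.1 : R) + z.2 = 0 := congrArg Prod.fst hz
    have h2 : a * (z.2 : R) - b * z.1 = 0 := congrArg (fun w => ((Prod.snd w : ↥(I * J)) : R)) hz
    refine Prod.ext (Subtype.ext ?_) (Subtype.ext ?_)
    · change (z.1 : R) = 0
      linear_combination a * h1 - h2 - (z.1 : R) * hab
    · change (z.2 : R) = 0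
      linear_combination b * h1 + h2 - (z.2 : R) * hab
  · refine ⟨(⟨w.1 * a - w.2, sub_mem (I.mul_mem_left _ ha) (Ideal.mul_le_left w.2.2)⟩,
      ⟨w.1 * b + w.2, add_mem (J.mul_mem_left _ hb) (Ideal.mul_le_right w.2.2)⟩),
      Prod.ext ?_ (Subtype.ext ?_)⟩
    · change (w.1 * a - w.2 : R) + (w.1 * b + w.2) = w.1
      linear_combination w.1 * hab
    · change a * (w.1 * b + w.2 : R) - b * (w.1 * a - w.2) = w.2
      linear_combination (w.2 : R) * hab

end Ideal

section Dedekind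

variable {R : Type*} [CommRing R] [IsDedekindDomain R]

/-- In a Dedekind domain, every ideal class contains an ideal prime to a given one. -/
theorem Ideal.exists_isCoprime_span_mul_eq {I J : Ideal R} (hI : I ≠ ⊥) (hJ : J ≠ ⊥) :
    ∃ (C : Ideal R) (a b : R), a ≠ 0 ∧ b ≠ 0 ∧ IsCoprime C J ∧
      Ideal.span {a} * I = Ideal.span {b} * C := by
  -- Any nonzero ideal has an inverse class prime to `J`; this is applied twice.
  have key : ∀ I : Ideal R, I ≠ ⊥ → ∃ (C : Ideal R) (a : R), a ≠ 0 ∧ IsCoprime C J ∧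
      I * C = Ideal.span {a} := by
    intro I hI
    have hIJ : I * J ≠ 0 := mul_ne_zero hI hJ
    obtain ⟨a₀, ha₀I, ha₀⟩ := Submodule.exists_mem_ne_zero_of_ne_bot hIJ
    obtain ⟨a, ha⟩ := IsDedekindDomain.exists_sup_span_eq (Ideal.mul_le_left (I := I) (J := J)) hIJ
    have haI : a ∈ I :=
      (le_of_eq ha : _ ≤ I) (Ideal.mem_sup_right (Ideal.mem_span_singleton_self a))
    by_cases ha0 : a = 0
    · -- Here `I J = I`, so that `J` is the unit ideal and any ideal is prime to it.
      have h1 : J = 1 := by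
        have : I * J = I * 1 := by simpa [ha0] using ha
        exact mul_left_cancel₀ hI this
      obtain ⟨C, hC⟩ := Ideal.dvd_iff_le.2
        ((Ideal.span_singleton_le_iff_mem I).2 (Ideal.mul_le_left ha₀I))
      exact ⟨C, a₀, ha₀, h1 ▸ isCoprime_one_right, hC.symm⟩
    · obtain ⟨C, hC⟩ := Ideal.dvd_iff_le.2 ((Ideal.span_singleton_le_iff_mem I).2 haI)
      refine ⟨C, a, ha0, ?_, hC.symm⟩
      rw [Ideal.isCoprime_iff_add, add_comm]
      have : I * (J + C) = I * 1 := by rw [mul_add, ← hC, mul_one]; exact ha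
      exact mul_left_cancel₀ hI this
  obtain ⟨C₀, b, hb, -, hbC⟩ := key I hI
  have hC₀ : C₀ ≠ ⊥ := by
    rintro rfl
    rw [Ideal.mul_bot, eq_comm, Ideal.span_singleton_eq_bot] at hbC
    exact hb hbC
  obtain ⟨C, a, ha, hC, haC⟩ := key C₀ hC₀
  exact ⟨C, a, b, ha, hb, hC, by rw [← haC, ← hbC]; ring⟩

/-- Steinitz: `I × J ≃ R × I J` for nonzero ideals of a Dedekind domain. -/
theorem Ideal.nonempty_prod_linearEquiv {I J : Ideal R} (hI : I ≠ ⊥) (hJ : J ≠ ⊥) :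
    Nonempty ((I × J) ≃ₗ[R] (R × ↥(I * J))) := by
  obtain ⟨C, a, b, ha, hb, hC, h⟩ := Ideal.exists_isCoprime_span_mul_eq hI hJ
  obtain ⟨e₁⟩ := Ideal.nonempty_linearEquiv_span_mul ha I
  obtain ⟨e₂⟩ := Ideal.nonempty_linearEquiv_span_mul hb C
  obtain ⟨e₃⟩ := Ideal.nonempty_linearEquiv_span_mul ha (I * J)
  obtain ⟨e₄⟩ := Ideal.nonempty_linearEquiv_span_mul hb (C * J)
  obtain ⟨e⟩ := Ideal.nonempty_prod_linearEquiv_of_isCoprime hC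
  have h' : Ideal.span {a} * (I * J) = Ideal.span {b} * (C * J) := by
    rw [← mul_assoc, h, mul_assoc]
  exact ⟨((e₁.trans (LinearEquiv.ofEq _ _ h)).trans e₂.symm).prodCongr (.refl R J) ≪≫ₗ e ≪≫ₗ
    (LinearEquiv.refl R R).prodCongr (e₄.trans ((LinearEquiv.ofEq _ _ h'.symm).trans e₃.symm))⟩

theorem Ideal.finrank_eq_one {I : Ideal R} (hI : I ≠ ⊥) : Module.finrank R I = 1 := by
  obtain ⟨a, ha, ha0⟩ := Submodule.exists_mem_ne_zero_of_ne_bot hI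
  apply le_antisymm
  · exact (LinearMap.finrank_le_finrank_of_injective (f := I.subtype)
      I.subtype_injective).trans_eq (Module.finrank_self R)
  · refine (Module.finrank_self R).symm.trans_le (LinearMap.finrank_le_finrank_of_injective
      (f := LinearMap.toSpanSingleton R I ⟨a, ha⟩) fun x y h => ?_)
    exact mul_right_cancel₀ ha0 (congrArg Subtype.val h)

theorem Module.projective_of_isTorsionFree_of_isDedekindDomain (L : Type*) [AddCommGroup L]
    [Module R L] [Module.Finite R L] [Module.IsTorsionFree R L] : Module.Projective R L :=
  have : Module.FinitePresentation R L := Module.finitePresentation_of_finite R L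
  Module.Flat.projective_of_finitePresentation

/-- A module of positive rank has a nonzero linear form, and it splits off the image of this form, a
nonzero ideal. -/
theorem Module.exists_dual_split (L : Type*) [AddCommGroup L] [Module R L] [Module.Finite R L]
    [Module.IsTorsionFree R L] (hL : Module.finrank R L ≠ 0) :
    ∃ f : L →ₗ[R] R, f.range ≠ ⊥ ∧ Nonempty (L ≃ₗ[R] f.ker × f.range) ∧
      Module.finrank R L = Module.finrank R f.ker + 1 := by
  have := Module.projective_of_isTorsionFree_of_isDedekindDomain (R := R) L
  obtain ⟨f, hf⟩ : ∃ f : L →ₗ[R] R, f ≠ 0 := by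
    by_contra! h
    have hsub : Subsingleton L := ⟨fun x y => by
      rw [← sub_eq_zero, ← Module.forall_dual_apply_eq_zero_iff R]
      intro φ
      simp [h φ]⟩
    exact hL (Module.finrank_zero_of_subsingleton)
  have hf' : f.range ≠ ⊥ := fun h => hf (LinearMap.range_eq_bot.1 h)
  have := Module.projective_of_isTorsionFree_of_isDedekindDomain (R := R) f.range
  obtain ⟨s, hs⟩ := Module.projective_lifting_property f.rangeRestrict LinearMap.id
    f.surjective_rangeRestrict
  have hs' : ∀ y, f (s y) = y := fun y => congrArg Subtype.val (LinearMap.congr_fun hs y)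
  refine ⟨f, hf', ⟨LinearEquiv.ofBijective ((LinearMap.codRestrict f.ker
    (LinearMap.id - s ∘ₗ f.rangeRestrict) fun x => ?_).prod f.rangeRestrict)
    ⟨(injective_iff_map_eq_zero _).2 fun x hx => ?_, fun ⟨x, y⟩ => ⟨x + s y, ?_⟩⟩⟩, ?_⟩
  · simp [hs']
  · have h1 : x - s (f.rangeRestrict x) = 0 := congrArg (fun z : f.ker × f.range => (z.1 : L)) hx
    have h2 : f.rangeRestrict x = 0 := congrArg Prod.snd hx
    simpa [h2] using h1
  · have hx : f x = 0 := x.2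
    have h : f.rangeRestrict (x + s y) = y := Subtype.ext (by simp [hs', hx])
    refine Prod.ext (Subtype.ext ?_) h
    change (x + s y : L) - s (f.rangeRestrict (x + s y)) = x
    rw [h, add_sub_cancel_right]
  · rw [← Submodule.finrank_quotient_add_finrank f.ker, f.quotKerEquivRange.finrank_eq,
      Ideal.finrank_eq_one hf', add_comm]

/-- Steinitz: a finitely generated torsion-free module over a Dedekind domain is a free module plus
an ideal. -/
theorem Module.exists_linearEquiv_pi_prod_ideal (n : ℕ) (L : Type*) [AddCommGroup L] [Module R L]
    [Module.Finite R L] [Module.IsTorsionFree R L] (hL : Module.finrank R L = n + 1) :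
    ∃ I : Ideal R, I ≠ ⊥ ∧ Nonempty (L ≃ₗ[R] ((Fin n → R) × I)) := by
  induction n generalizing L with
  | zero =>
    obtain ⟨f, hf, ⟨e⟩, hker⟩ := exists_dual_split (R := R) L (by lia)
    refine ⟨_, hf, ?_⟩
    have h0 : Subsingleton f.ker := by
      rw [hL, Nat.add_right_cancel_iff, eq_comm] at hker
      rw [Module.finrank_eq_zero_iff_isTorsion] at hker
      refine ⟨fun x y => ?_⟩
      obtain ⟨r, hr⟩ := @hker (x - y)
      rw [← sub_eq_zero]
      exact (smul_eq_zero_iff_right (nonZeroDivisors.ne_zero r.2)).1 hr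
    exact ⟨e.trans ((0 : f.ker ≃ₗ[R] (Fin 0 → R)).prodCongr (.refl R f.range))⟩
  | succ n ih =>
    obtain ⟨f, hf, ⟨e⟩, hker⟩ := exists_dual_split (R := R) L (by lia)
    obtain ⟨J, hJ, ⟨e'⟩⟩ := ih f.ker (by lia)
    obtain ⟨s⟩ := Ideal.nonempty_prod_linearEquiv hJ hf
    refine ⟨_, mul_ne_zero hJ hf, ⟨?_⟩⟩
    let e₁ : (f.ker × f.range) ≃ₗ[R] ((Fin n → R) × J) × f.range := e'.prodCongr (.refl R _)
    let e₂ : (((Fin n → R) × J) × f.range) ≃ₗ[R] (Fin n → R) × (J × f.range) :=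
      LinearEquiv.prodAssoc R _ _ _
    let e₃ : ((Fin n → R) × (J × f.range)) ≃ₗ[R] (Fin n → R) × (R × ↥(J * f.range)) :=
      (LinearEquiv.refl R _).prodCongr s
    let e₄ : ((Fin n → R) × (R × ↥(J * f.range))) ≃ₗ[R] ((Fin n → R) × R) × ↥(J * f.range) :=
      (LinearEquiv.prodAssoc R _ _ _).symm
    let e₅ : ((Fin n → R) × R) ≃ₗ[R] (Fin (n + 1) → R) :=
      (LinearEquiv.prodComm R _ _).trans (Fin.consLinearEquiv R fun _ => R)
    exact ((((e.trans e₁).trans e₂).trans e₃).trans e₄).trans (e₅.prodCongr (.refl R _))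

/-- An ideal that contains a principal ideal `(γ)` with a quotient killed by a power of the prime
element `π` is principal: `(γ) = I J` for a divisor `J` of a power of `(π)`, which is principal. -/
theorem Ideal.isPrincipal_of_forall_dvd {I : Ideal R} (hI : I ≠ ⊥) {π c γ : R} (hπ : Prime π)
    {N : ℕ} (hc : c ∣ π ^ N) (hγ : γ ∈ I) (h : ∀ x ∈ I, γ ∣ c * x) : I.IsPrincipal := by
  obtain ⟨J, hJ⟩ := Ideal.dvd_iff_le.2 ((Ideal.span_singleton_le_iff_mem I).2 hγ)
  have hcJ : Ideal.span {c} ≤ J := by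
    have : Ideal.span {c} * I ≤ J * I := by
      rw [mul_comm J, ← hJ]
      intro y hy
      obtain ⟨z, hz, rfl⟩ := Ideal.mem_span_singleton_mul.1 hy
      exact Ideal.mem_span_singleton.2 (h z hz)
    rw [← Ideal.dvd_iff_le] at this ⊢
    exact (mul_dvd_mul_iff_right hI).1 this
  have hJπ : J ∣ Ideal.span {π} ^ N := by
    rw [Ideal.span_singleton_pow]
    exact (Ideal.dvd_iff_le.2 hcJ).trans (Ideal.dvd_iff_le.2
      (Ideal.span_singleton_le_span_singleton.2 hc))
  have hπ' : Prime (Ideal.span {π}) := Ideal.prime_of_isPrime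
    (by simpa using hπ.ne_zero) ((Ideal.span_singleton_prime hπ.ne_zero).2 hπ)
  obtain ⟨i, -, hi⟩ := (dvd_prime_pow hπ' N).1 hJπ
  rw [associated_iff_eq, Ideal.span_singleton_pow] at hi
  rw [hi] at hJ
  obtain ⟨δ, hδ⟩ : π ^ i ∣ γ := by
    rw [← Ideal.mem_span_singleton]
    exact (le_of_eq hJ |>.trans Ideal.mul_le_right) (Ideal.mem_span_singleton_self γ)
  refine ⟨⟨δ, ?_⟩⟩
  have : Ideal.span {π ^ i} * I = Ideal.span {π ^ i} * Ideal.span {δ} := by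
    rw [mul_comm, ← hJ, hδ, Ideal.span_singleton_mul_span_singleton]
  exact mul_left_cancel₀ (by simpa using pow_ne_zero i hπ.ne_zero) this

/-- If maps between `R^κ × I` and a free module invert each other up to a power of a prime element,
then `I` is principal: the determinant of `g`, as an endomorphism of `R^(κ + 1) ⊇ R^κ × I`,
generates `I` up to a power of this prime. -/
theorem Ideal.isPrincipal_of_comp_eq_smul {I : Ideal R} (hI : I ≠ ⊥) {π c : R} (hπ : Prime π)
    {N : ℕ} (hc : c ∣ π ^ N) {κ ι : Type*} [Finite κ] [Finite ι]
    (f : ((κ → R) × I) →ₗ[R] (ι → R)) (g : (ι → R) →ₗ[R] ((κ → R) × I))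
    (hfg : ∀ x, f (g x) = c • x) (hgf : ∀ x, g (f x) = c • x) : I.IsPrincipal := by
  classical
  have := Fintype.ofFinite κ
  have := Fintype.ofFinite ι
  have hc0 : c ≠ 0 := by
    rintro rfl
    exact pow_ne_zero N hπ.ne_zero (zero_dvd_iff.1 hc)
  have hcard : Fintype.card ι = Fintype.card κ + 1 := by
    have hrank : Module.finrank R ((κ → R) × I) = Fintype.card κ + 1 := by
      have := Module.projective_of_isTorsionFree_of_isDedekindDomain (R := R) I
      obtain ⟨a, ha, ha0⟩ := Submodule.exists_mem_ne_zero_of_ne_bot hI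
      apply le_antisymm
      · refine (LinearMap.finrank_le_finrank_of_injective
          (f := (LinearMap.id (M := κ → R)).prodMap I.subtype)
          (Prod.map_injective.2 ⟨Function.injective_id, I.subtype_injective⟩)).trans_eq ?_
        simp
      · have h2 : Function.Injective (LinearMap.toSpanSingleton R I ⟨a, ha⟩) := fun x y h =>
          mul_right_cancel₀ ha0 (congrArg Subtype.val h)
        refine (Eq.trans ?_ rfl).trans_le (LinearMap.finrank_le_finrank_of_injective
          (f := (LinearMap.id (M := κ → R)).prodMap (LinearMap.toSpanSingleton R I ⟨a, ha⟩))
          (Prod.map_injective.2 ⟨Function.injective_id, h2⟩))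
        simp
    rw [← Module.finrank_pi (R := R) (ι := ι), ← hrank]
    apply le_antisymm
    · refine LinearMap.finrank_le_finrank_of_injective (f := g) fun x y h => ?_
      have := congrArg f h
      rw [hfg, hfg] at this
      exact smul_right_injective _ hc0 this
    · refine LinearMap.finrank_le_finrank_of_injective (f := f) fun x y h => ?_
      have := congrArg g h
      rw [hgf, hgf] at this
      exact smul_right_injective _ hc0 this
  obtain ⟨e⟩ : Nonempty (ι ≃ Option κ) :=
    ⟨Fintype.equivOfCardEq (by rw [hcard, Fintype.card_option])⟩
  -- The inclusion of `R^κ × I` into `R^(κ + 1)`: the index `none` is the place of `I`.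
  let inc : ((κ → R) × I) →ₗ[R] (ι → R) :=
    LinearMap.pi fun i => (e i).elim (I.subtype ∘ₗ LinearMap.snd R _ _)
      fun k => LinearMap.proj k ∘ₗ LinearMap.fst R _ _
  have hinc : ∀ z, inc z (e.symm none) ∈ I := fun z => by
    simp [inc]
  refine Ideal.isPrincipal_of_forall_dvd (c := c ^ Fintype.card ι) (γ := LinearMap.det (inc ∘ₗ g))
    hI hπ (N := N * Fintype.card ι) (by rw [pow_mul]; exact pow_dvd_pow_of_dvd hc _) ?_
    fun x hx => ?_
  · rw [← LinearMap.det_toMatrix']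
    refine Matrix.det_mem_of_row_mem _ (e.symm none) fun j => ?_
    rw [LinearMap.toMatrix'_apply]
    exact hinc _
  · -- For `x` in `I`, the matrix `diag(1, …, 1, x)` factors through `R^κ × I`.
    let m : (ι → R) →ₗ[R] ((κ → R) × I) :=
      (LinearMap.pi fun k => LinearMap.proj (e.symm (some k))).prod
        ((LinearMap.toSpanSingleton R I ⟨x, hx⟩) ∘ₗ LinearMap.proj (e.symm none))
    have h1 : (inc ∘ₗ g) ∘ₗ (f ∘ₗ m) = c • (inc ∘ₗ m) := by
      ext1 i
      ext1
      simp [hgf]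
    have h2 : LinearMap.det (inc ∘ₗ m) = x := by
      have : inc ∘ₗ m = Matrix.toLin' (Matrix.diagonal fun i => if e i = none then x else 1) := by
        apply LinearMap.ext
        intro v
        funext i
        rw [Matrix.toLin'_apply, Matrix.mulVec_diagonal]
        obtain ⟨o, rfl⟩ := e.symm.surjective i
        rcases o with _ | k
        · simp [inc, m, mul_comm]
        · simp [inc, m]
      rw [this, LinearMap.det_toLin', Matrix.det_diagonal,
        Finset.prod_eq_single (e.symm none)]
      · simp
      · intro i _ hi
        rw [if_neg]
        rintro h
        exact hi (by rw [← h, e.symm_apply_apply])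
      · simp
    refine ⟨LinearMap.det (f ∘ₗ m), ?_⟩
    rw [← LinearMap.det_comp, h1, LinearMap.det_smul, h2]
    simp

end Dedekind

/-! ### Lattices with an automorphism of prime order -/

section Lattice

open Polynomial

variable (p : ℕ)

/-- The part of a `ℤ[X]`-module on which `Φ_p` vanishes, a module over `ℤ[X] / (Φ_p)`. -/
abbrev CycPart (M : Type*) [AddCommGroup M] [Module ℤ[X] M] : Type _ :=
  Submodule.torsionBy ℤ[X] M (cyclotomic p ℤ)

variable {p} {M Q P : Type*} [AddCommGroup M] [Module ℤ[X] M] [AddCommGroup Q] [Module ℤ[X] Q]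
  [AddCommGroup P] [Module ℤ[X] P]

/-- A `ℤ[X]`-linear map restricts to the parts on which `Φ_p` vanishes. -/
noncomputable def CycPart.map (f : M →ₗ[ℤ[X]] Q) : CycPart p M →ₗ[CycRing p] CycPart p Q :=
  LinearMap.extendScalarsOfSurjective (R := ℤ[X]) Ideal.Quotient.mk_surjective
    (f.restrict fun x hx => by
      rw [Submodule.mem_torsionBy_iff] at hx ⊢
      rw [← map_smul, hx, map_zero])

@[simp]
theorem CycPart.coe_map (f : M →ₗ[ℤ[X]] Q) (x : CycPart p M) : (CycPart.map f x : Q) = f x := rfl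

/-- An additive map commuting with the action of `X` is `ℤ[X]`-linear. -/
noncomputable def AddMonoidHom.toPolynomialLinearMap (f : M →+ Q)
    (h : ∀ x, f ((X : ℤ[X]) • x) = (X : ℤ[X]) • f x) : M →ₗ[ℤ[X]] Q where
  toFun := f
  map_add' := f.map_add
  map_smul' g x := by
    simp only [RingHom.id_apply]
    induction g using Polynomial.induction_on generalizing x with
    | C a =>
      rw [show (C a : ℤ[X]) = (a : ℤ[X]) from rfl, Int.cast_smul_eq_zsmul, map_zsmul,
        Int.cast_smul_eq_zsmul]
    | add g₁ g₂ h₁ h₂ => simp only [add_smul, map_add, h₁, h₂]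
    | monomial n a ih =>
      rw [pow_succ, ← mul_assoc, mul_smul, ih, h, mul_smul _ X]

theorem X_pow_smul_of_permutation {J : Type*} (b : Module.Basis J ℤ Q)
    (π : Equiv.Perm J) (hb : ∀ j, (X : ℤ[X]) • b j = b (π j)) (i : ℕ) (j : J) :
    (X : ℤ[X]) ^ i • b j = b ((π ^ i) j) := by
  induction i with
  | zero => simp
  | succ i ih => rw [pow_succ', mul_smul, ih, hb, pow_succ' π, Equiv.Perm.mul_apply]

theorem X_pow_sub_one_smul_of_permutation {J : Type*} [Finite J] (b : Module.Basis J ℤ Q)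
    (π : Equiv.Perm J) (hπ : π ^ p = 1) (hb : ∀ j, (X : ℤ[X]) • b j = b (π j)) (w : Q) :
    (X ^ p - 1 : ℤ[X]) • w = 0 := by
  have := Fintype.ofFinite J
  rw [← b.sum_repr w, Finset.smul_sum]
  refine Finset.sum_eq_zero fun j _ => ?_
  rw [smul_comm, sub_smul, X_pow_smul_of_permutation b π hb, hπ, one_smul, Equiv.Perm.one_apply,
    sub_self, smul_zero]

variable [hp : Fact p.Prime]

/-- A permutation of prime order has all its nontrivial orbits of size `p`: they are parametrized by
a set of representatives `r` and an exponent `i < p`. -/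
theorem Equiv.Perm.exists_orbit_representatives {J : Type u} [Finite J] (π : Equiv.Perm J)
    (hπ : π ^ p = 1) : ∃ (J' : Type u) (_ : Finite J') (r : J' → J),
      Set.BijOn (fun z : J' × ℕ => (π ^ z.2) (r z.1)) {z | z.2 < p} {x | π x ≠ x} := by
  have hper : ∀ x, Function.IsPeriodicPt π p x := fun x => by
    rw [Function.IsPeriodicPt, Function.IsFixedPt, iterate_eq_pow, hπ, one_apply]
  have hmin : ∀ x, π x ≠ x → Function.minimalPeriod π x = p := fun x hx =>
    ((Nat.dvd_prime hp.out).1 (hper x).minimalPeriod_dvd).resolve_left fun h =>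
      hx (Function.minimalPeriod_eq_one_iff_isFixedPt.1 h)
  have hmod : ∀ (n : ℕ) x, (π ^ n) x = (π ^ (n % p)) x := fun n x => by
    conv_lhs => rw [← Nat.div_add_mod n p, pow_add, pow_mul, hπ, one_pow, one_mul]
  let S := SameCycle.setoid π
  have hfix : ∀ (i : ℕ) x, π ((π ^ i) x) = (π ^ i) x ↔ π x = x := fun i x => by
    rw [← mul_apply, ← pow_succ', pow_succ, mul_apply]
    exact (π ^ i).injective.eq_iff
  refine ⟨{q : Quotient S // π q.out ≠ q.out}, inferInstance, fun q => q.1.out, ?_, ?_, ?_⟩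
  · intro z _
    exact fun h => z.1.2 ((hfix _ _).1 h)
  · rintro ⟨q, i⟩ hi ⟨q', i'⟩ hi' h
    simp only at h
    have hq : q = q' := by
      refine Subtype.ext ?_
      rw [← q.1.out_eq, ← q'.1.out_eq]
      refine Quotient.sound ?_
      have h1 : π.SameCycle q.1.out ((π ^ i) q.1.out) := ⟨i, by simp⟩
      have h2 : π.SameCycle q'.1.out ((π ^ i') q'.1.out) := ⟨i', by simp⟩
      rw [← h] at h2
      exact h1.trans h2.symm
    subst hq
    have : i = i' := by
      refine Function.iterate_injOn_Iio_minimalPeriod (f := π) (x := q.1.out) ?_ ?_ ?_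
      · rw [hmin _ q.2]; exact hi
      · rw [hmin _ q.2]; exact hi'
      · simpa [iterate_eq_pow] using h
    rw [this]
  · intro x hx
    obtain ⟨n, hn⟩ : π.SameCycle (Quotient.mk S x).out x := Quotient.mk_out (s := S) x
    have hpz : (p : ℤ) ≠ 0 := by exact_mod_cast hp.out.ne_zero
    obtain ⟨m, hm⟩ : ∃ m : ℕ, (m : ℤ) = n % p :=
      ⟨(n % p).toNat, Int.toNat_of_nonneg (Int.emod_nonneg _ hpz)⟩
    have hnm : (π ^ m) (Quotient.mk S x).out = x := by
      conv_rhs => rw [← hn, ← Int.emod_add_mul_ediv n p, zpow_add, zpow_mul, zpow_natCast, hπ,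
        one_zpow, mul_one, ← hm, zpow_natCast]
    have hx' : π (Quotient.mk S x).out ≠ (Quotient.mk S x).out := fun h => by
      rw [← hfix m, hnm] at h
      exact hx h
    exact ⟨⟨⟨_, hx'⟩, m % p⟩, Nat.mod_lt _ hp.out.pos, by simpa [← hmod] using hnm⟩

/-- The part of a permutation lattice killed by `Φ_p` is free up to `ζ - 1`: a representative `j` of
a nontrivial orbit gives the element `(X - 1) e_j`, and the form `∑ i, w (π^i j) ζ^i`. -/
theorem CycPart.exists_free_of_permutation {J : Type u} [Finite J] (b : Module.Basis J ℤ Q)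
    (π : Equiv.Perm J) (hπ : π ^ p = 1) (hb : ∀ j, (X : ℤ[X]) • b j = b (π j)) :
    ∃ (J' : Type u) (_ : Finite J') (f : (J' → CycRing p) →ₗ[CycRing p] CycPart p Q)
      (g : CycPart p Q →ₗ[CycRing p] (J' → CycRing p)),
      (∀ x, g (f x) = (CycRing.zeta p - 1) • x) ∧ ∀ x, f (g x) = (CycRing.zeta p - 1) • x := by
  classical
  have := Fintype.ofFinite J
  obtain ⟨J', hJ', r, hr⟩ := π.exists_orbit_representatives hπ
  have := Fintype.ofFinite J'
  have hXpow := X_pow_smul_of_permutation b π hb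
  have hXp := X_pow_sub_one_smul_of_permutation b π hπ hb
  have hrepr : ∀ (w : Q) j, b.repr ((X : ℤ[X]) • w) (π j) = b.repr w j := fun w j => by
    have : b.coord (π j) ∘ₗ (DistribSMul.toAddMonoidHom Q (X : ℤ[X])).toIntLinearMap = b.coord j :=
      b.ext fun j' => by
        simp [hb, Finsupp.single_apply, π.injective.eq_iff]
    exact LinearMap.congr_fun this w
  -- The form belonging to a representative, on all of `Q`.
  let l₀ : J' → Q →ₗ[ℤ[X]] CycRing p := fun q => AddMonoidHom.toPolynomialLinearMap
    { toFun := fun w => ∑ i ∈ Finset.range p, b.repr w ((π ^ i) (r q)) • CycRing.zeta p ^ i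
      map_zero' := by simp
      map_add' := fun v w => by simp [add_smul, Finset.sum_add_distrib] } fun w => by
    simp only [AddMonoidHom.coe_mk, ZeroHom.coe_mk]
    have hX : ∀ y : CycRing p, (X : ℤ[X]) • y = CycRing.zeta p * y := fun y => rfl
    let F : ℕ → CycRing p := fun i => b.repr ((X : ℤ[X]) • w) ((π ^ i) (r q)) • CycRing.zeta p ^ i
    have h1 : (X : ℤ[X]) • ∑ i ∈ Finset.range p, b.repr w ((π ^ i) (r q)) • CycRing.zeta p ^ i =
        ∑ i ∈ Finset.range p, F (i + 1) := by
      rw [hX, Finset.mul_sum]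
      refine Finset.sum_congr rfl fun i _ => ?_
      simp only [F]
      rw [pow_succ' π, Equiv.Perm.mul_apply, hrepr, mul_smul_comm, pow_succ']
    have h2 : F p = F 0 := by simp [F, hπ, CycRing.zeta_pow]
    have h3 := (Finset.sum_range_succ F p).symm.trans (Finset.sum_range_succ' F p)
    rw [h2] at h3
    rw [h1]
    exact add_right_cancel h3
  have hl₀ : ∀ q w, l₀ q w =
    ∑ i ∈ Finset.range p, b.repr w ((π ^ i) (r q)) • CycRing.zeta p ^ i := fun _ _ => rfl
  let l : CycPart p Q →ₗ[CycRing p] (J' → CycRing p) := LinearMap.pi fun q =>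
    LinearMap.extendScalarsOfSurjective (R := ℤ[X]) Ideal.Quotient.mk_surjective
      (l₀ q ∘ₗ (Submodule.torsionBy ℤ[X] Q (cyclotomic p ℤ)).subtype)
  have hl : ∀ w q, l w q = l₀ q w := fun w q => rfl
  let e : J' → CycPart p Q := fun q => ⟨(X - 1 : ℤ[X]) • b (r q), by
    rw [Submodule.mem_torsionBy_iff, smul_smul, cyclotomic_prime_mul_X_sub_one, hXp]⟩
  have hz : ∀ i, i < p → ∀ q q', (π ^ i) (r q) = r q' ↔ i = 0 ∧ q = q' := fun i hi q q' => by
    refine ⟨fun h => ?_, fun h => by simp [h.1, h.2]⟩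
    have := hr.injOn (show (q, i) ∈ {z : J' × ℕ | z.2 < p} from hi)
      (show (q', 0) ∈ {z : J' × ℕ | z.2 < p} from hp.out.pos) (by simpa using h)
    simpa [and_comm] using this
  have hle : ∀ q q', l (e q') q = if q = q' then CycRing.zeta p - 1 else 0 := fun q q' => by
    have h1 : l₀ q (b (r q')) = if q = q' then 1 else 0 := by
      rw [hl₀, Finset.sum_eq_single 0]
      · have := hz 0 hp.out.pos q' q
        simp only [pow_zero, Equiv.Perm.one_apply, true_and] at this
        simp [Finsupp.single_apply, this, eq_comm]
      · intro i hi hi0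
        rw [b.repr_self, Finsupp.single_apply, if_neg, zero_smul]
        intro h
        exact hi0 ((hz i (Finset.mem_range.1 hi) _ _).1 h.symm).1
      · intro h
        exact absurd (Finset.mem_range.2 hp.out.pos) h
    have h2 : (X - 1 : ℤ[X]) • (1 : CycRing p) = CycRing.zeta p - 1 := by
      rw [sub_smul, one_smul]
      exact congrArg (· - 1) (mul_one (CycRing.zeta p))
    rw [hl]
    simp only [e]
    rw [map_smul, h1]
    split_ifs
    · exact h2
    · exact smul_zero _
  have hsmul : ∀ (f : ℤ[X]) (x : CycPart p Q),
      ((Ideal.Quotient.mk (Ideal.span {cyclotomic p ℤ}) f • x : CycPart p Q) : Q) = f • (x : Q) :=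
    fun f x => rfl
  refine ⟨J', hJ', Fintype.linearCombination (CycRing p) e, l, fun x => ?_, fun w => ?_⟩
  · funext q
    rw [Fintype.linearCombination_apply, map_sum, Finset.sum_apply, Finset.sum_eq_single q]
    · rw [map_smul, Pi.smul_apply, hle, if_pos rfl, Pi.smul_apply, smul_eq_mul, smul_eq_mul,
        mul_comm]
    · intro q' _ hq'
      rw [map_smul, Pi.smul_apply, hle, if_neg hq'.symm, smul_zero]
    · simp
  · have h1 : ∀ q, ((l w q • e q : CycPart p Q) : Q) = (X - 1 : ℤ[X]) •
        ∑ i ∈ Finset.range p, b.repr (w : Q) ((π ^ i) (r q)) • b ((π ^ i) (r q)) := fun q => by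
      have h : l w q = Ideal.Quotient.mk (Ideal.span {cyclotomic p ℤ})
          (∑ i ∈ Finset.range p, b.repr (w : Q) ((π ^ i) (r q)) • X ^ i) := by
        rw [hl, hl₀, map_sum]
        refine Finset.sum_congr rfl fun i _ => ?_
        rw [map_zsmul, map_pow]
        rfl
      rw [h, hsmul, Finset.sum_smul, Finset.smul_sum]
      refine Finset.sum_congr rfl fun i _ => ?_
      simp only [e]
      rw [smul_assoc, smul_comm (X ^ i), hXpow, smul_comm]
    have h2 : (((CycRing.zeta p - 1) • w : CycPart p Q) : Q) =
        (X - 1 : ℤ[X]) • ∑ j, b.repr (w : Q) j • b j := by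
      rw [b.sum_repr]
      exact hsmul (X - 1) w
    have h3 : (X - 1 : ℤ[X]) • ∑ j with ¬ π j ≠ j, b.repr (w : Q) j • b j = 0 := by
      rw [Finset.smul_sum]
      refine Finset.sum_eq_zero fun j hj => ?_
      have : π j = j := by simpa using hj
      rw [smul_comm, sub_smul, hb, this, one_smul, sub_self, smul_zero]
    have h4 : ∑ q, ∑ i ∈ Finset.range p, b.repr (w : Q) ((π ^ i) (r q)) • b ((π ^ i) (r q)) =
        ∑ j with π j ≠ j, b.repr (w : Q) j • b j := by
      rw [← Finset.sum_product']
      refine Finset.sum_bij (fun z _ => (π ^ z.2) (r z.1)) (fun z hz => ?_)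
        (fun z hz z' hz' h => ?_) (fun j hj => ?_) fun _ _ => rfl
      · have := hr.mapsTo (x := z) (Finset.mem_range.1 (Finset.mem_product.1 hz).2)
        simpa using this
      · exact hr.injOn (Finset.mem_range.1 (Finset.mem_product.1 hz).2)
          (Finset.mem_range.1 (Finset.mem_product.1 hz').2) h
      · obtain ⟨z, hz, h⟩ := hr.surjOn (show j ∈ {x | π x ≠ x} by simpa using hj)
        exact ⟨z, by simpa using hz, h⟩
    refine Subtype.ext ?_
    rw [h2, Fintype.linearCombination_apply, AddSubmonoidClass.coe_finsetSum]
    simp_rw [h1]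
    rw [← Finset.smul_sum, h4,
      ← Finset.sum_filter_add_sum_filter_not Finset.univ (fun j => π j ≠ j) (fun j =>
        b.repr (w : Q) j • b j), smul_add, h3, add_zero]

/-- Multiplication by `p` lifts along a surjection of `ℤ[X]/(X^p - 1)`-modules to the parts killed
by `Φ_p`, since `p - Φ_p` maps into the part killed by `Φ_p`. -/
theorem CycPart.exists_map_eq_smul (q : Q →ₗ[ℤ[X]] P) (hq : Function.Surjective q)
    (hQ : ∀ w : Q, (X ^ p - 1 : ℤ[X]) • w = 0) (y : CycPart p P) :
    ∃ x : CycPart p Q, CycPart.map q x = (p : CycRing p) • y := by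
  obtain ⟨w, hw⟩ := hq y
  obtain ⟨h, hh⟩ : (X - 1 : ℤ[X]) ∣ cyclotomic p ℤ - p := by
    rw [← C_1, dvd_iff_isRoot]
    simp [eval_one_cyclotomic_prime]
  refine ⟨⟨((p : ℤ[X]) - cyclotomic p ℤ) • w, ?_⟩, Subtype.ext ?_⟩
  · have : cyclotomic p ℤ * ((p : ℤ[X]) - cyclotomic p ℤ) = -h * (X ^ p - 1) := by
      rw [← cyclotomic_prime_mul_X_sub_one ℤ p]
      linear_combination -(cyclotomic p ℤ) * hh
    rw [Submodule.mem_torsionBy_iff, smul_smul, this, mul_smul, hQ, smul_zero]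
  · have h0 : cyclotomic p ℤ • (y : P) = 0 := y.2
    have h1 : (((p : CycRing p) • y : CycPart p P) : P) = (p : ℤ[X]) • (y : P) := by
      have : (p : CycRing p) • y = (p : ℤ[X]) • y := by
        rw [Nat.cast_smul_eq_nsmul, Nat.cast_smul_eq_nsmul]
      rw [this]; rfl
    rw [CycPart.coe_map, h1]
    simp only
    rw [map_smul, hw, sub_smul, h0, sub_zero]

/-- In an exact sequence `0 → M → Q → P → 0` with permutation lattices `Q` and `P`, the ideal class
of the part of `M` killed by `Φ_p` is trivial. -/
theorem CycPart.isPrincipal_of_exact {J₁ J₂ : Type*} [Finite J₁] [Finite J₂]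
    (i : M →ₗ[ℤ[X]] Q) (q : Q →ₗ[ℤ[X]] P) (hi : Function.Injective i) (hiq : Function.Exact i q)
    (hq : Function.Surjective q)
    (b₁ : Module.Basis J₁ ℤ Q) (π₁ : Equiv.Perm J₁) (hπ₁ : π₁ ^ p = 1)
    (hb₁ : ∀ j, (X : ℤ[X]) • b₁ j = b₁ (π₁ j))
    (b₂ : Module.Basis J₂ ℤ P) (π₂ : Equiv.Perm J₂) (hπ₂ : π₂ ^ p = 1)
    (hb₂ : ∀ j, (X : ℤ[X]) • b₂ j = b₂ (π₂ j))
    {I : Ideal (CycRing p)} (hI : I ≠ ⊥) {n : ℕ}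
    (e : CycPart p M ≃ₗ[CycRing p] (Fin n → CycRing p) × I) : I.IsPrincipal := by
  have hQ : ∀ w : Q, (X ^ p - 1 : ℤ[X]) • w = 0 :=
    X_pow_sub_one_smul_of_permutation b₁ π₁ hπ₁ hb₁
  obtain ⟨K₁, _, u₁, v₁, hvu₁, huv₁⟩ := exists_free_of_permutation b₁ π₁ hπ₁ hb₁
  obtain ⟨K₂, _, u₂, v₂, hvu₂, huv₂⟩ := exists_free_of_permutation b₂ π₂ hπ₂ hb₂
  classical
  have := Fintype.ofFinite K₂
  choose t ht using exists_map_eq_smul (p := p) q hq hQ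
  -- A lift `s` of `p u₂` along `q`.
  let s : (K₂ → CycRing p) →ₗ[CycRing p] CycPart p Q :=
    Fintype.linearCombination (CycRing p) fun k => t (u₂ (Pi.single k 1))
  have hs : ∀ y, CycPart.map q (s y) = (p : CycRing p) • u₂ y := fun y => by
    have : CycPart.map q ∘ₗ s = (p : CycRing p) • u₂ :=
      LinearMap.pi_ext' fun k => LinearMap.ext_ring (by simp [s, ht])
    exact LinearMap.congr_fun this y
  have hi' : Function.Injective (CycPart.map (p := p) i) := fun x y h =>
    Subtype.ext (hi (congrArg Subtype.val h))
  have hqi : ∀ x, CycPart.map (p := p) q (CycPart.map i x) = 0 := fun x =>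
    Subtype.ext (hiq.apply_apply_eq_zero _)
  have hex : ∀ x : CycPart p Q, CycPart.map q x = 0 → x ∈ (CycPart.map (p := p) i).range :=
    fun x hx => by
      obtain ⟨m, hm⟩ := (hiq x).1 (congrArg Subtype.val hx)
      refine ⟨⟨m, ?_⟩, Subtype.ext hm⟩
      rw [Submodule.mem_torsionBy_iff]
      refine hi ?_
      rw [map_smul, hm, map_zero]
      exact x.2
  set π : CycRing p := CycRing.zeta p - 1
  -- With `s` and `v₂` in place of a splitting, `p π - s v₂ q` maps into the kernel of `q`.
  let h : CycPart p Q →ₗ[CycRing p] CycPart p Q :=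
    ((p : CycRing p) * π) • LinearMap.id - s ∘ₗ v₂ ∘ₗ CycPart.map q
  let ie := LinearEquiv.ofInjective _ hi'
  let w : CycPart p Q →ₗ[CycRing p] CycPart p M :=
    ie.symm.toLinearMap ∘ₗ h.codRestrict _ fun x => hex _ (by
      simp [h, hs, huv₂, mul_smul])
  have hw : ∀ x, CycPart.map i (w x) = h x := fun x =>
    congrArg Subtype.val (ie.apply_symm_apply _)
  -- Up to `p π`, the sequence splits: `Q` is the sum of `M` and a free module.
  let F : (CycPart p M × (K₂ → CycRing p)) →ₗ[CycRing p] CycPart p Q :=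
    (CycPart.map i).coprod s
  let G : CycPart p Q →ₗ[CycRing p] (CycPart p M × (K₂ → CycRing p)) :=
    w.prod (v₂ ∘ₗ CycPart.map q)
  have hFG : ∀ x, F (G x) = ((p : CycRing p) * π) • x := fun x => by
    simp [F, G, hw, h]
  have hGF : ∀ x, G (F x) = ((p : CycRing p) * π) • x := fun x => by
    have h1 : v₂ (CycPart.map q (F x)) = ((p : CycRing p) * π) • x.2 := by
      simp only [F, LinearMap.coprod_apply, map_add, hqi, hs, zero_add, map_smul, hvu₂]
      exact smul_smul _ _ _
    refine Prod.ext (hi' ?_) h1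
    change CycPart.map i (w (F x)) = _
    rw [hw]
    simp only [h, LinearMap.sub_apply, LinearMap.comp_apply, h1]
    simp [F]
  let E : (((Fin n ⊕ K₂) → CycRing p) × I) ≃ₗ[CycRing p] CycPart p M × (K₂ → CycRing p) :=
    ((LinearEquiv.sumArrowLequivProdArrow (Fin n) K₂ (CycRing p) (CycRing p)).prodCongr
      (.refl _ I)).trans (((LinearEquiv.prodAssoc _ _ _ _).trans
        ((LinearEquiv.refl _ _).prodCongr (LinearEquiv.prodComm _ _ _))).trans
        ((LinearEquiv.prodAssoc _ _ _ _).symm.trans (e.symm.prodCongr (.refl _ _))))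
  refine Ideal.isPrincipal_of_comp_eq_smul hI (CycRing.prime_zeta_sub_one p)
    (c := π * ((p : CycRing p) * π)) (N := p + 2) ?_
    (v₁ ∘ₗ F ∘ₗ E.toLinearMap) (E.symm.toLinearMap ∘ₗ G ∘ₗ u₁) (fun x => ?_) fun x => ?_
  · obtain ⟨d, hd⟩ := CycRing.natCast_dvd_zeta_sub_one_pow p
    exact ⟨d, by rw [pow_add, hd]; ring⟩
  · simp only [LinearMap.comp_apply, LinearEquiv.coe_coe, LinearEquiv.apply_symm_apply, hFG,
      map_smul, hvu₁]
    rw [smul_smul, mul_comm]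
  · simp only [LinearMap.comp_apply, LinearEquiv.coe_coe, huv₁, map_smul, hGF,
      LinearEquiv.symm_apply_apply]
    exact (mul_smul π ((p : CycRing p) * π) x).symm

end Lattice

/-! ### The coordinate ring of a split torus -/

namespace AddMonoidAlgebra

/-- A unit of `K[M]` is a monomial, if `M` is for instance a torsion-free abelian group. -/
theorem exists_eq_single_of_isUnit {K M : Type*} [CommRing K] [IsDomain K] [AddCommMonoid M]
    [TwoUniqueSums M] {u : AddMonoidAlgebra K M} (hu : IsUnit u) :
    ∃ (m : M) (c : K), c ≠ 0 ∧ u = single m c := by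
  obtain ⟨v, huv⟩ := hu.exists_right_inv
  classical
  have hu0 : u ≠ 0 := fun h => by simp [h] at huv
  have hv0 : v ≠ 0 := fun h => by simp [h] at huv
  have hcard : ¬ 1 < u.coeff.support.card * v.coeff.support.card := by
    intro hlt
    obtain ⟨p₁, h₁, p₂, h₂, hne, hu₁, hu₂⟩ := TwoUniqueSums.uniqueAdd_of_one_lt_card hlt
    rw [Finset.mem_product] at h₁ h₂
    -- Two uniquely represented exponents would both occur in the product `1`.
    have key : ∀ q : M × M, q.1 ∈ u.coeff.support → q.2 ∈ v.coeff.support →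
        UniqueAdd u.coeff.support v.coeff.support q.1 q.2 → q.1 + q.2 = 0 := fun q ha hb hq => by
      have h := coeff_mul_add_of_uniqueAdd hq
      by_contra h0
      rw [huv, one_def, coeff_single, Finsupp.single_apply, if_neg (Ne.symm h0)] at h
      exact mul_ne_zero (Finsupp.mem_support_iff.1 ha) (Finsupp.mem_support_iff.1 hb) h.symm
    have e₁ := key p₁ h₁.1 h₁.2 hu₁
    have e₂ := key p₂ h₂.1 h₂.2 hu₂
    have := hu₂ h₁.1 h₁.2 (e₁.trans e₂.symm)
    exact hne (Prod.ext this.1 this.2)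
  have hu1 : 0 < u.coeff.support.card := by
    rw [Finset.card_pos, Finsupp.support_nonempty_iff]
    simpa using hu0
  have hv1 : 0 < v.coeff.support.card := by
    rw [Finset.card_pos, Finsupp.support_nonempty_iff]
    simpa using hv0
  obtain ⟨m, hm⟩ := Finset.card_eq_one.1 (show u.coeff.support.card = 1 by nlinarith)
  have hsup := Finsupp.support_eq_singleton.1 hm
  exact ⟨m, u.coeff m, hsup.1, by ext1; rw [coeff_single]; exact hsup.2⟩

variable (K : Type*) [Field K] (d : ℕ)

/-- The inclusion of exponents. -/
def exponentHom : (Fin d →₀ ℕ) →+ (Fin d → ℤ) where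
  toFun f i := f i
  map_zero' := by ext; simp
  map_add' f g := by ext; simp

theorem exponentHom_injective : Function.Injective (exponentHom d) := fun f g h => by
  ext i
  have := congrFun h i
  simpa [exponentHom] using this

/-- The inclusion of the polynomial ring into the Laurent polynomial ring. -/
noncomputable def ofMvPolynomial :
    MvPolynomial (Fin d) K →ₐ[K] AddMonoidAlgebra K (Fin d → ℤ) :=
  mapDomainAlgHom K K (exponentHom d)

theorem ofMvPolynomial_injective : Function.Injective (ofMvPolynomial K d) :=
  mapDomain_injective (exponentHom_injective d)

theorem ofMvPolynomial_monomial (s : Fin d →₀ ℕ) (c : K) :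
    ofMvPolynomial K d (MvPolynomial.monomial s c) = single (exponentHom d s) c :=
  mapDomain_single

/-- The Laurent polynomials are a localization of the polynomials. -/
theorem isLocalization_ofMvPolynomial :
    letI := (ofMvPolynomial K d).toRingHom.toAlgebra
    IsLocalization (MonoidHom.mrange (MvPolynomial.monomialOneHom K (Fin d)))
      (AddMonoidAlgebra K (Fin d → ℤ)) := by
  let _ := (ofMvPolynomial K d).toRingHom.toAlgebra
  have halg : ∀ f, algebraMap (MvPolynomial (Fin d) K) (AddMonoidAlgebra K (Fin d → ℤ)) f =
    ofMvPolynomial K d f := fun f => rfl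
  have hmon : ∀ s, ofMvPolynomial K d (MvPolynomial.monomialOneHom K (Fin d) s) =
    single (exponentHom d s.toAdd) 1 := fun s => ofMvPolynomial_monomial K d _ _
  refine ⟨?_, ?_, ?_⟩
  · rintro ⟨_, ⟨s, rfl⟩⟩
    refine (congrArg IsUnit (hmon s)).mpr ?_
    refine IsUnit.of_mul_eq_one (single (-exponentHom d s.toAdd) 1) ?_
    rw [single_mul_single, add_neg_cancel, mul_one, one_def]
  · suffices h : ∀ f : AddMonoidAlgebra K (Fin d → ℤ), ∃ (s : Fin d →₀ ℕ)
        (g : MvPolynomial (Fin d) K), f * single (exponentHom d s) 1 = ofMvPolynomial K d g by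
      intro f
      obtain ⟨s, g, hg⟩ := h f
      refine ⟨(g, ⟨_, ⟨.ofAdd s, rfl⟩⟩), ?_⟩
      rw [halg, halg, ← hg]
      exact congrArg (f * ·) (hmon (.ofAdd s))
    intro f
    induction f using AddMonoidAlgebra.induction_linear with
    | zero => exact ⟨0, 0, by simp⟩
    | add f₁ f₂ h₁ h₂ =>
      obtain ⟨s₁, g₁, h₁⟩ := h₁
      obtain ⟨s₂, g₂, h₂⟩ := h₂
      refine ⟨s₁ + s₂, g₁ * MvPolynomial.monomial s₂ 1 + g₂ * MvPolynomial.monomial s₁ 1, ?_⟩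
      rw [map_add (ofMvPolynomial K d), map_mul, map_mul, ← h₁, ← h₂, ofMvPolynomial_monomial,
        ofMvPolynomial_monomial, mul_assoc, mul_assoc, single_mul_single, single_mul_single,
        mul_one, add_mul, map_add, add_comm (exponentHom d s₂)]
    | single m c =>
      let s : Fin d →₀ ℕ := Finsupp.equivFunOnFinite.symm fun i => (-m i).toNat
      let t : Fin d →₀ ℕ := Finsupp.equivFunOnFinite.symm fun i => (m i).toNat
      refine ⟨s, MvPolynomial.monomial t c, ?_⟩
      rw [ofMvPolynomial_monomial, single_mul_single, mul_one]
      congr 1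
      funext i
      simp [exponentHom, s, t]
      lia
  · intro x y h
    rw [ofMvPolynomial_injective K d h]
    exact ⟨1, rfl⟩

instance : UniqueFactorizationMonoid (AddMonoidAlgebra K (Fin d → ℤ)) :=
  letI := (ofMvPolynomial K d).toRingHom.toAlgebra
  have := isLocalization_ofMvPolynomial K d
  UniqueFactorizationMonoid.of_isLocalization
    (MonoidHom.mrange (MvPolynomial.monomialOneHom K (Fin d))) _

end AddMonoidAlgebra

/-! ### Units of localizations of factorial rings -/

section Factorial

variable {C : Type u} [CommRing C] [IsDomain C] [UniqueFactorizationMonoid C]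
  {Ω : Type*} [Field Ω] [Algebra C Ω] [IsFractionRing C Ω]

/-- The prime elements of `C` that are inverted in `D`, up to associates. -/
theorem exists_primes_inverted (D : Submonoid Ω) (hC : ∀ c, algebraMap C Ω c ∈ D) (a : C)
    (ha0 : a ≠ 0) (hD : ∀ x ∈ D, ∃ (n : ℕ) (c : C), algebraMap C Ω a ^ n * x = algebraMap C Ω c) :
    ∃ (J : Type u) (_ : Finite J) (q : J → C), (∀ j, Prime (q j)) ∧
      (∀ i j, q i ∣ q j → i = j) ∧ (∀ j, (algebraMap C Ω (q j))⁻¹ ∈ D) ∧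
      ∀ c, Prime c → (algebraMap C Ω c)⁻¹ ∈ D → ∃ j, Associated c (q j) := by
  classical
  let o : Associates C → C := Quot.out
  let J := {P : Associates C // Prime P ∧ (algebraMap C Ω (o P))⁻¹ ∈ D}
  have hmk : ∀ P : Associates C, Associates.mk (o P) = P := fun P => Quot.out_eq P
  have hprime : ∀ j : J, Prime (o j.1) := fun j => by
    rw [← Associates.prime_mk, hmk]; exact j.2.1
  refine ⟨J, ?_, fun j => o j.1, hprime, fun i j h => ?_, fun j => j.2.2, fun c hc hcD => ?_⟩
  · refine Set.Finite.to_subtype (Set.Finite.subset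
      ((UniqueFactorizationMonoid.factors a).map Associates.mk).toFinset.finite_toSet ?_)
    rintro P ⟨hP, hPD⟩
    have hP' : Prime (o P) := by rw [← Associates.prime_mk, hmk]; exact hP
    obtain ⟨n, c, hn⟩ := hD _ hPD
    have hPa : (o P) ∣ a := by
      refine hP'.dvd_of_dvd_pow (n := n) ⟨c, IsFractionRing.injective C Ω ?_⟩
      rw [map_pow, map_mul, ← hn, mul_left_comm, mul_inv_cancel₀, mul_one]
      simpa using hP'.ne_zero
    obtain ⟨b, hb, hPb⟩ := UniqueFactorizationMonoid.exists_mem_factors_of_dvd ha0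
      hP'.irreducible hPa
    simp only [Finset.mem_coe, Multiset.mem_toFinset, Multiset.mem_map]
    exact ⟨b, hb, by rw [← hmk P]; exact (Associates.mk_eq_mk_iff_associated.2 hPb).symm⟩
  · have := (hprime i).associated_of_dvd (hprime j) h
    refine Subtype.ext ?_
    rw [← hmk i.1, ← hmk j.1]
    exact Associates.mk_eq_mk_iff_associated.2 this
  · have h : Associated c (o (Associates.mk c)) :=
      Associates.mk_eq_mk_iff_associated.1 (hmk _).symm
    refine ⟨⟨Associates.mk c, Associates.prime_mk.2 hc, ?_⟩, h⟩
    obtain ⟨w, hw⟩ := h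
    rw [← hw, map_mul, mul_inv]
    refine D.mul_mem hcD ?_
    have : (algebraMap C Ω w)⁻¹ = algebraMap C Ω ↑w⁻¹ := by
      refine inv_eq_of_mul_eq_one_right ?_
      rw [← map_mul, Units.mul_inv, map_one]
    rw [this]
    exact hC _

/-- Let `D` be a localization `C[1/a]` of a factorial ring (only its multiplicative monoid is used),
stable under an automorphism `τ`.  Modulo the units of `C`, the units of `D` are free on the primes
of `C` that are inverted in `D`, and `τ` permutes this basis. -/
theorem exists_unitValuation (D : Submonoid Ω) (hC : ∀ c, algebraMap C Ω c ∈ D) (a : C)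
    (ha0 : a ≠ 0) (ha : (algebraMap C Ω a)⁻¹ ∈ D)
    (hD : ∀ x ∈ D, ∃ (n : ℕ) (c : C), algebraMap C Ω a ^ n * x = algebraMap C Ω c)
    {p : ℕ} (τ : Ω ≃+* Ω) (τC : C ≃+* C)
    (hτC : ∀ c, τ (algebraMap C Ω c) = algebraMap C Ω (τC c))
    (hτD : ∀ x ∈ D, τ x ∈ D) (hτp : ∀ c, τC^[p] c = c) :
    ∃ (J : Type u) (_ : Finite J) (π : Equiv.Perm J) (v : Additive D.units →+ (J → ℤ)),
      π ^ p = 1 ∧ Function.Surjective v ∧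
      (∀ u : D.units, v (.ofMul u) = 0 ↔
        ∃ c : Cˣ, ((u : Ωˣ) : Ω) = algebraMap C Ω c) ∧
      ∀ u u' : D.units, ((u' : Ωˣ) : Ω) = τ ((u : Ωˣ) : Ω) →
        ∀ j, v (.ofMul u') (π j) = v (.ofMul u) j := by
  obtain ⟨J, hJ, q, hq, hqinj, hqD, hqall⟩ := exists_primes_inverted D hC a ha0 hD
  have := Fintype.ofFinite J
  classical
  let A := algebraMap C Ω
  have hA : Function.Injective A := IsFractionRing.injective C Ω
  have hqA : ∀ j, A (q j) ≠ 0 := fun j => by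
    rw [map_ne_zero_iff A hA]; exact (hq j).ne_zero
  have hAinv : ∀ x : Cˣ, A ↑x⁻¹ = (A x)⁻¹ := fun x =>
    eq_inv_of_mul_eq_one_left (by rw [← map_mul, Units.inv_mul, map_one])
  have hAz : ∀ (x : Cˣ) (k : ℤ), A ↑(x ^ k) = A x ^ k := fun x k => by
    have := congrArg Units.val (map_zpow (Units.map (A : C →* Ω)) x k)
    rw [Units.coe_map, Units.val_zpow_eq_zpow_val, Units.coe_map] at this
    exact this
  -- Existence of factorizations.
  have hex : ∀ c : C, c ≠ 0 → (A c)⁻¹ ∈ D → ∃ n : J → ℕ, Associated (∏ j, q j ^ n j) c := by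
    intro c
    induction c using UniqueFactorizationMonoid.induction_on_prime with
    | h₁ => exact fun h => absurd rfl h
    | h₂ x hx => exact fun _ _ => ⟨0, by simpa using (associated_one_iff_isUnit.2 hx).symm⟩
    | h₃ c b hc hb ih =>
      intro _ h
      have hAc : A c ≠ 0 := by rwa [map_ne_zero_iff A hA]
      have hAb : A b ≠ 0 := by rw [map_ne_zero_iff A hA]; exact hb.ne_zero
      have h1 : (A c)⁻¹ ∈ D := by
        have := D.mul_mem (hC b) h
        rwa [map_mul, mul_inv, mul_inv_cancel_left₀ hAb] at this
      have h2 : (A b)⁻¹ ∈ D := by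
        have := D.mul_mem (hC c) h
        rwa [map_mul, mul_comm (A b), mul_inv, mul_inv_cancel_left₀ hAc] at this
      obtain ⟨n, hn⟩ := ih hc h1
      obtain ⟨j, hj⟩ := hqall b hb h2
      refine ⟨n + Pi.single j 1, ?_⟩
      have : ∏ i, q i ^ (n + Pi.single j 1 : J → ℕ) i = (∏ i, q i ^ n i) * q j := by
        simp_rw [Pi.add_apply, pow_add, Finset.prod_mul_distrib]
        congr 1
        rw [Finset.prod_eq_single j]
        · simp
        · intro i _ hi; simp [hi]
        · simp
      rw [this, mul_comm b]
      exact hn.mul_mul hj.symm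
  have hexU : ∀ u : D.units, ∃ (n : J → ℤ) (w : Cˣ), ((u : Ωˣ) : Ω) = A w * ∏ j, A (q j) ^ n j := by
    intro u
    obtain ⟨hu, hu'⟩ := Submonoid.mem_units_iff _ _ |>.1 u.2
    obtain ⟨k, c, hk⟩ := hD _ hu
    have hAa : A a ≠ 0 := by rwa [map_ne_zero_iff A hA]
    have hu0 : ((u : Ωˣ) : Ω) ≠ 0 := Units.ne_zero _
    have hc0 : c ≠ 0 := by
      rintro rfl
      rw [map_zero] at hk
      exact mul_ne_zero (pow_ne_zero k hAa) hu0 hk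
    have hcD : (A c)⁻¹ ∈ D := by
      rw [show A c = A a ^ k * ((u : Ωˣ) : Ω) from hk.symm, mul_inv, ← inv_pow]
      refine D.mul_mem (D.pow_mem ha k) ?_
      rwa [← Units.val_inv_eq_inv_val]
    obtain ⟨n₁, w₁, h₁⟩ := hex c hc0 hcD
    obtain ⟨n₂, w₂, h₂⟩ := hex a ha0 ha
    refine ⟨fun j => n₁ j - k * n₂ j, w₁ * (w₂ ^ k)⁻¹, ?_⟩
    have hw₂ : A ↑(w₂ ^ k)⁻¹ = (A w₂ ^ k)⁻¹ := by
      rw [hAinv, Units.val_pow_eq_pow_val, map_pow]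
    have e₁ : A c = (∏ j, A (q j) ^ n₁ j) * A w₁ := by simp [← h₁]
    have e₂ : A a = (∏ j, A (q j) ^ n₂ j) * A w₂ := by simp [← h₂]
    have e₃ : ∏ j, A (q j) ^ ((n₁ j : ℤ) - k * n₂ j) =
        (∏ j, A (q j) ^ n₁ j) * ((∏ j, A (q j) ^ n₂ j) ^ k)⁻¹ := by
      rw [← Finset.prod_pow, ← Finset.prod_inv_distrib, ← Finset.prod_mul_distrib]
      refine Finset.prod_congr rfl fun j _ => ?_
      rw [zpow_sub₀ (hqA j), zpow_natCast, div_eq_mul_inv, ← pow_mul, mul_comm (k : ℤ)]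
      norm_cast
    have e₄ : ((u : Ωˣ) : Ω) = A c * (A a ^ k)⁻¹ := by
      rw [eq_mul_inv_iff_mul_eq₀ (pow_ne_zero k hAa), mul_comm]
      exact hk
    rw [e₄, e₁, e₂, e₃, Units.val_mul, map_mul, hw₂, mul_pow, mul_inv]
    ring
  -- Uniqueness of factorizations.
  have huniq : ∀ (n : J → ℤ) (w : Cˣ), A w * ∏ j, A (q j) ^ n j = 1 → n = 0 := by
    have key : ∀ (n : J → ℤ) (w : Cˣ), A w * ∏ j, A (q j) ^ n j = 1 → ∀ j, ¬ 0 < n j := by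
      intro n w h j hj
      have h1 : (w : C) * ∏ j, q j ^ (n j).toNat = ∏ j, q j ^ (-n j).toNat := by
        apply hA
        simp only [map_mul, map_prod, map_pow]
        have h2 : ∏ j, A (q j) ^ (n j).toNat =
            (∏ j, A (q j) ^ n j) * ∏ j, A (q j) ^ (-n j).toNat := by
          rw [← Finset.prod_mul_distrib]
          refine Finset.prod_congr rfl fun j _ => ?_
          rw [← zpow_natCast, ← zpow_natCast, ← zpow_add₀ (hqA j)]
          congr 1
          lia
        rw [h2, ← mul_assoc, h, one_mul]
      have h2 : q j ∣ ∏ j, q j ^ (-n j).toNat := by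
        rw [← h1]
        refine Dvd.dvd.mul_left ?_ _
        exact (dvd_pow_self _ (by lia)).trans (Finset.dvd_prod_of_mem _ (Finset.mem_univ j))
      obtain ⟨i, -, hi⟩ := (hq j).exists_mem_finset_dvd h2
      have := hqinj _ _ ((hq j).dvd_of_dvd_pow hi)
      subst this
      rw [show (-n j).toNat = 0 by lia, pow_zero] at hi
      exact (hq j).not_isUnit (isUnit_of_dvd_one hi)
    intro n w h
    funext j
    refine le_antisymm (not_lt.1 (key n w h j)) ?_
    have h' : A ↑w⁻¹ * ∏ j, A (q j) ^ (-n) j = 1 := by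
      simp_rw [Pi.neg_apply, zpow_neg]
      rw [hAinv, Finset.prod_inv_distrib, ← mul_inv, h, inv_one]
    have := key (-n) w⁻¹ h' j
    simp only [Pi.neg_apply] at this
    simp only [Pi.zero_apply]
    lia
  choose n w hnw using hexU
  have huniq' : ∀ (u : D.units) (m : J → ℤ) (x : Cˣ),
      ((u : Ωˣ) : Ω) = A x * ∏ j, A (q j) ^ m j → n u = m := by
    intro u m x h
    rw [← sub_eq_zero]
    refine huniq _ (w u * x⁻¹) ?_
    have h1 : ∏ j, A (q j) ^ (n u - m) j = (∏ j, A (q j) ^ n u j) * (∏ j, A (q j) ^ m j)⁻¹ := by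
      rw [← Finset.prod_inv_distrib, ← Finset.prod_mul_distrib]
      refine Finset.prod_congr rfl fun j _ => ?_
      rw [Pi.sub_apply, zpow_sub₀ (hqA j), div_eq_mul_inv]
    have h2 := (hnw u).symm.trans h
    have hx : A x ≠ 0 := by rw [map_ne_zero_iff A hA]; exact x.ne_zero
    have hm : ∏ j, A (q j) ^ m j ≠ 0 := Finset.prod_ne_zero_iff.2 fun j _ => zpow_ne_zero _ (hqA j)
    rw [h1, Units.val_mul, map_mul, hAinv]
    field_simp
    linear_combination h2
  -- The exponents of a unit, a homomorphism by uniqueness.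
  let v : Additive D.units →+ (J → ℤ) :=
    { toFun := fun u => n u.toMul
      map_zero' := huniq' 1 0 1 (by simp)
      map_add' := fun u u' => by
        refine huniq' (u.toMul * u'.toMul) _ (w u.toMul * w u'.toMul) ?_
        simp_rw [Pi.add_apply, zpow_add₀ (hqA _), Finset.prod_mul_distrib]
        rw [Subgroup.coe_mul, Units.val_mul, hnw u.toMul, hnw u'.toMul, Units.val_mul, map_mul]
        ring }
  have hv : ∀ u, v (.ofMul u) = n u := fun u => rfl
  -- The automorphism permutes the primes, up to units.
  have hτq : ∀ j, ∃ i, Associated (τC (q j)) (q i) := fun j => by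
    refine hqall _ ((MulEquiv.prime_iff τC).2 (hq j)) ?_
    rw [← hτC, ← map_inv₀]
    exact hτD _ (hqD j)
  choose f hf using hτq
  have hfinj : Function.Injective f := fun i j h => by
    have h1 := (hf i).trans (h ▸ (hf j).symm)
    refine hqinj i j ?_
    have := map_dvd τC.symm h1.dvd
    simpa using this
  let π : Equiv.Perm J := Equiv.ofBijective f (Finite.injective_iff_bijective.1 hfinj)
  refine ⟨J, hJ, π, v, ?_, ?_, ?_, ?_⟩
  · have hpow : ∀ (i : ℕ) j, Associated (τC^[i] (q j)) (q ((π ^ i) j)) := fun i j => by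
      induction i with
      | zero => exact Associated.refl _
      | succ i ih =>
        rw [Function.iterate_succ_apply', pow_succ', Equiv.Perm.mul_apply]
        exact (ih.map τC).trans (hf _)
    ext1 j
    have := hpow p j
    rw [hτp] at this
    exact (hqinj _ _ this.dvd).symm
  · intro m
    have hmem : ∀ j, Units.mk0 (A (q j)) (hqA j) ∈ D.units := fun j =>
      (Submonoid.mem_units_iff _ _).2 ⟨hC _, by
        rw [Units.val_inv_eq_inv_val]; exact hqD j⟩
    refine ⟨.ofMul (∏ j, (⟨_, hmem j⟩ : D.units) ^ m j), ?_⟩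
    rw [hv]
    refine huniq' _ _ 1 ?_
    simp
  · intro u
    rw [hv]
    refine ⟨fun h => ⟨w u, ?_⟩, fun ⟨c, hc⟩ => huniq' u 0 c ?_⟩
    · rw [hnw u, h]; simp [A]
    · rw [hc]; simp [A]
  · intro u u' h j
    choose x hx using hf
    rw [hv, hv, huniq' u' (n u ∘ π.symm) (Units.map (τC : C →* C) (w u) *
      ∏ j, (x j)⁻¹ ^ n u j) ?_]
    · simp
    · have hx' : ∀ j, A (τC (q j)) = A (q (π j)) * A ↑(x j)⁻¹ := fun j => by
        rw [← map_mul]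
        change A (τC (q j)) = A (q (f j) * ↑(x j)⁻¹)
        rw [← hx j, Units.mul_inv_cancel_right]
      have hτA : ∀ c, τ (A c) = A (τC c) := hτC
      rw [h, hnw u, map_mul, map_prod, hτA,
        ← Equiv.prod_comp π (fun j => A (q j) ^ (n u ∘ π.symm) j)]
      simp_rw [map_zpow₀, hτA]
      change A (τC (w u)) * ∏ j, A (τC (q j)) ^ n u j = _
      simp_rw [hx', mul_zpow, Finset.prod_mul_distrib]
      simp only [Units.val_mul, Units.coe_map, map_mul, Units.coe_prod, map_prod, hAz,
        Function.comp_apply, Equiv.symm_apply_apply, MonoidHom.coe_coe]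
      ring

end Factorial

/-! ### Factorial rings with the same field of fractions -/

section Birational

variable {Ω : Type*} [Field Ω]

/-- The elements of `Ω` that lie in `C` after multiplication by powers of `α` and `β`. -/
def denominatorMonoid (C : Type*) [CommRing C] [Algebra C Ω] (α β : Ω) : Submonoid Ω where
  carrier := {x | ∃ (n m : ℕ) (c : C), α ^ n * β ^ m * x = algebraMap C Ω c}
  one_mem' := ⟨0, 0, 1, by simp⟩
  mul_mem' := by
    rintro x y ⟨n, m, c, h⟩ ⟨n', m', c', h'⟩
    refine ⟨n + n', m + m', c * c', ?_⟩
    rw [map_mul, ← h, ← h']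
    ring

theorem algebraMap_mem_denominatorMonoid {C : Type*} [CommRing C] [Algebra C Ω] (α β : Ω) (c : C) :
    algebraMap C Ω c ∈ denominatorMonoid C α β :=
  ⟨0, 0, c, by simp⟩

theorem denominatorMonoid_le {C C' : Type*} [CommRing C] [Algebra C Ω] [CommRing C'] [Algebra C' Ω]
    (α β : Ω) (h : ∀ c : C, ∃ (m : ℕ) (c' : C'), β ^ m * algebraMap C Ω c = algebraMap C' Ω c') :
    denominatorMonoid C α β ≤ denominatorMonoid C' β α := by
  rintro x ⟨n, m, c, hx⟩
  obtain ⟨k, c', hc'⟩ := h c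
  refine ⟨k + m, n, c', ?_⟩
  rw [← hc', ← hx]
  ring

/-- If `β` has a power of `α` as its denominator, then the localization at `α` and `β` is a
localization at one element, the product of `α` and the numerator of `β`. -/
theorem denominatorMonoid_inverted {C : Type*} [CommRing C] [IsDomain C] [Algebra C Ω]
    [FaithfulSMul C Ω] (α : C) (β : Ω) (hα : α ≠ 0) (hβ : β ≠ 0)
    (h : ∃ (r : ℕ) (c : C), algebraMap C Ω α ^ r * β = algebraMap C Ω c) :
    ∃ a : C, a ≠ 0 ∧ (algebraMap C Ω a)⁻¹ ∈ denominatorMonoid C (algebraMap C Ω α) β ∧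
      ∀ x ∈ denominatorMonoid C (algebraMap C Ω α) β,
        ∃ (n : ℕ) (c : C), algebraMap C Ω a ^ n * x = algebraMap C Ω c := by
  obtain ⟨r, c, hc⟩ := h
  have hα' : algebraMap C Ω α ≠ 0 := by
    rwa [map_ne_zero_iff _ (FaithfulSMul.algebraMap_injective C Ω)]
  have ha : algebraMap C Ω (α * c) = algebraMap C Ω α ^ (r + 1) * β := by
    rw [map_mul, ← hc]; ring
  have ha0 : algebraMap C Ω (α * c) ≠ 0 := by
    rw [ha]; exact mul_ne_zero (pow_ne_zero _ hα') hβ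
  refine ⟨α * c, fun h => ha0 (by rw [h, map_zero]), ⟨r + 1, 1, 1, ?_⟩, ?_⟩
  · rw [pow_one, ← ha, mul_inv_cancel₀ ha0, map_one]
  · rintro x ⟨n, m, e, hx⟩
    refine ⟨n + m, α ^ ((r + 1) * m) * c ^ n * e, ?_⟩
    simp only [map_mul _ (_ * _) e, map_mul, map_pow, ← hx, ← hc]
    ring

/-- Finitely many elements of a fraction field have a common denominator. -/
theorem exists_denominator (K : Type*) [Field K] [Algebra K Ω] {C C' : Type*} [CommRing C]
    [Algebra K C] [Algebra C Ω] [IsScalarTower K C Ω] [Algebra.FiniteType K C]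
    [CommRing C'] [IsDomain C'] [Algebra K C'] [Algebra C' Ω] [IsScalarTower K C' Ω]
    [IsFractionRing C' Ω] :
    ∃ b : C', b ≠ 0 ∧ ∀ c : C, ∃ (n : ℕ) (c' : C'),
      algebraMap C' Ω b ^ n * algebraMap C Ω c = algebraMap C' Ω c' := by
  classical
  obtain ⟨s, hs⟩ := Algebra.FiniteType.out (R := K) (A := C)
  obtain ⟨b, hb⟩ := IsLocalization.exist_integer_multiples_of_finset (nonZeroDivisors C')
    (s.image (algebraMap C Ω))
  refine ⟨b, nonZeroDivisors.ne_zero b.2, fun c => ?_⟩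
  have hc : c ∈ Algebra.adjoin K (s : Set C) := hs ▸ Algebra.mem_top
  induction hc using Algebra.adjoin_induction with
  | mem x hx =>
    obtain ⟨y, hy⟩ := hb _ (Finset.mem_image_of_mem _ hx)
    exact ⟨1, y, by rw [hy, pow_one, Algebra.smul_def]⟩
  | algebraMap r =>
    exact ⟨0, algebraMap K C' r, by
      rw [pow_zero, one_mul, ← IsScalarTower.algebraMap_apply, ← IsScalarTower.algebraMap_apply]⟩
  | add x y _ _ hx hy =>
    obtain ⟨n, x', hx⟩ := hx
    obtain ⟨m, y', hy⟩ := hy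
    refine ⟨n + m, b ^ m * x' + b ^ n * y', ?_⟩
    simp only [map_add, map_mul, map_pow, ← hx, ← hy]
    ring
  | mul x y _ _ hx hy =>
    obtain ⟨n, x', hx⟩ := hx
    obtain ⟨m, y', hy⟩ := hy
    refine ⟨n + m, x' * y', ?_⟩
    simp only [map_mul, ← hx, ← hy]
    ring

/-- The denominator may be taken invariant under an automorphism of finite order. -/
theorem exists_invariant_denominator (K : Type*) [Field K] [Algebra K Ω] {C C' : Type*}
    [CommRing C] [Algebra K C] [Algebra C Ω] [IsScalarTower K C Ω] [Algebra.FiniteType K C]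
    [CommRing C'] [IsDomain C'] [Algebra K C'] [Algebra C' Ω] [IsScalarTower K C' Ω]
    [IsFractionRing C' Ω] {p : ℕ} (hp : 0 < p) (τ : C' ≃+* C') (hτ : ∀ c, τ^[p] c = c) :
    ∃ b : C', b ≠ 0 ∧ τ b = b ∧ ∀ c : C, ∃ (n : ℕ) (c' : C'),
      algebraMap C' Ω b ^ n * algebraMap C Ω c = algebraMap C' Ω c' := by
  obtain ⟨b, hb0, hb⟩ := exists_denominator (Ω := Ω) K (C := C) (C' := C')
  refine ⟨∏ i ∈ Finset.range p, τ^[i] b, ?_, ?_, fun c => ?_⟩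
  · refine Finset.prod_ne_zero_iff.2 fun i _ => ?_
    exact fun h => hb0 (τ.injective.iterate i (h.trans
      (Function.iterate_fixed (map_zero τ) i).symm))
  · rw [map_prod]
    simp_rw [← Function.iterate_succ_apply' τ]
    have h := (Finset.prod_range_succ (fun i => τ^[i] b) p).symm.trans
      (Finset.prod_range_succ' (fun i => τ^[i] b) p)
    rw [hτ, Function.iterate_zero, id_eq] at h
    exact (mul_right_cancel₀ hb0 h).symm
  · obtain ⟨d, hd⟩ := Finset.dvd_prod_of_mem (fun i => τ^[i] b) (Finset.mem_range.2 hp)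
    obtain ⟨n, c', hc⟩ := hb c
    refine ⟨n, d ^ n * c', ?_⟩
    rw [hd]
    simp only [Function.iterate_zero, id_eq, map_mul, map_pow, ← hc]
    ring

theorem Pi.single_comp_perm_symm {J : Type*} [DecidableEq J] (π : Equiv.Perm J) (j : J) :
    (Pi.single j (1 : ℤ) : J → ℤ) ∘ π.symm = Pi.single (π j) 1 := by
  funext x
  simp [Pi.single_apply, Equiv.symm_apply_eq]

open Polynomial in
/-- Let the field `Ω` with an automorphism `τ` be the fraction field of two `τ`-stable factorial
rings of finite type over `K`, one with units `Kˣ` and the other with units `Kˣ × M`.  The two rings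
have a common `τ`-stable localization; comparing the two descriptions of its units yields an exact
sequence `0 → M → Q → P → 0` with permutation lattices `Q` and `P`. -/
theorem isPrincipal_of_birational {p : ℕ} [hp : Fact p.Prime] (K : Type*) [Field K] [Algebra K Ω]
    {C₁ : Type u} {C₂ : Type v}
    [CommRing C₁] [IsDomain C₁] [UniqueFactorizationMonoid C₁] [Algebra K C₁]
    [Algebra C₁ Ω] [IsScalarTower K C₁ Ω] [IsFractionRing C₁ Ω] [Algebra.FiniteType K C₁]
    [CommRing C₂] [IsDomain C₂] [UniqueFactorizationMonoid C₂] [Algebra K C₂]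
    [Algebra C₂ Ω] [IsScalarTower K C₂ Ω] [IsFractionRing C₂ Ω] [Algebra.FiniteType K C₂]
    (τ : Ω ≃+* Ω) (τ₁ : C₁ ≃+* C₁) (τ₂ : C₂ ≃+* C₂)
    (hτ₁ : ∀ c, τ (algebraMap C₁ Ω c) = algebraMap C₁ Ω (τ₁ c))
    (hτ₂ : ∀ c, τ (algebraMap C₂ Ω c) = algebraMap C₂ Ω (τ₂ c))
    (hp₁ : ∀ c, τ₁^[p] c = c) (hp₂ : ∀ c, τ₂^[p] c = c)
    {M : Type*} [AddCommGroup M] [Module ℤ[X] M] (χ : Multiplicative M →* C₁ˣ)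
    (hχ : ∀ m : M, τ₁ (χ (.ofAdd m)) = χ (.ofAdd ((X : ℤ[X]) • m)))
    (hχ0 : ∀ (m : M) (c : K), (χ (.ofAdd m) : C₁) = algebraMap K C₁ c → m = 0)
    (hC₁ : ∀ u : C₁ˣ, ∃ (m : M) (c : K), (u : C₁) = algebraMap K C₁ c * χ (.ofAdd m))
    (hC₂ : ∀ u : C₂ˣ, ∃ c : K, (u : C₂) = algebraMap K C₂ c)
    {I : Ideal (CycRing p)} (hI : I ≠ ⊥) {n : ℕ}
    (e : CycPart p M ≃ₗ[CycRing p] (Fin n → CycRing p) × I) : I.IsPrincipal := by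
  obtain ⟨a, ha0, haτ, ha⟩ :=
    exists_invariant_denominator (Ω := Ω) K (C := C₂) hp.out.pos τ₁ hp₁
  obtain ⟨b, hb0, hbτ, hb⟩ :=
    exists_invariant_denominator (Ω := Ω) K (C := C₁) hp.out.pos τ₂ hp₂
  set α := algebraMap C₁ Ω a with hα
  set β := algebraMap C₂ Ω b with hβ
  have hα0 : α ≠ 0 := by
    rwa [hα, map_ne_zero_iff _ (IsFractionRing.injective C₁ Ω)]
  have hβ0 : β ≠ 0 := by
    rwa [hβ, map_ne_zero_iff _ (IsFractionRing.injective C₂ Ω)]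
  have hDD : denominatorMonoid C₁ α β = denominatorMonoid C₂ β α :=
    le_antisymm (denominatorMonoid_le α β hb) (denominatorMonoid_le β α ha)
  set D := denominatorMonoid C₁ α β with hD
  have : FaithfulSMul C₁ Ω := (faithfulSMul_iff_algebraMap_injective _ _).2
    (IsFractionRing.injective C₁ Ω)
  have : FaithfulSMul C₂ Ω := (faithfulSMul_iff_algebraMap_injective _ _).2
    (IsFractionRing.injective C₂ Ω)
  obtain ⟨a', ha'0, ha'D, ha'⟩ := denominatorMonoid_inverted a β ha0 hβ0 (ha b)
  obtain ⟨b', hb'0, hb'D, hb'⟩ := denominatorMonoid_inverted b α hb0 hα0 (hb a)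
  rw [← hα, ← hD] at ha'D ha'
  rw [← hβ, ← hDD] at hb'D hb'
  have hτD : ∀ x ∈ D, τ x ∈ D := by
    rintro x ⟨n, m, c, h⟩
    refine ⟨n, m, τ₁ c, ?_⟩
    rw [← hτ₁, ← h, map_mul, map_mul, map_pow, map_pow, hα, hτ₁, haτ, hβ, hτ₂, hbτ]
  have hC₁D : ∀ c, algebraMap C₁ Ω c ∈ D := algebraMap_mem_denominatorMonoid α β
  have hC₂D : ∀ c, algebraMap C₂ Ω c ∈ D := fun c => by
    rw [hDD]; exact algebraMap_mem_denominatorMonoid β α c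
  obtain ⟨J₁, _, π₁, v₁, hπ₁, hv₁, hv₁0, hv₁τ⟩ :=
    exists_unitValuation D hC₁D a' ha'0 ha'D ha' τ τ₁ hτ₁ hτD hp₁
  obtain ⟨J₂, _, π₂, v₂, hπ₂, hv₂, hv₂0, hv₂τ⟩ :=
    exists_unitValuation D hC₂D b' hb'0 hb'D hb' τ τ₂ hτ₂ hτD hp₂
  -- The action of `τ` on the units of `D`.
  have hτU : ∀ u : D.units, ∃ u' : D.units, ((u' : Ωˣ) : Ω) = τ ((u : Ωˣ) : Ω) := fun u => by
    obtain ⟨h, h'⟩ := (Submonoid.mem_units_iff _ _).1 u.2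
    refine ⟨⟨Units.map (τ : Ω →* Ω) u, (Submonoid.mem_units_iff _ _).2 ⟨hτD _ h, ?_⟩⟩, rfl⟩
    rw [← map_inv]
    exact hτD _ h'
  choose t ht using hτU
  let V₁ := Module.AEval' (LinearMap.funLeft ℤ ℤ π₁.symm)
  let V₂ := Module.AEval' (LinearMap.funLeft ℤ ℤ π₂.symm)
  let o₁ : (J₁ → ℤ) ≃ₗ[ℤ] V₁ := Module.AEval'.of _
  let o₂ : (J₂ → ℤ) ≃ₗ[ℤ] V₂ := Module.AEval'.of _
  have hX₁ : ∀ w, (X : ℤ[X]) • o₁ w = o₁ (w ∘ π₁.symm) := fun w => Module.AEval'.X_smul_of _ _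
  have hX₂ : ∀ w, (X : ℤ[X]) • o₂ w = o₂ (w ∘ π₂.symm) := fun w => Module.AEval'.X_smul_of _ _
  have ht₁ : ∀ u, v₁ (.ofMul (t u)) = v₁ (.ofMul u) ∘ π₁.symm := fun u => funext fun j => by
    rw [Function.comp_apply, ← hv₁τ u _ (ht u), Equiv.apply_symm_apply]
  have ht₂ : ∀ u, v₂ (.ofMul (t u)) = v₂ (.ofMul u) ∘ π₂.symm := fun u => funext fun j => by
    rw [Function.comp_apply, ← hv₂τ u _ (ht u), Equiv.apply_symm_apply]
  -- The monomials as units of `D`.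
  let ψ : Multiplicative M →* D.units :=
    ((Units.map (algebraMap C₁ Ω : C₁ →* Ω)).comp χ).codRestrict D.units fun m =>
      (Submonoid.mem_units_iff _ _).2 ⟨hC₁D _, by rw [← map_inv]; exact hC₁D _⟩
  have hψ : ∀ m, ((ψ m : Ωˣ) : Ω) = algebraMap C₁ Ω (χ m) := fun m => rfl
  have hψt : ∀ m : M, ψ (.ofAdd ((X : ℤ[X]) • m)) = t (ψ (.ofAdd m)) := fun m => by
    refine Subtype.ext (Units.ext ?_)
    rw [ht, hψ, hψ, hτ₁, hχ]
  let i : M →ₗ[ℤ[X]] V₂ := AddMonoidHom.toPolynomialLinearMap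
    (o₂.toAddMonoidHom.comp (v₂.comp (MonoidHom.toAdditiveRight ψ))) fun m => by
      change o₂ (v₂ (.ofMul (ψ (.ofAdd ((X : ℤ[X]) • m))))) =
        (X : ℤ[X]) • o₂ (v₂ (.ofMul (ψ (.ofAdd m))))
      rw [hψt, ht₂, hX₂]
  have hi : ∀ m, i m = o₂ (v₂ (.ofMul (ψ (.ofAdd m)))) := fun m => rfl
  have hK : ∀ (u : D.units) (c : K), ((u : Ωˣ) : Ω) = algebraMap K Ω c →
      v₁ (.ofMul u) = 0 ∧ v₂ (.ofMul u) = 0 := fun u c h => by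
    have hc : c ≠ 0 := by
      rintro rfl
      rw [map_zero] at h
      exact Units.ne_zero _ h
    have hu : IsUnit c := isUnit_iff_ne_zero.2 hc
    refine ⟨(hv₁0 u).2 ⟨(hu.map (algebraMap K C₁)).unit, ?_⟩,
      (hv₂0 u).2 ⟨(hu.map (algebraMap K C₂)).unit, ?_⟩⟩ <;>
    rw [h, IsUnit.unit_spec, ← IsScalarTower.algebraMap_apply]
  have hv₂K : ∀ u : D.units, v₂ (.ofMul u) = 0 → ∃ c : K, ((u : Ωˣ) : Ω) = algebraMap K Ω c :=
    fun u hu => by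
      obtain ⟨w, hw⟩ := (hv₂0 u).1 hu
      obtain ⟨c, hc⟩ := hC₂ w
      exact ⟨c, by rw [hw, hc, ← IsScalarTower.algebraMap_apply]⟩
  have hker : v₂.ker ≤ v₁.ker := fun u hu => by
    obtain ⟨c, hc⟩ := hv₂K u.toMul hu
    exact (hK _ c hc).1
  -- Units of `C₂` are scalars, so `v₁` factors through `v₂`; the kernel of the quotient map is `M`.
  let q₀ : (J₂ → ℤ) →+ (J₁ → ℤ) := v₂.liftOfSurjective hv₂ ⟨v₁, hker⟩
  have hq₀ : ∀ u, q₀ (v₂ u) = v₁ u := fun u => v₂.liftOfRightInverse_comp_apply _ _ ⟨v₁, hker⟩ u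
  let q : V₂ →ₗ[ℤ[X]] V₁ := AddMonoidHom.toPolynomialLinearMap
    (o₁.toAddMonoidHom.comp (q₀.comp o₂.symm.toAddMonoidHom)) fun y => by
      obtain ⟨w, rfl⟩ := o₂.surjective y
      obtain ⟨u, rfl⟩ := hv₂ w
      change o₁ (q₀ (o₂.symm ((X : ℤ[X]) • o₂ (v₂ (.ofMul u.toMul))))) =
        (X : ℤ[X]) • o₁ (q₀ (o₂.symm (o₂ (v₂ u))))
      rw [hX₂, ← ht₂, o₂.symm_apply_apply, o₂.symm_apply_apply, hq₀, hq₀, hX₁, ht₁]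
      rfl
  have hq : ∀ u, q (o₂ (v₂ u)) = o₁ (v₁ u) := fun u => by
    change o₁ (q₀ (o₂.symm (o₂ (v₂ u)))) = _
    rw [o₂.symm_apply_apply, hq₀]
  classical
  refine CycPart.isPrincipal_of_exact (p := p) i q ?_ ?_ ?_ ((Pi.basisFun ℤ J₂).map o₂) π₂ hπ₂ ?_
    ((Pi.basisFun ℤ J₁).map o₁) π₁ hπ₁ ?_ hI e
  · refine (injective_iff_map_eq_zero _).2 fun m hm => ?_
    rw [hi, LinearEquiv.map_eq_zero_iff] at hm
    obtain ⟨c, hc⟩ := hv₂K _ hm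
    rw [hψ, IsScalarTower.algebraMap_apply K C₁ Ω] at hc
    exact hχ0 m c (IsFractionRing.injective C₁ Ω hc)
  · intro y
    obtain ⟨w, rfl⟩ := o₂.surjective y
    obtain ⟨u, rfl⟩ := hv₂ w
    rw [hq, LinearEquiv.map_eq_zero_iff]
    constructor
    · intro hu
      obtain ⟨x, hx⟩ := (hv₁0 u.toMul).1 hu
      obtain ⟨m, c, hmc⟩ := hC₁ x
      refine ⟨m, ?_⟩
      rw [hi]
      congr 1
      have h1 : (((u.toMul * (ψ (.ofAdd m))⁻¹ : D.units) : Ωˣ) : Ω) = algebraMap K Ω c := by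
        rw [Subgroup.coe_mul, Units.val_mul, hx, hmc, map_mul, ← IsScalarTower.algebraMap_apply,
          ← hψ, mul_assoc, Subgroup.coe_inv, Units.mul_inv, mul_one]
      have h2 := (hK _ c h1).2
      rw [ofMul_mul, ofMul_inv, map_add, map_neg] at h2
      exact (add_neg_eq_zero.1 h2).symm
    · rintro ⟨m, hm⟩
      rw [hi, o₂.injective.eq_iff] at hm
      rw [← hq₀, ← hm, hq₀, hv₁0]
      exact ⟨_, hψ _⟩
  · intro y
    obtain ⟨w, rfl⟩ := o₁.surjective y
    obtain ⟨u, rfl⟩ := hv₁ w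
    exact ⟨_, hq u⟩
  · intro j
    rw [Module.Basis.map_apply, Module.Basis.map_apply, hX₂, Pi.basisFun_apply, Pi.basisFun_apply,
      Pi.single_comp_perm_symm]
  · intro j
    rw [Module.Basis.map_apply, Module.Basis.map_apply, hX₁, Pi.basisFun_apply, Pi.basisFun_apply,
      Pi.single_comp_perm_symm]

end Birational

/-! ### Semilinear automorphisms and Galois descent -/

section GaloisDescent

variable {k K : Type*} [Field k] [Field K] [Algebra k K] {σ : K ≃ₐ[k] K} {p : ℕ}

/-- The trace `∑ i < p, τ^i x` of an element under a map of order `p`. -/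
def cyclicTrace {V : Type*} [AddCommMonoid V] (p : ℕ) (τ : V → V) (x : V) : V :=
  ∑ i ∈ Finset.range p, τ^[i] x

theorem map_cyclicTrace {V F : Type*} [AddCommGroup V] [FunLike F V V] [AddMonoidHomClass F V V]
    (τ : F) (hτ : ∀ x, τ^[p] x = x) (x : V) : τ (cyclicTrace p τ x) = cyclicTrace p τ x := by
  rw [cyclicTrace, map_sum]
  simp_rw [← Function.iterate_succ_apply' τ]
  have h := (Finset.sum_range_succ (fun i => τ^[i] x) p).symm.trans
    (Finset.sum_range_succ' (fun i => τ^[i] x) p)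
  rw [hτ, Function.iterate_zero, id_eq] at h
  exact (add_right_cancel h).symm

theorem cyclicTrace_add {V F : Type*} [AddCommGroup V] [FunLike F V V] [AddMonoidHomClass F V V]
    (τ : F) (v w : V) : cyclicTrace p τ (v + w) = cyclicTrace p τ v + cyclicTrace p τ w := by
  simp only [cyclicTrace, iterate_map_add, Finset.sum_add_distrib]

theorem cyclicTrace_zero {V F : Type*} [AddCommGroup V] [FunLike F V V] [AddMonoidHomClass F V V]
    (τ : F) : cyclicTrace p τ 0 = 0 :=
  Finset.sum_eq_zero fun i _ => Function.iterate_fixed (map_zero τ) i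

theorem cyclicTrace_sum {V F ι : Type*} [AddCommGroup V] [FunLike F V V] [AddMonoidHomClass F V V]
    (τ : F) (s : Finset ι) (v : ι → V) :
    cyclicTrace p τ (∑ i ∈ s, v i) = ∑ i ∈ s, cyclicTrace p τ (v i) := by
  classical
  induction s using Finset.induction_on with
  | empty => exact cyclicTrace_zero τ
  | insert i s hi ih => rw [Finset.sum_insert hi, Finset.sum_insert hi, cyclicTrace_add, ih]

theorem AlgEquiv.pow_apply_eq_iterate (i : ℕ) (c : K) : (σ ^ i) c = σ^[i] c := by
  induction i with
  | zero => rfl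
  | succ i ih => rw [pow_succ', AlgEquiv.mul_apply, ih, Function.iterate_succ_apply']

theorem iterate_algEquiv_orderOf (hσ : orderOf σ = p) (c : K) : σ^[p] c = c := by
  rw [← AlgEquiv.pow_apply_eq_iterate, ← hσ, pow_orderOf_eq_one, AlgEquiv.one_apply]

theorem iterate_smul_of_semilinear {V : Type*} [AddCommGroup V] [Module K V] (τ : V → V)
    (hτ : ∀ (c : K) x, τ (c • x) = σ c • τ x) (i : ℕ) (c : K) (x : V) :
    τ^[i] (c • x) = (σ ^ i) c • τ^[i] x := by
  induction i with
  | zero => simp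
  | succ i ih =>
    rw [Function.iterate_succ_apply', ih, hτ, ← Function.iterate_succ_apply' τ, pow_succ',
      AlgEquiv.mul_apply]

theorem cyclicTrace_smul_of_fixed {V : Type*} [AddCommGroup V] [Module K V] (τ : V → V)
    (hτ : ∀ (c : K) x, τ (c • x) = σ c • τ x) {v : V} (hv : τ v = v)
    (c : K) : cyclicTrace p τ (c • v) = cyclicTrace p σ c • v := by
  rw [cyclicTrace, cyclicTrace, Finset.sum_smul]
  refine Finset.sum_congr rfl fun i _ => ?_
  rw [iterate_smul_of_semilinear τ hτ, Function.iterate_fixed hv]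
  rw [AlgEquiv.pow_apply_eq_iterate]

/-- Galois descent for vector spaces: the traces of the multiples of a vector span a subspace
containing it, because the automorphisms `σ^i` are linearly independent. -/
theorem mem_span_cyclicTrace (hσ : orderOf σ = p) (hp : 0 < p) {V : Type*} [AddCommGroup V]
    [Module K V] (τ : V → V) (hτ : ∀ (c : K) x, τ (c • x) = σ c • τ x) (x : V) :
    x ∈ Submodule.span K (Set.range fun c : K => cyclicTrace p τ (c • x)) := by
  by_contra hx
  obtain ⟨f, hfx, hf⟩ := Submodule.exists_dual_map_eq_bot_of_notMem hx inferInstance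
  have hf' : ∀ c : K, f (cyclicTrace p τ (c • x)) = 0 := fun c => by
    have := Submodule.mem_map_of_mem (f := f) (Submodule.subset_span (s := Set.range
      fun c : K => cyclicTrace p τ (c • x)) ⟨c, rfl⟩)
    rwa [hf, Submodule.mem_bot] at this
  have hli : LinearIndependent K (fun i : Fin p =>
      (((σ ^ (i : ℕ) : K ≃ₐ[k] K) : K →* K) : K → K)) := by
    refine (linearIndependent_monoidHom K K).comp
      (fun i : Fin p => ((σ ^ (i : ℕ) : K ≃ₐ[k] K) : K →* K)) fun i j h => ?_
    have h2 : σ ^ (i : ℕ) = σ ^ (j : ℕ) := AlgEquiv.ext fun c => DFunLike.congr_fun h c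
    exact Fin.ext (pow_injOn_Iio_orderOf (hσ ▸ i.2) (hσ ▸ j.2) h2)
  have h0 := Fintype.linearIndependent_iff.1 hli (fun i => f (τ^[i] x)) (by
    funext c
    have := hf' c
    rw [cyclicTrace, map_sum, Finset.sum_range] at this
    simp only [iterate_smul_of_semilinear τ hτ, map_smul, smul_eq_mul] at this
    simpa [mul_comm] using this) ⟨0, hp⟩
  exact hfx h0

theorem exists_cyclicTrace_ne_zero (hσ : orderOf σ = p) (hp : 0 < p) {V : Type*} [AddCommGroup V]
    [Module K V] (τ : V → V) (hτ : ∀ (c : K) x, τ (c • x) = σ c • τ x) {x : V} (hx : x ≠ 0) :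
    ∃ c : K, cyclicTrace p τ (c • x) ≠ 0 := by
  by_contra! h
  have := mem_span_cyclicTrace hσ hp τ hτ x
  simp only [h, Set.range_const, Submodule.span_zero_singleton, Submodule.mem_bot] at this
  exact hx this

end GaloisDescent

section FixedField

variable {k K Ω : Type*} [Field k] [Field K] [Algebra k K] [Field Ω] [Algebra K Ω]
  {σ : K ≃ₐ[k] K} {p : ℕ} (τ : Ω ≃+* Ω)

theorem semilinear_of_algebraMap (hτ : ∀ c, τ (algebraMap K Ω c) = algebraMap K Ω (σ c)) (c : K)
    (x : Ω) : τ (c • x) = σ c • τ x := by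
  rw [Algebra.smul_def, map_mul, hτ, Algebra.smul_def]

theorem iterate_mul_of_fixed {x : Ω} (hx : τ x = x) (i : ℕ) (y : Ω) :
    τ^[i] (x * y) = x * τ^[i] y := by
  induction i with
  | zero => rfl
  | succ i ih => rw [Function.iterate_succ_apply', ih, map_mul, hx, Function.iterate_succ_apply']

theorem cyclicTrace_mul_of_fixed {x : Ω} (hx : τ x = x) (y : Ω) :
    cyclicTrace p τ (x * y) = x * cyclicTrace p τ y := by
  simp only [cyclicTrace, iterate_mul_of_fixed τ hx, Finset.mul_sum]

theorem exists_algebraMap_of_fixed [FiniteDimensional k K] [IsGalois k K]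
    (hgen : ∀ g : K ≃ₐ[k] K, g ∈ Subgroup.zpowers σ) {c : K} (hc : σ c = c) :
    ∃ b : k, algebraMap k K b = c := by
  refine (IsGalois.mem_range_algebraMap_iff_fixed c).2 fun g => ?_
  have h : σ ∈ MulAction.stabilizer (K ≃ₐ[k] K) c := hc
  exact (Subgroup.zpowers_le.2 h) (hgen g)

/-- A field of `τ`-fixed elements that generates `Ω` over `K` is the whole fixed field of `τ`. -/
theorem mem_of_fixed_of_adjoin_eq_top [Algebra k Ω] [IsScalarTower k K Ω]
    [FiniteDimensional k K] [IsGalois k K]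
    (hgen : ∀ g : K ≃ₐ[k] K, g ∈ Subgroup.zpowers σ) (hσ : orderOf σ = p) (hp : 0 < p)
    (hτ : ∀ c, τ (algebraMap K Ω c) = algebraMap K Ω (σ c))
    (L : IntermediateField k Ω) (hL : ∀ x ∈ L, τ x = x)
    (hLtop : IntermediateField.adjoin K (L : Set Ω) = ⊤) {x : Ω} (hx : τ x = x) : x ∈ L := by
  have hspan : ∀ y : Ω, y ∈ Submodule.span L (Set.range (algebraMap K Ω)) := by
    have h1 : IntermediateField.adjoin L (Set.range (algebraMap K Ω)) = ⊤ := by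
      refine top_unique fun y _ => ?_
      have hy : y ∈ IntermediateField.adjoin K (L : Set Ω) := hLtop ▸ IntermediateField.mem_top
      induction hy using IntermediateField.adjoin_induction with
      | mem y hy => exact IntermediateField.algebraMap_mem _ (⟨y, hy⟩ : L)
      | algebraMap c => exact IntermediateField.subset_adjoin _ _ ⟨c, rfl⟩
      | add _ _ _ _ h h' => exact add_mem (h trivial) (h' trivial)
      | inv _ _ h => exact inv_mem (h trivial)
      | mul _ _ _ _ h h' => exact mul_mem (h trivial) (h' trivial)
    have h2 := IntermediateField.adjoin_toSubalgebra_of_isAlgebraic (F := L)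
      (S := Set.range (algebraMap K Ω)) (by
        rintro _ ⟨c, rfl⟩
        exact ((Algebra.IsAlgebraic.isAlgebraic (R := k) c).algebraMap).tower_top L)
    have h3 := Algebra.adjoin_eq_span L (Set.range (algebraMap K Ω))
    rw [show Set.range (algebraMap K Ω) = (MonoidHom.mrange (algebraMap K Ω : K →* Ω) : Set Ω) from
      rfl, Submonoid.closure_eq] at h3
    intro y
    have hy : y ∈ Algebra.adjoin L (Set.range (algebraMap K Ω)) := by
      rw [← h2, h1]; trivial
    rw [← Subalgebra.mem_toSubmodule] at hy
    exact h3 ▸ hy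
  have hT : ∀ c : K, cyclicTrace p τ (algebraMap K Ω c) ∈ L := fun c => by
    have h1 : ∀ i, τ^[i] (algebraMap K Ω c) = algebraMap K Ω (σ^[i] c) := fun i => by
      induction i with
      | zero => rfl
      | succ i ih => rw [Function.iterate_succ_apply', ih, hτ, Function.iterate_succ_apply']
    have h2 : cyclicTrace p τ (algebraMap K Ω c) = algebraMap K Ω (cyclicTrace p σ c) := by
      simp only [cyclicTrace, map_sum, h1]
    obtain ⟨b, hb⟩ := exists_algebraMap_of_fixed hgen
      (map_cyclicTrace σ (iterate_algEquiv_orderOf hσ) c)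
    rw [h2, ← hb, ← IsScalarTower.algebraMap_apply]
    exact L.algebraMap_mem b
  have hT' : ∀ y : Ω, cyclicTrace p τ y ∈ L := fun y => by
    induction hspan y using Submodule.span_induction with
    | mem y hy =>
      obtain ⟨c, rfl⟩ := hy
      exact hT c
    | zero =>
      rw [cyclicTrace_zero]; exact zero_mem L
    | add y z _ _ hy hz =>
      rw [cyclicTrace_add]; exact add_mem hy hz
    | smul l y _ hy =>
      have : cyclicTrace p τ (l • y) = l * cyclicTrace p τ y :=
        cyclicTrace_mul_of_fixed τ (hL l l.2) y
      rw [this]; exact mul_mem l.2 hy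
  obtain ⟨c, hc⟩ := exists_cyclicTrace_ne_zero hσ hp τ (semilinear_of_algebraMap τ hτ)
    (one_ne_zero (α := Ω))
  have h := cyclicTrace_mul_of_fixed (p := p) τ hx (c • 1)
  rw [eq_div_of_mul_eq hc h.symm]
  exact div_mem (hT' _) (hT' _)

/-- A form of Hilbert's Theorem 90: if all conjugates of `u` lie in `E u`, then `E u` contains a
nonzero fixed element, the trace of a multiple of `u`. -/
theorem exists_fixed_of_conjugates (hσ : orderOf σ = p) (hp : 0 < p)
    (hτ : ∀ c, τ (algebraMap K Ω c) = algebraMap K Ω (σ c)) (hτp : ∀ x, τ^[p] x = x)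
    (E : IntermediateField K Ω) {u : Ω} (hu : u ≠ 0) (hE : ∀ i, τ^[i] u / u ∈ E) :
    ∃ w, τ w = w ∧ ∃ e ∈ E, e ≠ 0 ∧ w = e * u := by
  have hs := semilinear_of_algebraMap τ hτ
  obtain ⟨c, hc⟩ := exists_cyclicTrace_ne_zero hσ hp τ hs hu
  refine ⟨_, map_cyclicTrace τ hτp (c • u), cyclicTrace p τ (c • u) / u, ?_, div_ne_zero hc hu,
    (div_mul_cancel₀ _ hu).symm⟩
  rw [cyclicTrace, Finset.sum_div]
  refine sum_mem fun i _ => ?_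
  have h : τ^[i] (c • u) / u = (σ ^ i) c • (τ^[i] u / u) := by
    rw [← smul_div_assoc]
    exact congrArg (· / u) (iterate_smul_of_semilinear τ hs i c u)
  rw [h]
  exact E.smul_mem (hE i)

/-- A spanning set of a finite-dimensional space contains a basis. -/
theorem exists_finset_subset_of_span_le_span {V : Type*} [AddCommGroup V] [Module K V]
    {s : Finset V} {W : Set V} (hs : Submodule.span K (s : Set V) ≤ Submodule.span K W)
    (hW : W ⊆ Submodule.span K (s : Set V)) :
    ∃ b : Finset V, (b : Set V) ⊆ W ∧ (∀ y ∈ b, y ∈ Submodule.span K (s : Set V)) ∧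
      (∀ y ∈ b, y ≠ 0) ∧ Submodule.span K (s : Set V) = Submodule.span K (b : Set V) ∧
      b.card ≤ s.card := by
  obtain ⟨b, hbW, hbspan, hbli⟩ := exists_linearIndependent K W
  have hle : Set.range ((↑) : b → V) ⊆ Submodule.span K (s : Set V) := by
    rintro _ ⟨y, rfl⟩
    exact hW (hbW y.2)
  have hfin : Finite b := hbli.finite_of_le_span_finite _ (s : Set V) hle
  have := Fintype.ofFinite b
  refine ⟨b.toFinset, by simpa using hbW, fun y hy => hW (hbW (by simpa using hy)),
    fun y hy => hbli.ne_zero (⟨y, by simpa using hy⟩ : b), ?_, ?_⟩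
  · rw [Set.coe_toFinset, hbspan]
    exact le_antisymm hs (Submodule.span_le.2 hW)
  · rw [Set.toFinset_card]
    simpa using linearIndependent_le_span' _ hbli (s : Set V) hle

/-- Think of `t 0, …, t (p - 1)` as homogeneous coordinates permuted cyclically by `τ`.  The field
generated by their quotients is generated by fixed elements, the quotients of coordinates that are
fixed after a `K`-linear change. -/
theorem exists_fixed_generators_of_cyclic (hσ : orderOf σ = p) (hp : 0 < p)
    (hτ : ∀ c, τ (algebraMap K Ω c) = algebraMap K Ω (σ c))
    (t : ℕ → Ω) (ht0 : t 0 = 1) (htp : t p = 1) (hne : ∀ i, t i ≠ 0)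
    (ht : ∀ i, t 1 * τ (t i) = t (i + 1)) :
    ∃ S : Finset Ω, S.card ≤ p - 1 ∧ (∀ x ∈ S, τ x = x) ∧
      ∀ i, t i ∈ IntermediateField.adjoin K (S : Set Ω) := by
  classical
  -- The twisted action `x ↦ t 1 * τ x`, which permutes the `t i` cyclically.
  let τ' : Ω →+ Ω := (AddMonoidHom.mulLeft (t 1)).comp (τ : Ω →+ Ω)
  have hτ' : ∀ x, τ' x = t 1 * τ x := fun x => rfl
  have hs : ∀ (c : K) x, τ' (c • x) = σ c • τ' x := fun c x => by
    rw [hτ', semilinear_of_algebraMap τ hτ, mul_smul_comm, hτ']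
  have hit : ∀ i j, τ'^[i] (t j) = t (i + j) := fun i j => by
    induction i with
    | zero => simp
    | succ i ih => rw [Function.iterate_succ_apply', ih, hτ', ht]; congr 1; ring
  let V : Submodule K Ω := Submodule.span K (t '' Set.Iio p)
  have hperiod : ∀ i, t (i + p) = t i := fun i => by
    induction i with
    | zero => rw [zero_add, htp, ht0]
    | succ i ih => rw [add_right_comm, ← ht, ih, ht]
  have htV : ∀ i, t i ∈ V := fun i => by
    have : t i = t (i % p) := by
      conv_lhs => rw [← Nat.mod_add_div i p]
      generalize i / p = n
      induction n with
      | zero => rfl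
      | succ n ih => rw [mul_add, mul_one, ← add_assoc, hperiod, ih]
    rw [this]
    exact Submodule.subset_span ⟨_, Nat.mod_lt _ hp, rfl⟩
  -- `V` is spanned by the elements fixed by the twisted action.
  let W : Set Ω := {y | y ∈ V ∧ τ' y = y}
  have hVW : V ≤ Submodule.span K W := by
    refine Submodule.span_le.2 ?_
    rintro _ ⟨j, -, rfl⟩
    refine Submodule.span_mono ?_ (mem_span_cyclicTrace hσ hp τ' hs (t j))
    rintro _ ⟨c, rfl⟩
    let F : ℕ → Ω := fun i => (σ ^ i) c • t (i + j)
    have hF : cyclicTrace p τ' (c • t j) = ∑ i ∈ Finset.range p, F i :=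
      Finset.sum_congr rfl fun i _ => by
        rw [iterate_smul_of_semilinear (K := K) τ' hs, hit]
    have hFs : ∀ i, τ' (F i) = F (i + 1) := fun i => by
      simp only [F]
      rw [hs, hτ', ht, pow_succ', AlgEquiv.mul_apply, add_right_comm]
    have hFp : F p = F 0 := by
      simp only [F]
      rw [← hσ, pow_orderOf_eq_one, hσ, pow_zero, add_comm p, hperiod, zero_add]
    change cyclicTrace p τ' (c • t j) ∈ W
    rw [hF]
    refine ⟨sum_mem fun i _ => V.smul_mem _ (htV _), ?_⟩
    rw [map_sum, Finset.sum_congr rfl fun i _ => hFs i]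
    have h := (Finset.sum_range_succ F p).symm.trans (Finset.sum_range_succ' F p)
    rw [hFp] at h
    exact (add_right_cancel h).symm
  obtain ⟨b, hbW, -, hb0, hVb, hbcard⟩ := exists_finset_subset_of_span_le_span (K := K)
    (s := (Finset.range p).image t) (W := W)
    (by rw [Finset.coe_image, Finset.coe_range]; exact hVW) fun y hy => by
      rw [Finset.coe_image, Finset.coe_range]; exact hy.1
  rw [Finset.coe_image, Finset.coe_range] at hVb
  change V = _ at hVb
  have hbcard : b.card ≤ p :=
    hbcard.trans (Finset.card_image_le.trans_eq (Finset.card_range p))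
  have hbne : ∃ y₀, y₀ ∈ b := by
    by_contra! h
    have h1 : t 0 ∈ Submodule.span K b := hVb ▸ htV 0
    rw [Finset.eq_empty_of_forall_notMem h, Finset.coe_empty, Submodule.span_empty,
      Submodule.mem_bot] at h1
    exact hne 0 h1
  obtain ⟨y₀, hy₀⟩ := hbne
  have hy₀0 : y₀ ≠ 0 := hb0 y₀ hy₀
  refine ⟨(b.erase y₀).image (· / y₀), ?_, ?_, fun i => ?_⟩
  · refine Finset.card_image_le.trans ?_
    rw [Finset.card_erase_of_mem (hy₀)]
    exact Nat.sub_le_sub_right hbcard 1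
  · intro x hx
    obtain ⟨y, hy, rfl⟩ := Finset.mem_image.1 hx
    have h1 := (hbW ((Finset.mem_of_mem_erase hy))).2
    have h2 := (hbW hy₀).2
    rw [hτ'] at h1 h2
    rw [map_div₀]
    conv_rhs => rw [← h1, ← h2]
    exact (mul_div_mul_left _ _ (hne 1)).symm
  · -- As `t 0 = 1`, each `t i` is a quotient of two elements of `V`.
    set E := IntermediateField.adjoin K
      (((b.erase y₀).image (· / y₀) : Finset Ω) : Set Ω) with hE
    have h1 : ∀ y ∈ V, y / y₀ ∈ E := fun y hy => by
      rw [hVb] at hy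
      induction hy using Submodule.span_induction with
      | mem y hy =>
        by_cases h : y = y₀
        · rw [h, div_self hy₀0]; exact one_mem E
        · exact IntermediateField.subset_adjoin _ _ (Finset.mem_coe.2 (Finset.mem_image.2
            ⟨y, Finset.mem_erase.2 ⟨h, hy⟩, rfl⟩))
      | zero => rw [zero_div]; exact zero_mem E
      | add x y _ _ hx hy => rw [add_div]; exact add_mem hx hy
      | smul c y _ hy => rw [smul_div_assoc]; exact E.smul_mem hy
    have h2 : t i = (t i / y₀) / (t 0 / y₀) := by
      rw [div_div_div_cancel_right₀ hy₀0, ht0, div_one]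
    rw [h2]
    exact div_mem (h1 _ (htV i)) (h1 _ (htV 0))

end FixedField

/-! ### Rational fixed fields -/

section FixedGenerators

open Polynomial

variable {k K Ω : Type*} [Field k] [Field K] [Algebra k K] [Field Ω] [Algebra K Ω]
  {σ : K ≃ₐ[k] K} {p : ℕ} [hp : Fact p.Prime] (τ : Ω ≃+* Ω)
  {M : Type*} [AddCommGroup M] (χ : Multiplicative M →* Ωˣ)

/-- The characters whose values lie in a subfield. -/
def charactersIn (E : IntermediateField K Ω) : AddSubgroup M where
  carrier := {m | (χ (.ofAdd m) : Ω) ∈ E}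
  zero_mem' := by simp
  add_mem' {m n} hm hn := by
    simp only [Set.mem_ofPred_eq, ofAdd_add, map_mul, Units.val_mul] at *
    exact mul_mem hm hn
  neg_mem' {m} hm := by
    simp only [Set.mem_ofPred_eq, ofAdd_neg, map_inv, Units.val_inv_eq_inv_val] at *
    exact inv_mem hm

theorem mem_charactersIn {E : IntermediateField K Ω} {m : M} :
    m ∈ charactersIn χ E ↔ (χ (.ofAdd m) : Ω) ∈ E := Iff.rfl

variable [Module ℤ[X] M]

theorem iterate_character (hχ : ∀ m : M, τ (χ (.ofAdd m)) = χ (.ofAdd ((X : ℤ[X]) • m))) (i : ℕ)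
    (m : M) : τ^[i] (χ (.ofAdd m)) = χ (.ofAdd ((X : ℤ[X]) ^ i • m)) := by
  induction i with
  | zero => simp
  | succ i ih => rw [Function.iterate_succ_apply', ih, hχ, smul_smul, pow_succ']

/-- The characters in the `ℤ[X] / (Φ_p)`-submodule generated by one element `e` lie in a field
generated by `p - 1` fixed elements. -/
theorem exists_fixed_generators_of_mem_cycPart (hσ : orderOf σ = p)
    (hτ : ∀ c, τ (algebraMap K Ω c) = algebraMap K Ω (σ c))
    (hχ : ∀ m : M, τ (χ (.ofAdd m)) = χ (.ofAdd ((X : ℤ[X]) • m))) (e : CycPart p M) :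
    ∃ S : Finset Ω, S.card ≤ p - 1 ∧ (∀ x ∈ S, τ x = x) ∧
      ∀ c : CycRing p, ((c • e : CycPart p M) : M) ∈
        charactersIn χ (IntermediateField.adjoin K (S : Set Ω)) := by
  -- The exponents `g i e` run through `0, e, (1 + X) e, …, Φ_p e = 0`.
  let g : ℕ → ℤ[X] := fun i => ∑ j ∈ Finset.range i, X ^ j
  have hg : ∀ i, 1 + X * g i = g (i + 1) := fun i => by
    simp only [g]
    rw [Finset.sum_range_succ', Finset.mul_sum, add_comm, pow_zero]
    simp_rw [pow_succ']
  let t : ℕ → Ω := fun i => χ (.ofAdd (g i • (e : M)))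
  obtain ⟨S, hS, hSτ, hSt⟩ := exists_fixed_generators_of_cyclic τ hσ hp.out.pos hτ t
    (by simp [t, g]) (by
      have h : cyclotomic p ℤ • (e : M) = 0 := e.2
      simp only [t, g]
      rw [← cyclotomic_prime ℤ p, h]
      simp) (fun i => Units.ne_zero _) (fun i => by
      simp only [t]
      rw [hχ, ← Units.val_mul, ← map_mul, ← ofAdd_add, ← hg i, smul_smul, add_smul, one_smul]
      simp [g])
  refine ⟨S, hS, hSτ, fun c => ?_⟩
  obtain ⟨f, rfl⟩ := Ideal.Quotient.mk_surjective c
  change f • (e : M) ∈ _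
  have hX : ∀ i, (X ^ i : ℤ[X]) • (e : M) ∈
      charactersIn χ (IntermediateField.adjoin K (S : Set Ω)) := fun i => by
      have : (X ^ i : ℤ[X]) = g (i + 1) - g i := by
        simp only [g]
        rw [Finset.sum_range_succ, add_sub_cancel_left]
      rw [this, sub_smul]
      exact sub_mem (hSt _) (hSt _)
  induction f using Polynomial.induction_on' with
  | add f g hf hg => rw [add_smul]; exact add_mem hf hg
  | monomial n a =>
    rw [← C_mul_X_pow_eq_monomial, mul_smul, show (C a : ℤ[X]) = (a : ℤ[X]) from rfl,
      Int.cast_smul_eq_zsmul]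
    exact zsmul_mem (hX n) a

/-- Modulo the part killed by `Φ_p`, the lattice is generated by as many elements as the ranks
require. -/
theorem finrank_eq_add_of_cycPart [Module.Finite ℤ M] [Module.Free ℤ M] {r : ℕ}
    (e : CycPart p M ≃ₗ[CycRing p] (Fin r → CycRing p)) :
    ∃ (a : ℕ) (m : Fin a → M), Module.finrank ℤ M = r * (p - 1) + a ∧
      ∀ x : M, ∃ c : Fin a → ℤ, x - ∑ i, c i • m i ∈
        Submodule.torsionBy ℤ[X] M (cyclotomic p ℤ) := by
  let f : M →ₗ[ℤ] M := (DistribSMul.toAddMonoidHom M (cyclotomic p ℤ)).toIntLinearMap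
  have hf : ∀ x, f x = cyclotomic p ℤ • x := fun x => rfl
  let b := Module.finBasis ℤ (LinearMap.range f)
  choose m hm using fun i => (b i).2
  refine ⟨_, m, ?_, fun x => ⟨b.repr ⟨f x, x, rfl⟩, ?_⟩⟩
  · rw [← Submodule.finrank_quotient_add_finrank (LinearMap.ker f), add_comm,
      f.quotKerEquivRange.finrank_eq]
    congr 1
    let e₁ : LinearMap.ker f ≃+ CycPart p M :=
      { toFun := fun x => ⟨x.1, x.2⟩
        invFun := fun x => ⟨x.1, x.2⟩
        left_inv := fun x => rfl
        right_inv := fun x => rfl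
        map_add' := fun x y => rfl }
    rw [(e₁.trans e.toAddEquiv).toIntLinearEquiv.finrank_eq, Module.finrank_pi_fintype,
      Finset.sum_const, Finset.card_univ, Fintype.card_fin, CycRing.finrank_int, smul_eq_mul]
  · rw [Submodule.mem_torsionBy_iff, ← hf, map_sub, map_sum, sub_eq_zero]
    have := congrArg Subtype.val (b.sum_repr ⟨f x, x, rfl⟩)
    rw [AddSubmonoidClass.coe_finsetSum] at this
    simp only [map_zsmul, hm]
    exact this.symm

/-- If the part of the character lattice killed by `Φ_p` is free over `ℤ[X] / (Φ_p)`, then the field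
generated by the characters is generated by fixed elements, at most as many as the rank of the
lattice. -/
theorem exists_fixed_generators (hσ : orderOf σ = p)
    (hτ : ∀ c, τ (algebraMap K Ω c) = algebraMap K Ω (σ c)) (hτp : ∀ x, τ^[p] x = x)
    (hχ : ∀ m : M, τ (χ (.ofAdd m)) = χ (.ofAdd ((X : ℤ[X]) • m)))
    (hM : ∀ m : M, (X ^ p - 1 : ℤ[X]) • m = 0) [Module.Finite ℤ M] [Module.Free ℤ M] {r : ℕ}
    (e : CycPart p M ≃ₗ[CycRing p] (Fin r → CycRing p)) :
    ∃ S : Finset Ω, S.card ≤ Module.finrank ℤ M ∧ (∀ x ∈ S, τ x = x) ∧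
      ∀ m, m ∈ charactersIn χ (IntermediateField.adjoin K (S : Set Ω)) := by
  classical
  obtain ⟨a, m, hrank, hm⟩ := finrank_eq_add_of_cycPart e
  choose S hS hSτ hSe using fun l : Fin r =>
    exists_fixed_generators_of_mem_cycPart τ χ hσ hτ hχ (e.symm (Pi.single l 1))
  let S₁ := Finset.univ.biUnion S
  have hL : ∀ x : CycPart p M, (x : M) ∈
      charactersIn χ (IntermediateField.adjoin K (S₁ : Set Ω)) := fun x => by
    have h1 : x = ∑ l, e x l • e.symm (Pi.single l 1) := by
      rw [← e.injective.eq_iff, map_sum]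
      simp_rw [map_smul, e.apply_symm_apply]
      exact pi_eq_sum_univ' (e x)
    rw [h1, AddSubmonoidClass.coe_finsetSum]
    refine sum_mem fun l _ => ?_
    refine (IntermediateField.adjoin.mono K _ _ ?_) (hSe l (e x l))
    exact Finset.coe_subset.2 (Finset.subset_biUnion_of_mem S (Finset.mem_univ l))
  -- The action on the quotient by `CycPart p M` is trivial, since `Φ_p (X - 1)` acts as zero.
  have hconj : ∀ (i : ℕ) (y : M), τ^[i] (χ (.ofAdd y)) / (χ (.ofAdd y) : Ω) ∈
      IntermediateField.adjoin K (S₁ : Set Ω) := fun i y => by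
    have h1 : (X ^ i - 1 : ℤ[X]) • y ∈ Submodule.torsionBy ℤ[X] M (cyclotomic p ℤ) := by
      obtain ⟨q, hq⟩ := sub_one_dvd_pow_sub_one (X : ℤ[X]) i
      rw [Submodule.mem_torsionBy_iff, smul_smul, hq, ← mul_assoc, cyclotomic_prime_mul_X_sub_one,
        mul_comm, mul_smul, hM, smul_zero]
    have h2 := hL ⟨_, h1⟩
    rw [mem_charactersIn] at h2
    rw [iterate_character τ χ hχ]
    simpa [sub_smul, ofAdd_sub] using h2
  choose w hwτ c hcE hc0 hw using fun j => exists_fixed_of_conjugates τ hσ hp.out.pos hτ hτp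
    (IntermediateField.adjoin K (S₁ : Set Ω)) (χ (.ofAdd (m j))).ne_zero fun i => hconj i (m j)
  refine ⟨S₁ ∪ Finset.univ.image w, ?_, fun x hx => ?_, fun x => ?_⟩
  · refine (Finset.card_union_le _ _).trans (hrank ▸ Nat.add_le_add ?_ ?_)
    · refine Finset.card_biUnion_le.trans
        ((Finset.sum_le_card_nsmul _ _ (p - 1) fun l _ => hS l).trans ?_)
      simp
    · exact Finset.card_image_le.trans (by simp)
  · rcases Finset.mem_union.1 hx with hx | hx
    · obtain ⟨l, -, hl⟩ := Finset.mem_biUnion.1 hx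
      exact hSτ l x hl
    · obtain ⟨j, -, rfl⟩ := Finset.mem_image.1 hx
      exact hwτ j
  · have hle : IntermediateField.adjoin K (S₁ : Set Ω) ≤
        IntermediateField.adjoin K ((S₁ ∪ Finset.univ.image w : Finset Ω) : Set Ω) :=
      IntermediateField.adjoin.mono K _ _ (Finset.coe_subset.2 Finset.subset_union_left)
    obtain ⟨z, hz⟩ := hm x
    have hmj : ∀ j, m j ∈ charactersIn χ (IntermediateField.adjoin K
        ((S₁ ∪ Finset.univ.image w : Finset Ω) : Set Ω)) := fun j => by
      rw [mem_charactersIn, eq_div_of_mul_eq (hc0 j) ((mul_comm _ _).trans (hw j).symm)]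
      refine div_mem (IntermediateField.subset_adjoin _ _ ?_) (hle (hcE j))
      exact Finset.mem_coe.2
        (Finset.mem_union_right _ (Finset.mem_image_of_mem w (Finset.mem_univ j)))
    rw [← sub_add_cancel x (∑ i, z i • m i)]
    exact add_mem (hle (hL ⟨_, hz⟩)) (sum_mem fun j _ => zsmul_mem (hmj j) _)

end FixedGenerators

section Rational

variable {K Ω : Type*} [Field K] [Field Ω] [Algebra K Ω]

theorem algebraicIndependent_of_card_le_trdeg (S : Finset Ω)
    (hS : IntermediateField.adjoin K (S : Set Ω) = ⊤)
    (hcard : (S.card : Cardinal) ≤ Algebra.trdeg K Ω) :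
    AlgebraicIndependent K ((↑) : S → Ω) := by
  have h1 : Set.range ((↑) : S → Ω) = (S : Set Ω) := Subtype.range_coe
  have : Algebra.IsAlgebraic (Algebra.adjoin K (Set.range ((↑) : S → Ω))) Ω := by
    rw [h1]
    refine ⟨fun x => ?_⟩
    have hx : x ∈ IntermediateField.adjoin K (S : Set Ω) := hS ▸ IntermediateField.mem_top
    obtain ⟨a, ha, b, hb, rfl⟩ := (IntermediateField.mem_adjoin_iff_div).1 hx
    have h2 := isAlgebraic_algebraMap (A := Ω) (⟨a, ha⟩ : Algebra.adjoin K (S : Set Ω))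
    have h3 := isAlgebraic_algebraMap (A := Ω) (⟨b, hb⟩ : Algebra.adjoin K (S : Set Ω))
    rw [div_eq_mul_inv]
    exact h2.mul h3.inv
  refine (Algebra.IsAlgebraic.isTranscendenceBasis_of_lift_le_trdeg_of_finite K
    ((↑) : S → Ω) ?_).1
  simpa using hcard

/-- The fraction field of a ring `A` of `τ`-fixed elements that spans `Ω` over `K` is rational, once
`Ω` is generated by at most `trdeg Ω` fixed elements: both fields are the fixed field of `τ`. -/
theorem isRationalOver_of_fixed_generators {k : Type u} [Field k] [Algebra k K]
    [Algebra k Ω] [IsScalarTower k K Ω] [FiniteDimensional k K] [IsGalois k K]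
    {σ : K ≃ₐ[k] K} {p : ℕ} (τ : Ω ≃+* Ω)
    (hgen : ∀ g : K ≃ₐ[k] K, g ∈ Subgroup.zpowers σ) (hσ : orderOf σ = p) (hp : 0 < p)
    (hτ : ∀ c, τ (algebraMap K Ω c) = algebraMap K Ω (σ c))
    {A : Type u} [CommRing A] [IsDomain A] [Algebra k A] (ι : A →ₐ[k] Ω)
    (hι : Function.Injective ι) (hιτ : ∀ a, τ (ι a) = ι a)
    (hιtop : IntermediateField.adjoin K (Set.range ι) = ⊤)
    (S : Finset Ω) (hS : ∀ x ∈ S, τ x = x) (hStop : IntermediateField.adjoin K (S : Set Ω) = ⊤)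
    (hcard : (S.card : Cardinal) ≤ Algebra.trdeg K Ω) : IsRationalOver k (FractionRing A) := by
  have hind : AlgebraicIndependent k ((↑) : S → Ω) :=
    (algebraicIndependent_of_card_le_trdeg S hStop hcard).restrictScalars
      (algebraMap k K).injective
  have hfix : ∀ (T : Set Ω), (∀ x ∈ T, τ x = x) →
      ∀ x ∈ IntermediateField.adjoin k T, τ x = x := fun T hT x hx => by
    induction hx using IntermediateField.adjoin_induction with
    | mem x hx => exact hT x hx
    | algebraMap c => rw [IsScalarTower.algebraMap_apply k K Ω, hτ, σ.commutes]
    | add x y _ _ hx hy => rw [map_add, hx, hy]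
    | inv x _ hx => rw [map_inv₀, hx]
    | mul x y _ _ hx hy => rw [map_mul, hx, hy]
  have hmem : ∀ (T : Set Ω), (∀ x ∈ T, τ x = x) → IntermediateField.adjoin K T = ⊤ →
      ∀ x, τ x = x → x ∈ IntermediateField.adjoin k T := fun T hT hTtop x hx => by
    refine mem_of_fixed_of_adjoin_eq_top τ hgen hσ hp hτ _ (hfix T hT) ?_ hx
    exact top_unique (hTtop ▸ IntermediateField.adjoin.mono K _ _
      (IntermediateField.subset_adjoin k T))
  have hrange : ∀ x ∈ Set.range ι, τ x = x := by
    rintro _ ⟨a, rfl⟩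
    exact hιτ a
  have heq : (IsFractionRing.liftAlgHom (K := FractionRing A) hι).fieldRange =
      IntermediateField.adjoin k (Set.range ((↑) : S → Ω)) := by
    have h1 : IntermediateField.adjoin k (Set.range ι) =
        IntermediateField.adjoin k (Set.range ((↑) : S → Ω)) := by
      rw [Subtype.range_coe]
      exact le_antisymm
        (fun x hx => hmem _ hS hStop x (hfix _ hrange x hx))
        (fun x hx => hmem _ hrange hιtop x (hfix _ hS x hx))
    rw [← h1]
    exact IsFractionRing.algHom_fieldRange_eq_of_comp_eq_of_range_eq (g := ι)
      (by ext; simp) (by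
        rw [← AlgHom.coe_range, Algebra.adjoin_eq])
  refine ⟨S.card, ⟨(AlgEquiv.ofInjectiveField
    (IsFractionRing.liftAlgHom (K := FractionRing A) hι)).trans
    ((IntermediateField.equivOfEq heq).trans (hind.aevalEquivField.symm.trans
      (IsFractionRing.algEquivOfAlgEquiv (MvPolynomial.renameEquiv k S.equivFin))))⟩⟩

end Rational

/-! ### Twisted forms of Laurent polynomial rings -/

section TwistedForm

open Polynomial

/-- A `k`-form `A` of the Laurent polynomial ring `K[ℤ^d]`, for a field extension `K / k` with an
automorphism `σ`: the elements of `A` are fixed under an automorphism `τ` that acts on `K` as `σ`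
and on the exponents by an additive map `ρ`. -/
structure TwistedForm {k K : Type*} [Field k] [Field K] [Algebra k K] (σ : K ≃ₐ[k] K) (d : ℕ)
    (A : Type*) [CommRing A] [Algebra k A] where
  /-- The action on the exponents. -/
  ρ : (Fin d → ℤ) →ₗ[ℤ] (Fin d → ℤ)
  /-- The semilinear automorphism. -/
  τ : AddMonoidAlgebra K (Fin d → ℤ) ≃+* AddMonoidAlgebra K (Fin d → ℤ)
  /-- The inclusion of the form. -/
  ι : A →ₐ[k] AddMonoidAlgebra K (Fin d → ℤ)
  τ_single : ∀ m c, τ (.single m c) = .single (ρ m) (σ c)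
  τ_ι : ∀ a, τ (ι a) = ι a
  ι_injective : Function.Injective ι
  span_range_ι : Submodule.span K (Set.range ι) = ⊤

namespace TwistedForm

variable {k K : Type*} [Field k] [Field K] [Algebra k K] {σ : K ≃ₐ[k] K} {d : ℕ} {A : Type*}
  [CommRing A] [Algebra k A] (F : TwistedForm σ d A)

/-- The exponents, as a `ℤ[X]`-module on which `X` acts as `ρ`. -/
abbrev Lattice : Type := Module.AEval' F.ρ

/-- The monomials, as units of the Laurent polynomial ring. -/
noncomputable def monomial : Multiplicative F.Lattice →* (AddMonoidAlgebra K (Fin d → ℤ))ˣ :=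
  MonoidHom.toHomUnits ((AddMonoidAlgebra.of K (Fin d → ℤ)).comp
    ((Module.AEval'.of F.ρ).symm.toAddMonoidHom.toMultiplicative))

theorem monomial_ofAdd (m : F.Lattice) :
    (F.monomial (.ofAdd m) : AddMonoidAlgebra K (Fin d → ℤ)) =
      .single ((Module.AEval'.of F.ρ).symm m) 1 := rfl

theorem τ_monomial (m : F.Lattice) :
    F.τ (F.monomial (.ofAdd m)) = F.monomial (.ofAdd ((X : ℤ[X]) • m)) := by
  obtain ⟨m, rfl⟩ := (Module.AEval'.of F.ρ).surjective m
  rw [monomial_ofAdd, monomial_ofAdd, Module.AEval'.X_smul_of, LinearEquiv.symm_apply_apply,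
    LinearEquiv.symm_apply_apply, F.τ_single, map_one]

theorem τ_algebraMap (c : K) : F.τ (algebraMap K _ c) = algebraMap K _ (σ c) := by
  rw [AddMonoidAlgebra.coe_algebraMap]
  simp [F.τ_single]

theorem τ_smul (c : K) (x : AddMonoidAlgebra K (Fin d → ℤ)) : F.τ (c • x) = σ c • F.τ x := by
  rw [Algebra.smul_def, map_mul, F.τ_algebraMap, Algebra.smul_def]

theorem iterate_τ {p : ℕ} (hσ : orderOf σ = p) (x : AddMonoidAlgebra K (Fin d → ℤ)) :
    F.τ^[p] x = x := by
  have hx : x ∈ Submodule.span K (Set.range F.ι) := F.span_range_ι ▸ Submodule.mem_top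
  induction hx using Submodule.span_induction with
  | mem x hx =>
    obtain ⟨a, rfl⟩ := hx
    exact Function.iterate_fixed (F.τ_ι a) p
  | zero => exact Function.iterate_fixed (map_zero F.τ) p
  | add x y _ _ hx hy => rw [iterate_map_add, hx, hy]
  | smul c x _ hx =>
    rw [iterate_smul_of_semilinear F.τ F.τ_smul, hx, ← hσ, pow_orderOf_eq_one, AlgEquiv.one_apply]

theorem X_pow_sub_one_smul {p : ℕ} (hσ : orderOf σ = p) (m : F.Lattice) :
    (X ^ p - 1 : ℤ[X]) • m = 0 := by
  have h : ∀ i : ℕ, F.τ^[i] (F.monomial (.ofAdd m)) = F.monomial (.ofAdd ((X : ℤ[X]) ^ i • m)) :=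
    fun i => by
      induction i with
      | zero => simp
      | succ i ih => rw [Function.iterate_succ_apply', ih, F.τ_monomial, smul_smul, pow_succ']
  have h1 := h p
  rw [F.iterate_τ hσ, monomial_ofAdd, monomial_ofAdd] at h1
  have h2 := AddMonoidAlgebra.of_injective (R := K) (M := Fin d → ℤ) h1
  rw [sub_smul, one_smul, sub_eq_zero]
  exact ((Module.AEval'.of F.ρ).symm.injective h2).symm

/-- The exponents, with their standard basis. -/
noncomputable def latticeEquiv : (Fin d → ℤ) ≃ₗ[ℤ] F.Lattice :=
  (Module.AEval'.of F.ρ).toAddEquiv.toIntLinearEquiv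

instance : Module.Free ℤ F.Lattice := Module.Free.of_equiv F.latticeEquiv

instance : Module.Finite ℤ F.Lattice := Module.Finite.equiv F.latticeEquiv

theorem finrank_lattice : Module.finrank ℤ F.Lattice = d := by
  rw [← F.latticeEquiv.finrank_eq, Module.finrank_pi, Fintype.card_fin]

/-- A form of a Laurent polynomial ring has a rational fraction field if the part of the lattice of
exponents killed by `Φ_p` is free over `ℤ[X] / (Φ_p)`. -/
theorem isRationalOver {k : Type u} [Field k] [Algebra k K] [FiniteDimensional k K] [IsGalois k K]
    {σ : K ≃ₐ[k] K} {p : ℕ} [hp : Fact p.Prime]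
    (hgen : ∀ g : K ≃ₐ[k] K, g ∈ Subgroup.zpowers σ) (hσ : orderOf σ = p)
    {A : Type u} [CommRing A] [IsDomain A] [Algebra k A] (F : TwistedForm σ d A) {r : ℕ}
    (e : CycPart p F.Lattice ≃ₗ[CycRing p] (Fin r → CycRing p)) :
    IsRationalOver k (FractionRing A) := by
  let B := AddMonoidAlgebra K (Fin d → ℤ)
  let Ω := FractionRing B
  let τ : Ω ≃+* Ω := IsFractionRing.ringEquivOfRingEquiv F.τ
  have hτB : ∀ b, τ (algebraMap B Ω b) = algebraMap B Ω (F.τ b) :=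
    IsFractionRing.ringEquivOfRingEquiv_algebraMap F.τ
  have hτ : ∀ c : K, τ (algebraMap K Ω c) = algebraMap K Ω (σ c) := fun c => by
    rw [IsScalarTower.algebraMap_apply K B Ω, hτB, F.τ_algebraMap,
      ← IsScalarTower.algebraMap_apply]
  have hτp : ∀ x, τ^[p] x = x := fun x => by
    have hB : ∀ b, τ^[p] (algebraMap B Ω b) = algebraMap B Ω b := fun b => by
      have h : Function.Semiconj (algebraMap B Ω) F.τ τ := fun b => (hτB b).symm
      rw [← h.iterate_right p b, F.iterate_τ hσ]
    obtain ⟨⟨a, b⟩, hab⟩ := IsLocalization.surj (nonZeroDivisors B) x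
    have hb : algebraMap B Ω b ≠ 0 := IsFractionRing.to_map_ne_zero_of_mem_nonZeroDivisors b.2
    refine mul_right_cancel₀ hb ?_
    conv_lhs => rw [← hB b]
    rw [← iterate_map_mul, hab, hB]
  let χ : Multiplicative F.Lattice →* Ωˣ := (Units.map (algebraMap B Ω : B →* Ω)).comp F.monomial
  have hχ : ∀ m : F.Lattice, τ (χ (.ofAdd m)) = χ (.ofAdd ((X : ℤ[X]) • m)) := fun m => by
    change τ (algebraMap B Ω _) = algebraMap B Ω _
    rw [hτB, F.τ_monomial]
  obtain ⟨S, hScard, hS, hSχ⟩ := exists_fixed_generators τ χ hσ hτ hτp hχ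
    (F.X_pow_sub_one_smul hσ) e
  have hsmul : ∀ (c : K) b, algebraMap B Ω (c • b) = c • algebraMap B Ω b := fun c b => by
    rw [Algebra.algebraMap_eq_smul_one, smul_assoc, ← Algebra.algebraMap_eq_smul_one]
  have hgenB : ∀ E : IntermediateField K Ω, (∀ b, algebraMap B Ω b ∈ E) → E = ⊤ := fun E hE => by
    refine top_unique fun x _ => ?_
    obtain ⟨a, b, -, rfl⟩ := IsFractionRing.div_surjective (A := B) x
    exact div_mem (hE a) (hE b)
  refine isRationalOver_of_fixed_generators τ hgen hσ hp.out.pos hτ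
    ((IsScalarTower.toAlgHom k B Ω).comp F.ι)
    ((IsFractionRing.injective B Ω).comp F.ι_injective)
    (fun a => (hτB _).trans (congrArg _ (F.τ_ι a))) (hgenB _ fun b => ?_) S hS
    (hgenB _ fun b => ?_) ?_
  · have hb : b ∈ Submodule.span K (Set.range F.ι) := F.span_range_ι ▸ Submodule.mem_top
    induction hb using Submodule.span_induction with
    | mem b hb =>
      obtain ⟨a, rfl⟩ := hb
      exact IntermediateField.subset_adjoin _ _ ⟨a, rfl⟩
    | zero => rw [map_zero]; exact zero_mem _
    | add x y _ _ hx hy => rw [map_add]; exact add_mem hx hy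
    | smul c x _ hx =>
      rw [hsmul]
      exact IntermediateField.smul_mem _ hx
  · induction b using AddMonoidAlgebra.induction_linear with
    | zero => rw [map_zero]; exact zero_mem _
    | add x y hx hy => rw [map_add]; exact add_mem hx hy
    | single m c =>
      rw [show AddMonoidAlgebra.single m c =
        c • (AddMonoidAlgebra.single m 1 : AddMonoidAlgebra K (Fin d → ℤ)) by simp, hsmul]
      exact IntermediateField.smul_mem _ (hSχ (Module.AEval'.of F.ρ m))
  · have h1 : AlgebraicIndependent K
        (fun i : Fin d => (algebraMap B Ω (AddMonoidAlgebra.single (Pi.single i 1) 1))) := by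
      have h2 : MvPolynomial.aeval
          (fun i : Fin d => algebraMap B Ω (AddMonoidAlgebra.single (Pi.single i 1) 1)) =
          (IsScalarTower.toAlgHom K B Ω).comp (AddMonoidAlgebra.ofMvPolynomial K d) := by
        refine MvPolynomial.algHom_ext fun i => ?_
        rw [MvPolynomial.aeval_X, AlgHom.comp_apply, MvPolynomial.X,
          AddMonoidAlgebra.ofMvPolynomial_monomial]
        have : AddMonoidAlgebra.exponentHom d (Finsupp.single i 1) = Pi.single i 1 := by
          funext j
          simp [AddMonoidAlgebra.exponentHom, Finsupp.single_apply, Pi.single_apply, eq_comm]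
        rw [this]
        rfl
      rw [algebraicIndependent_iff_injective_aeval, h2]
      exact (IsFractionRing.injective B Ω).comp (AddMonoidAlgebra.ofMvPolynomial_injective K d)
    have h3 := h1.lift_cardinalMk_le_trdeg
    rw [Cardinal.mk_fin, Cardinal.lift_natCast, Cardinal.lift_id'] at h3
    refine le_trans ?_ h3
    exact_mod_cast hScard.trans_eq F.finrank_lattice

end TwistedForm

end TwistedForm

/-! ### Stably rational forms -/

section RatFunField

theorem RatFunField.ringHom_ext {A : Type u} [CommRing A] {m : ℕ} {Ω : Type*} [Field Ω]
    {f g : RatFunField m (FractionRing A) →+* Ω}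
    (hA : ∀ a : A, f (algebraMap (MvPolynomial (Fin m) (FractionRing A)) _
      (MvPolynomial.C (algebraMap A (FractionRing A) a))) =
      g (algebraMap (MvPolynomial (Fin m) (FractionRing A)) _
      (MvPolynomial.C (algebraMap A (FractionRing A) a))))
    (hX : ∀ j : Fin m,
      f (algebraMap _ _ (MvPolynomial.X j : MvPolynomial (Fin m) (FractionRing A))) =
      g (algebraMap _ _ (MvPolynomial.X j : MvPolynomial (Fin m) (FractionRing A)))) : f = g := by
  refine IsLocalization.ringHom_ext (nonZeroDivisors (MvPolynomial (Fin m) (FractionRing A))) ?_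
  refine MvPolynomial.ringHom_ext' ?_ hX
  exact IsLocalization.ringHom_ext (nonZeroDivisors A) (RingHom.ext hA)

variable {k : Type u} [Field k]

/-- The extension of an injective map `A[Y₁, …, Y_m] → Ω` to the field `Frac(A)(Y₁, …, Y_m)`. -/
theorem RatFunField.exists_algHom {A : Type u} [CommRing A] [IsDomain A] [Algebra k A] {m : ℕ}
    {Ω : Type*} [Field Ω] [Algebra k Ω] (ι : A →ₐ[k] Ω)
    (Y : Fin m → Ω) (hY : Function.Injective (MvPolynomial.eval₂Hom (ι : A →+* Ω) Y)) :
    ∃ f : RatFunField m (FractionRing A) →ₐ[k] Ω,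
      (∀ a : A, f (algebraMap (MvPolynomial (Fin m) (FractionRing A)) _
      (MvPolynomial.C (algebraMap A (FractionRing A) a))) = ι a) ∧
      ∀ j : Fin m,
        f (algebraMap _ _ (MvPolynomial.X j : MvPolynomial (Fin m) (FractionRing A))) = Y j := by
  have hι : Function.Injective ι := fun a b h => MvPolynomial.C_injective (Fin m) A (hY (by simpa))
  let _ : Algebra A Ω := (ι : A →+* Ω).toAlgebra
  let g : FractionRing A →ₐ[k] Ω := IsFractionRing.liftAlgHom hι
  let _ : Algebra (FractionRing A) Ω := (g : FractionRing A →+* Ω).toAlgebra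
  have hg : ∀ a, g (algebraMap A (FractionRing A) a) = ι a := fun a => by simp [g]
  have : IsScalarTower A (FractionRing A) Ω := .of_algebraMap_eq fun a => (hg a).symm
  have : IsScalarTower k (FractionRing A) Ω := .of_algebraMap_eq fun a => (g.commutes a).symm
  have : Algebra.IsAlgebraic A (FractionRing A) :=
    IsLocalization.isAlgebraic _ (nonZeroDivisors A)
  have h1 : AlgebraicIndependent A Y := hY
  have h2 := algebraicIndependent_iff_injective_aeval.1 (h1.extendScalars (FractionRing A))
  refine ⟨(IsFractionRing.liftAlgHom (K := RatFunField m (FractionRing A)) h2).restrictScalars k,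
    fun a => ?_, fun j => ?_⟩
  · change IsFractionRing.lift h2 _ = _
    rw [IsFractionRing.lift_algebraMap]
    exact (MvPolynomial.aeval_C Y _).trans (hg a)
  · change IsFractionRing.lift h2 _ = _
    rw [IsFractionRing.lift_algebraMap]
    simp

/-- A rational subfield of fixed elements that generates `Ω` over `K` yields algebraically
independent fixed generators of `Ω` over `K`. -/
theorem RatFunField.exists_algebraicIndependent {K Ω : Type*} [Field K] [Algebra k K]
    [Algebra.IsAlgebraic k K] [Field Ω] [Algebra k Ω] [Algebra K Ω] [IsScalarTower k K Ω]
    (τ : Ω ≃+* Ω) {N : ℕ} (g : RatFunField N k →ₐ[k] Ω) (hgτ : ∀ y, τ (g y) = g y)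
    (hg : IntermediateField.adjoin K (Set.range g) = ⊤) :
    ∃ x : Fin N → Ω, AlgebraicIndependent K x ∧ (∀ i, τ (x i) = x i) ∧
      IntermediateField.adjoin K (Set.range x) = ⊤ := by
  let x : Fin N → Ω := fun i =>
    g (algebraMap _ _ (MvPolynomial.X i : MvPolynomial (Fin N) k))
  have hx (f : MvPolynomial (Fin N) k) : g (algebraMap _ _ f) = MvPolynomial.aeval x f := by
    have : g.comp (IsScalarTower.toAlgHom k (MvPolynomial (Fin N) k) (RatFunField N k)) =
        MvPolynomial.aeval x :=
      MvPolynomial.algHom_ext fun i => (MvPolynomial.aeval_X x i).symm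
    exact AlgHom.congr_fun this f
  have hxk : AlgebraicIndependent k x := by
    have h : (MvPolynomial.aeval x : MvPolynomial (Fin N) k → Ω) = fun f =>
      g (algebraMap _ (RatFunField N k) f) := funext fun f => (hx f).symm
    rw [algebraicIndependent_iff_injective_aeval, h]
    exact g.injective.comp (IsFractionRing.injective _ _)
  refine ⟨x, hxk.extendScalars K, fun i => hgτ _, top_unique (hg ▸ ?_)⟩
  refine IntermediateField.adjoin_le_iff.2 ?_
  rintro _ ⟨y, rfl⟩
  have haeval : ∀ f : MvPolynomial (Fin N) k,
      MvPolynomial.aeval x f ∈ IntermediateField.adjoin K (Set.range x) := fun f => by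
    induction f using MvPolynomial.induction_on with
    | C c =>
      rw [MvPolynomial.aeval_C, IsScalarTower.algebraMap_apply k K Ω]
      exact IntermediateField.algebraMap_mem _ _
    | add f g hf hg => rw [map_add]; exact add_mem hf hg
    | mul_X g j hg =>
      rw [map_mul, MvPolynomial.aeval_X]
      exact mul_mem hg (IntermediateField.subset_adjoin _ _ ⟨j, rfl⟩)
  obtain ⟨a, b, -, rfl⟩ := IsFractionRing.div_surjective (A := MvPolynomial (Fin N) k) y
  rw [map_div₀, hx, hx]
  exact div_mem (haeval a) (haeval b)

theorem MvPolynomial.mapEquiv_C {R ι : Type*} [CommRing R] (τ : R ≃+* R) (c : R) :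
    MvPolynomial.mapEquiv ι τ (MvPolynomial.C c) = MvPolynomial.C (τ c) :=
  MvPolynomial.map_C (τ : R →+* R) c

theorem MvPolynomial.mapEquiv_X {R ι : Type*} [CommRing R] (τ : R ≃+* R) (i : ι) :
    MvPolynomial.mapEquiv ι τ (MvPolynomial.X i) = MvPolynomial.X i :=
  MvPolynomial.map_X (τ : R →+* R) i

theorem MvPolynomial.iterate_mapEquiv {R ι : Type*} [CommRing R] (τ : R ≃+* R) {p : ℕ}
    (hτ : ∀ c, τ^[p] c = c) (f : MvPolynomial ι R) : (MvPolynomial.mapEquiv ι τ)^[p] f = f := by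
  induction f using MvPolynomial.induction_on with
  | C a =>
    have h : Function.Semiconj (MvPolynomial.C (σ := ι)) τ (MvPolynomial.mapEquiv ι τ) :=
      fun b => (MvPolynomial.mapEquiv_C τ b).symm
    rw [← h.iterate_right p a, hτ]
  | add f g hf hg => rw [iterate_map_add, hf, hg]
  | mul_X f i hf => rw [iterate_map_mul, hf, Function.iterate_fixed (MvPolynomial.mapEquiv_X τ i)]

end RatFunField

namespace TwistedForm

open Polynomial

section

variable {k K : Type*} [Field k] [Field K] [Algebra k K] {σ : K ≃ₐ[k] K} {d m : ℕ} {Ω : Type*}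
  [Field Ω] [Algebra K Ω]
  [Algebra (MvPolynomial (Fin m) (AddMonoidAlgebra K (Fin d → ℤ))) Ω]
  [IsScalarTower K (MvPolynomial (Fin m) (AddMonoidAlgebra K (Fin d → ℤ))) Ω]
  [IsFractionRing (MvPolynomial (Fin m) (AddMonoidAlgebra K (Fin d → ℤ))) Ω]

/-- A subfield containing a form and the variables is everything. -/
theorem eq_top_of_mem {A : Type*} [CommRing A] [Algebra k A] (F : TwistedForm σ d A)
    (E : IntermediateField K Ω)
    (hA : ∀ a, algebraMap (MvPolynomial (Fin m) (AddMonoidAlgebra K (Fin d → ℤ))) Ω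
      (MvPolynomial.C (F.ι a)) ∈ E)
    (hX : ∀ j, algebraMap (MvPolynomial (Fin m) (AddMonoidAlgebra K (Fin d → ℤ))) Ω
      (MvPolynomial.X j) ∈ E) : E = ⊤ := by
  have hsmul : ∀ (c : K) b, algebraMap (MvPolynomial (Fin m) (AddMonoidAlgebra K (Fin d → ℤ))) Ω
      (c • b) = c • algebraMap _ Ω b := fun c b => by
    rw [Algebra.algebraMap_eq_smul_one, smul_assoc, ← Algebra.algebraMap_eq_smul_one]
  have hB : ∀ b, algebraMap (MvPolynomial (Fin m) (AddMonoidAlgebra K (Fin d → ℤ))) Ω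
      (MvPolynomial.C b) ∈ E := fun b => by
    have hb : b ∈ Submodule.span K (Set.range F.ι) := F.span_range_ι ▸ Submodule.mem_top
    induction hb using Submodule.span_induction with
    | mem b hb =>
      obtain ⟨a, rfl⟩ := hb
      exact hA a
    | zero => rw [map_zero, map_zero]; exact zero_mem _
    | add x y _ _ hx hy => rw [map_add, map_add]; exact add_mem hx hy
    | smul c x _ hx =>
      have h : MvPolynomial.C (σ := Fin m) (c • x) = c • MvPolynomial.C x :=
        map_smul (IsScalarTower.toAlgHom K (AddMonoidAlgebra K (Fin d → ℤ))
          (MvPolynomial (Fin m) _)) c x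
      rw [h, hsmul]
      exact IntermediateField.smul_mem _ hx
  have hC : ∀ g, algebraMap (MvPolynomial (Fin m) (AddMonoidAlgebra K (Fin d → ℤ))) Ω g ∈ E :=
    fun g => by
      induction g using MvPolynomial.induction_on with
      | C b => exact hB b
      | add f g hf hg => rw [map_add]; exact add_mem hf hg
      | mul_X g j hg => rw [map_mul]; exact mul_mem hg (hX j)
  refine top_unique fun x _ => ?_
  obtain ⟨a, b, -, rfl⟩ := IsFractionRing.div_surjective
    (A := MvPolynomial (Fin m) (AddMonoidAlgebra K (Fin d → ℤ))) x
  exact div_mem (hC a) (hC b)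

/-- The function field `Frac(A)(Y₁, …, Y_m)` consists of fixed elements of the field
`Ω = K(ℤ^d)(Y₁, …, Y_m)` and generates it over `K`. -/
theorem exists_ratFunField_algHom {k : Type u} [Field k] [Algebra k K] {σ : K ≃ₐ[k] K}
    [Algebra k Ω] [IsScalarTower k K Ω]
    [IsScalarTower k (MvPolynomial (Fin m) (AddMonoidAlgebra K (Fin d → ℤ))) Ω]
    {A : Type u} [CommRing A] [IsDomain A] [Algebra k A] (F : TwistedForm σ d A)
    (τ : Ω ≃+* Ω) (hτ : ∀ c, τ (algebraMap _ Ω c) =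
      algebraMap _ Ω (MvPolynomial.mapEquiv (Fin m) F.τ c)) :
    ∃ f : RatFunField m (FractionRing A) →ₐ[k] Ω, (∀ y, τ (f y) = f y) ∧
      IntermediateField.adjoin K (Set.range f) = ⊤ := by
  let ι : A →ₐ[k] Ω := (IsScalarTower.toAlgHom k
    (MvPolynomial (Fin m) (AddMonoidAlgebra K (Fin d → ℤ))) Ω).comp
    ((IsScalarTower.toAlgHom k (AddMonoidAlgebra K (Fin d → ℤ)) _).comp F.ι)
  have hι : ∀ a, ι a = algebraMap _ Ω (MvPolynomial.C (σ := Fin m) (F.ι a)) := fun a => rfl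
  obtain ⟨f, hfA, hfX⟩ := RatFunField.exists_algHom (m := m) ι
    (fun j => algebraMap (MvPolynomial (Fin m) (AddMonoidAlgebra K (Fin d → ℤ))) Ω
      (MvPolynomial.X j)) (by
      have : MvPolynomial.eval₂Hom (ι : A →+* Ω) (fun j => algebraMap
          (MvPolynomial (Fin m) (AddMonoidAlgebra K (Fin d → ℤ))) Ω (MvPolynomial.X j)) =
          (algebraMap _ Ω).comp (MvPolynomial.map
            (F.ι : A →+* AddMonoidAlgebra K (Fin d → ℤ))) :=
        MvPolynomial.ringHom_ext (fun a => by simp [hι]) fun j => by simp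
      rw [this]
      exact (IsFractionRing.injective _ Ω).comp (MvPolynomial.map_injective _ F.ι_injective))
  refine ⟨f, ?_, F.eq_top_of_mem (m := m) _ (fun a => ?_) fun j => ?_⟩
  · have : (τ : Ω →+* Ω).comp (f : _ →+* Ω) = (f : _ →+* Ω) :=
      RatFunField.ringHom_ext (A := A) (m := m) (fun a => by
        simp only [RingHom.comp_apply, RingHom.coe_coe, hfA]
        rw [hι, hτ, MvPolynomial.mapEquiv_C, F.τ_ι]) fun j => by
        simp only [RingHom.comp_apply, RingHom.coe_coe, hfX]
        rw [hτ, MvPolynomial.mapEquiv_X]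
    exact fun x => RingHom.congr_fun this x
  · exact IntermediateField.subset_adjoin _ _ ⟨_, hfA a⟩
  · exact IntermediateField.subset_adjoin _ _ ⟨_, hfX j⟩

/-- A field that is purely transcendental over `K` on fixed generators is the fraction field of a
`τ`-stable polynomial ring, to be compared with the Laurent polynomial ring. -/
theorem isPrincipal_of_algebraicIndependent {p : ℕ} [hp : Fact p.Prime] (hσ : orderOf σ = p)
    {A : Type*} [CommRing A] [Algebra k A] (F : TwistedForm σ d A)
    (τ : Ω ≃+* Ω) (hτ : ∀ c, τ (algebraMap _ Ω c) =
      algebraMap _ Ω (MvPolynomial.mapEquiv (Fin m) F.τ c))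
    {N : ℕ} (x : Fin N → Ω) (hxK : AlgebraicIndependent K x) (hxτ : ∀ i, τ (x i) = x i)
    (hxtop : IntermediateField.adjoin K (Set.range x) = ⊤)
    {I : Ideal (CycRing p)} (hI : I ≠ ⊥) {n : ℕ}
    (e : CycPart p F.Lattice ≃ₗ[CycRing p] (Fin n → CycRing p) × I) : I.IsPrincipal := by
  let _ : Algebra (MvPolynomial (Fin N) K) Ω :=
    (MvPolynomial.aeval x : MvPolynomial (Fin N) K →ₐ[K] Ω).toRingHom.toAlgebra
  have hx : ∀ g : MvPolynomial (Fin N) K, algebraMap _ Ω g = MvPolynomial.aeval x g := fun g => rfl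
  have : IsScalarTower K (MvPolynomial (Fin N) K) Ω := .of_algebraMap_eq fun c => by
    rw [hx, MvPolynomial.algebraMap_eq, MvPolynomial.aeval_C]
  have : FaithfulSMul (MvPolynomial (Fin N) K) Ω :=
    (faithfulSMul_iff_algebraMap_injective _ _).2 hxK
  have : IsFractionRing (MvPolynomial (Fin N) K) Ω := IsFractionRing.of_field _ _ fun z => by
    have hz : z ∈ IntermediateField.adjoin K (Set.range x) := hxtop ▸ IntermediateField.mem_top
    obtain ⟨a, ha, b, hb, rfl⟩ := IntermediateField.mem_adjoin_iff_div.1 hz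
    rw [Algebra.adjoin_range_eq_range_aeval] at ha hb
    obtain ⟨a, rfl⟩ := ha
    obtain ⟨b, rfl⟩ := hb
    exact ⟨a, b, rfl⟩
  have hτK : ∀ c : K, τ (algebraMap K Ω c) = algebraMap K Ω (σ c) := fun c => by
    rw [IsScalarTower.algebraMap_apply K (MvPolynomial (Fin m) (AddMonoidAlgebra K (Fin d → ℤ))) Ω,
      hτ, MvPolynomial.algebraMap_apply, MvPolynomial.mapEquiv_C,
      F.τ_algebraMap, ← MvPolynomial.algebraMap_apply, ← IsScalarTower.algebraMap_apply]
  have hτ₂ : ∀ g, τ (algebraMap _ Ω g) =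
      algebraMap _ Ω (MvPolynomial.mapEquiv (Fin N) (σ : K ≃+* K) g) := fun g => by
    induction g using MvPolynomial.induction_on with
    | C c =>
      rw [MvPolynomial.mapEquiv_C, hx, hx, MvPolynomial.aeval_C, MvPolynomial.aeval_C]
      exact hτK c
    | add f g hf hg => rw [map_add, map_add, hf, hg, map_add, map_add]
    | mul_X g j hg =>
      rw [map_mul, map_mul, hg, map_mul, map_mul, MvPolynomial.mapEquiv_X, hx (MvPolynomial.X j),
        MvPolynomial.aeval_X, hxτ]
  let χ : Multiplicative F.Lattice →* (MvPolynomial (Fin m) (AddMonoidAlgebra K (Fin d → ℤ)))ˣ :=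
    (Units.map (MvPolynomial.C (σ := Fin m) (R := AddMonoidAlgebra K (Fin d → ℤ)) :
      _ →* _)).comp F.monomial
  have hχ : ∀ l : F.Lattice,
    (χ (.ofAdd l) : MvPolynomial (Fin m) (AddMonoidAlgebra K (Fin d → ℤ))) =
      MvPolynomial.C (F.monomial (.ofAdd l) : AddMonoidAlgebra K (Fin d → ℤ)) := fun l => rfl
  refine isPrincipal_of_birational K τ _ _ hτ hτ₂
    (MvPolynomial.iterate_mapEquiv _ (F.iterate_τ hσ))
    (MvPolynomial.iterate_mapEquiv _ (iterate_algEquiv_orderOf hσ)) χ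
    (fun l => ?_) (fun l c h => ?_) (fun u => ?_) (fun u => ?_) hI e
  · rw [hχ, MvPolynomial.mapEquiv_C, F.τ_monomial, hχ]
  · rw [hχ, MvPolynomial.algebraMap_apply] at h
    have h1 := MvPolynomial.C_injective _ _ h
    rw [monomial_ofAdd, AddMonoidAlgebra.coe_algebraMap] at h1
    have h2 := congrArg (fun g => g.coeff ((Module.AEval'.of F.ρ).symm l)) h1
    have h3 : (Module.AEval'.of F.ρ).symm l = 0 := by
      by_contra h3
      simp [AddMonoidAlgebra.coeff_single, Ne.symm h3] at h2
    exact (LinearEquiv.map_eq_zero_iff _).1 h3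
  · obtain ⟨b, hb, hu⟩ := MvPolynomial.isUnit_iff_eq_C_of_isReduced.1 u.isUnit
    obtain ⟨l, c, -, rfl⟩ := AddMonoidAlgebra.exists_eq_single_of_isUnit hb
    refine ⟨Module.AEval'.of F.ρ l, c, ?_⟩
    rw [hu, hχ, MvPolynomial.algebraMap_apply, ← map_mul, monomial_ofAdd,
      LinearEquiv.symm_apply_apply, AddMonoidAlgebra.coe_algebraMap]
    simp
  · obtain ⟨r, -, hr⟩ := MvPolynomial.isUnit_iff_eq_C_of_isReduced.1 u.isUnit
    exact ⟨r, hr⟩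

end

/-- If the fraction field of a form of a Laurent polynomial ring is stably rational, then the
part of the lattice of exponents killed by `Φ_p` has trivial ideal class. -/
theorem isPrincipal_of_isStablyRationalOver {k : Type u} {K : Type*} [Field k] [Field K]
    [Algebra k K] [Algebra.IsAlgebraic k K] {σ : K ≃ₐ[k] K} {p : ℕ} [hp : Fact p.Prime]
    (hσ : orderOf σ = p) {d : ℕ} {A : Type u} [CommRing A] [IsDomain A] [Algebra k A]
    (F : TwistedForm σ d A) (h : IsStablyRationalOver k (FractionRing A))
    {I : Ideal (CycRing p)} (hI : I ≠ ⊥) {n : ℕ}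
    (e : CycPart p F.Lattice ≃ₗ[CycRing p] (Fin n → CycRing p) × I) : I.IsPrincipal := by
  obtain ⟨m, N, ⟨φ⟩⟩ := h
  let Ω := FractionRing (MvPolynomial (Fin m) (AddMonoidAlgebra K (Fin d → ℤ)))
  let τ : Ω ≃+* Ω := IsFractionRing.ringEquivOfRingEquiv (MvPolynomial.mapEquiv (Fin m) F.τ)
  have hτ : ∀ c, τ (algebraMap _ Ω c) = algebraMap _ Ω (MvPolynomial.mapEquiv (Fin m) F.τ c) :=
    IsFractionRing.ringEquivOfRingEquiv_algebraMap _
  obtain ⟨f, hfτ, hftop⟩ := F.exists_ratFunField_algHom τ hτ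
  obtain ⟨x, hxK, hxτ, hxtop⟩ := RatFunField.exists_algebraicIndependent (K := K) τ
    (f.comp φ.symm.toAlgHom) (fun y => hfτ _) (by
      rw [← hftop]
      exact congrArg _ (φ.symm.surjective.range_comp f))
  exact F.isPrincipal_of_algebraicIndependent hσ τ hτ x hxK hxτ hxtop hI e

end TwistedForm

/-! ### Tori are twisted forms -/

section Extraction

variable {k K A : Type*} [Field k] [Field K] [Algebra k K] {d : ℕ}

/-- A semilinear automorphism of the Laurent polynomial ring that is compatible with the counit
permutes the monomials: they are the units with value `1` under the counit. -/
theorem AddMonoidAlgebra.exists_exponent_action (σ : K ≃ₐ[k] K)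
    (τ : AddMonoidAlgebra K (Fin d → ℤ) ≃+* AddMonoidAlgebra K (Fin d → ℤ))
    (hτ : ∀ c, τ (algebraMap K _ c) = algebraMap K _ (σ c))
    (hε : ∀ b, Coalgebra.counit (R := K) (τ b) = σ (Coalgebra.counit (R := K) b)) :
    ∃ ρ : (Fin d → ℤ) →ₗ[ℤ] (Fin d → ℤ), ∀ m c, τ (single m c) = single (ρ m) (σ c) := by
  have h : ∀ m : Fin d → ℤ, ∃ n : Fin d → ℤ, τ (single m 1) = single n 1 := fun m => by
    have hu : IsUnit (single m 1 : AddMonoidAlgebra K (Fin d → ℤ)) :=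
      .of_mul_eq_one (single (-m) 1) (by rw [single_mul_single, add_neg_cancel, one_mul]; rfl)
    obtain ⟨n, c, -, hc⟩ := exists_eq_single_of_isUnit (hu.map τ)
    have h1 := hε (single m 1)
    rw [hc, counit_single, counit_single, CommSemiring.counit_apply, CommSemiring.counit_apply,
      map_one] at h1
    exact ⟨n, by rw [hc, h1]⟩
  choose r hr using h
  have hadd : ∀ m n, r (m + n) = r m + r n := fun m n => by
    refine of_injective (R := K) (M := Fin d → ℤ) (a₁ := .ofAdd _) (a₂ := .ofAdd _) ?_
    change single (r (m + n)) 1 = single (r m + r n) 1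
    rw [← hr, show (single (m + n) 1 : AddMonoidAlgebra K (Fin d → ℤ)) = single m 1 * single n 1 by
      rw [single_mul_single, one_mul], map_mul, hr, hr, single_mul_single, one_mul]
  refine ⟨(AddMonoidHom.mk' r hadd).toIntLinearMap, fun m c => ?_⟩
  have h1 : ∀ (m : Fin d → ℤ) (c : K), (single m c : AddMonoidAlgebra K (Fin d → ℤ)) =
      algebraMap K _ c * single m 1 := fun m c => by
    rw [coe_algebraMap]
    simp [single_mul_single]
  rw [h1, map_mul, hτ, hr, ← h1]
  rfl

/-- An isomorphism `K ⊗ A ≃ K[ℤ^d]` that takes `A` to elements fixed by `τ` makes `A` a twisted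
form. -/
noncomputable def TwistedForm.ofAlgEquiv [CommRing A] [Algebra k A] {σ : K ≃ₐ[k] K}
    (ρ : (Fin d → ℤ) →ₗ[ℤ] (Fin d → ℤ))
    (τ : AddMonoidAlgebra K (Fin d → ℤ) ≃+* AddMonoidAlgebra K (Fin d → ℤ))
    (hτ : ∀ m c, τ (.single m c) = .single (ρ m) (σ c))
    (e : (K ⊗[k] A) ≃ₐ[K] AddMonoidAlgebra K (Fin d → ℤ))
    (he : ∀ a, τ (e (1 ⊗ₜ a)) = e (1 ⊗ₜ a)) : TwistedForm σ d A where
  ρ := ρ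
  τ := τ
  ι := (e.toAlgHom.restrictScalars k).comp Algebra.TensorProduct.includeRight
  τ_single := hτ
  τ_ι := he
  ι_injective := e.injective.comp
    (Algebra.TensorProduct.includeRight_injective (algebraMap k K).injective)
  span_range_ι := by
    refine top_unique fun b _ => ?_
    obtain ⟨x, rfl⟩ := e.surjective b
    induction x with
    | zero => rw [map_zero]; exact zero_mem _
    | add x y hx hy => rw [map_add]; exact add_mem (hx trivial) (hy trivial)
    | tmul c a =>
      rw [show (c ⊗ₜ[k] a : K ⊗[k] A) = c • (1 ⊗ₜ a) by
        rw [TensorProduct.smul_tmul', smul_eq_mul, mul_one], map_smul]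
      exact Submodule.smul_mem _ _ (Submodule.subset_span ⟨a, rfl⟩)

variable [CommRing A] [HopfAlgebra k A]

/-- The coordinate ring of a torus is a twisted form of the Laurent polynomial ring. -/
theorem nonempty_twistedForm (σ : K ≃ₐ[k] K)
    (e : (K ⊗[k] A) ≃ₐc[K] AddMonoidAlgebra K (Fin d → ℤ)) : Nonempty (TwistedForm σ d A) := by
  let S : (K ⊗[k] A) ≃ₐ[k] (K ⊗[k] A) := Algebra.TensorProduct.congr σ AlgEquiv.refl
  have hS : ∀ c a, S (c ⊗ₜ a) = σ c ⊗ₜ a := fun c a => rfl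
  let e' : (K ⊗[k] A) ≃ₐ[K] AddMonoidAlgebra K (Fin d → ℤ) := e.toAlgEquiv
  have hε : ∀ x, Coalgebra.counit (R := K) (e' x) = Coalgebra.counit (R := K) x := fun x =>
    CoalgHomClass.counit_comp_apply e x
  let τ := e'.toRingEquiv.symm.trans (S.toRingEquiv.trans e'.toRingEquiv)
  have hτ : ∀ x, τ (e' x) = e' (S x) := fun x =>
    congrArg (fun y => e' (S y)) (e'.symm_apply_apply x)
  have hSε : ∀ x : K ⊗[k] A, Coalgebra.counit (R := K) (S x) = σ (Coalgebra.counit (R := K) x) :=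
    fun x => by
      induction x with
      | zero => simp
      | add x y hx hy => rw [map_add, map_add, hx, hy, map_add, map_add]
      | tmul c a =>
        rw [hS, TensorProduct.counit_tmul, TensorProduct.counit_tmul, map_smul,
          CommSemiring.counit_apply, CommSemiring.counit_apply]
  obtain ⟨ρ, hρ⟩ := AddMonoidAlgebra.exists_exponent_action σ τ (fun c => by
    rw [← e'.commutes, hτ, Algebra.TensorProduct.algebraMap_apply, hS, ← e'.commutes]
    rfl) fun b => by
    obtain ⟨x, rfl⟩ := e'.surjective b
    rw [hτ, hε, hε, hSε]
  exact ⟨.ofAlgEquiv ρ τ hρ e' fun a => by rw [hτ, hS, map_one]⟩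

end Extraction

/-! ### Descent of Hopf algebras -/

section Descent

variable {k K : Type*} [Field k] [Field K] [Algebra k K]

section Modules

variable {V W : Type*} [AddCommGroup V] [Module k V] [Module K V] [IsScalarTower k K V]
  [AddCommGroup W] [Module k W] {f : W →ₗ[k] V}

theorem IsBaseChange.injective_of_field (hf : IsBaseChange K f) : Function.Injective f := by
  have h : ⇑f = hf.equiv ∘ fun w => (1 : K) ⊗ₜ[k] w := funext fun w => by simp
  rw [h]
  exact hf.equiv.injective.comp
    (Module.Flat.tensorProduct_mk_injective (R := k) (S := K) (M := W))

theorem IsBaseChange.span_range_eq_top (hf : IsBaseChange K f) :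
    Submodule.span K (Set.range f) = ⊤ := by
  refine top_unique fun v _ => ?_
  obtain ⟨x, rfl⟩ := hf.equiv.surjective v
  induction x with
  | zero => rw [map_zero]; exact zero_mem _
  | add x y hx hy => rw [map_add]; exact add_mem (hx trivial) (hy trivial)
  | tmul c w =>
    rw [hf.equiv_tmul]
    exact Submodule.smul_mem _ _ (Submodule.subset_span ⟨w, rfl⟩)

theorem IsBaseChange.tensorProductMap {V' W' : Type*} [AddCommGroup V'] [Module k V'] [Module K V']
    [IsScalarTower k K V'] [AddCommGroup W'] [Module k W'] {f' : W' →ₗ[k] V'}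
    (hf : IsBaseChange K f) (hf' : IsBaseChange K f') (g : W ⊗[k] W' →ₗ[k] V ⊗[K] V')
    (hg : ∀ w w', g (w ⊗ₜ w') = f w ⊗ₜ f' w') : IsBaseChange K g := by
  refine IsBaseChange.of_equiv ((TensorProduct.AlgebraTensorModule.distribBaseChange k K W W').trans
    (TensorProduct.congr hf.equiv hf'.equiv)) fun x => ?_
  induction x with
  | zero => simp
  | add x y hx hy => rw [TensorProduct.tmul_add, map_add, hx, hy, map_add]
  | tmul w w' =>
    rw [LinearEquiv.trans_apply, TensorProduct.AlgebraTensorModule.distribBaseChange_tmul,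
      TensorProduct.congr_tmul, hf.equiv_tmul, hf'.equiv_tmul, one_smul, one_smul, hg]

variable {σ : K ≃ₐ[k] K} {p : ℕ}

theorem exists_algebraMap_eq_cyclicTrace [FiniteDimensional k K] [IsGalois k K]
    (hgen : ∀ g : K ≃ₐ[k] K, g ∈ Subgroup.zpowers σ) (hσ : orderOf σ = p) (c : K) :
    ∃ b : k, algebraMap k K b = cyclicTrace p σ c :=
  exists_algebraMap_of_fixed hgen (map_cyclicTrace σ (iterate_algEquiv_orderOf hσ) c)

variable [FiniteDimensional k K] [IsGalois k K]

/-- Galois descent: a `k`-subspace of fixed vectors that spans `V` over `K` is a `k`-form of `V`. -/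
theorem isBaseChange_of_fixed (hgen : ∀ g : K ≃ₐ[k] K, g ∈ Subgroup.zpowers σ)
    (hσ : orderOf σ = p) (hp : 0 < p) (τ : V →+ V) (hτ : ∀ (c : K) x, τ (c • x) = σ c • τ x)
    (hf : Function.Injective f) (hfτ : ∀ w, τ (f w) = f w)
    (hspan : Submodule.span K (Set.range f) = ⊤) : IsBaseChange K f := by
  let b := Module.Basis.ofVectorSpace k W
  have hli : LinearIndependent K (f ∘ b) := by
    rw [linearIndependent_iff']
    intro s g hg i hi
    by_contra hgi
    obtain ⟨a, ha⟩ := exists_cyclicTrace_ne_zero hσ hp σ (fun c x => map_mul σ c x) hgi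
    choose t ht using fun j => exists_algebraMap_eq_cyclicTrace hgen hσ (a • g j)
    have h0 : ∑ j ∈ s, t j • b j = 0 := by
      apply hf
      rw [map_sum, map_zero]
      calc ∑ j ∈ s, f (t j • b j) = ∑ j ∈ s, cyclicTrace p τ ((a • g j) • f (b j)) :=
            Finset.sum_congr rfl fun j _ => by
              rw [cyclicTrace_smul_of_fixed τ hτ (hfτ _), ← ht, map_smul, algebraMap_smul]
        _ = cyclicTrace p τ (a • ∑ j ∈ s, g j • f (b j)) := by
              rw [Finset.smul_sum, cyclicTrace_sum]
              simp_rw [smul_smul, smul_eq_mul]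
        _ = 0 := by
              rw [show ∑ j ∈ s, g j • f (b j) = 0 from hg, smul_zero, cyclicTrace_zero]
    rw [← ht, linearIndependent_iff'.1 b.linearIndependent s t h0 i hi, map_zero] at ha
    exact ha rfl
  have hsp : ⊤ ≤ Submodule.span K (Set.range (f ∘ b)) := by
    rw [← hspan]
    refine Submodule.span_le.2 ?_
    rintro _ ⟨w, rfl⟩
    rw [← b.linearCombination_repr w, Finsupp.linearCombination_apply, Finsupp.sum, map_sum]
    refine sum_mem fun j _ => ?_
    rw [map_smul, ← algebraMap_smul K]
    exact Submodule.smul_mem _ _ (Submodule.subset_span ⟨j, rfl⟩)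
  let e : K ⊗[k] W ≃ₗ[K] V := (b.baseChange K).equiv (Module.Basis.mk hli hsp) (Equiv.refl _)
  have he : ∀ j, e (1 ⊗ₜ b j) = f (b j) := fun j => by
    have := (b.baseChange K).equiv_apply (b' := Module.Basis.mk hli hsp) j (Equiv.refl _)
    simpa using this
  refine IsBaseChange.of_equiv e fun w => ?_
  have h : (e.toLinearMap.restrictScalars k) ∘ₗ TensorProduct.mk k K W 1 = f := b.ext he
  exact LinearMap.congr_fun h w

/-- In a `k`-form consisting of fixed vectors, every fixed vector belongs to the form. -/
theorem IsBaseChange.exists_eq_of_fixed (hf : IsBaseChange K f)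
    (hgen : ∀ g : K ≃ₐ[k] K, g ∈ Subgroup.zpowers σ)
    (hσ : orderOf σ = p) (hp : 0 < p) (τ : V →+ V) (hτ : ∀ (c : K) x, τ (c • x) = σ c • τ x)
    (hfτ : ∀ w, τ (f w) = f w) {v : V} (hv : τ v = v) : ∃ w, f w = v := by
  have hT : ∀ v ∈ Submodule.span K (Set.range f), ∀ c : K,
      cyclicTrace p τ (c • v) ∈ LinearMap.range f := fun v hv => by
    induction hv using Submodule.span_induction with
    | mem v hv =>
      obtain ⟨w, rfl⟩ := hv
      intro c
      obtain ⟨b, hb⟩ := exists_algebraMap_eq_cyclicTrace hgen hσ c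
      rw [cyclicTrace_smul_of_fixed τ hτ (hfτ w), ← hb, algebraMap_smul, ← map_smul]
      exact ⟨_, rfl⟩
    | zero =>
      intro c
      rw [smul_zero, cyclicTrace_zero]
      exact zero_mem _
    | add v w _ _ hv hw =>
      intro c
      rw [smul_add, cyclicTrace_add]
      exact add_mem (hv c) (hw c)
    | smul a v _ hv =>
      intro c
      rw [smul_smul]
      exact hv _
  obtain ⟨c, hc⟩ := exists_cyclicTrace_ne_zero hσ hp σ (fun c x => map_mul σ c x)
    (one_ne_zero (α := K))
  obtain ⟨b, hb⟩ := exists_algebraMap_eq_cyclicTrace hgen hσ (c • 1)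
  have h := hT v (hf.span_range_eq_top ▸ Submodule.mem_top) (c • 1)
  rw [cyclicTrace_smul_of_fixed τ hτ hv, ← hb, algebraMap_smul] at h
  obtain ⟨w, hw⟩ := h
  have hb0 : b ≠ 0 := fun h0 => hc (by rw [← hb, h0, map_zero])
  exact ⟨b⁻¹ • w, by rw [map_smul, hw, inv_smul_smul₀ hb0]⟩

end Modules

end Descent

section HopfDescent

theorem AlgHom.exists_lift_of_injective {R X Y Z : Type*} [CommRing R] [CommRing X] [CommRing Y]
    [CommRing Z] [Algebra R X] [Algebra R Y] [Algebra R Z] (f : X →ₐ[R] Y) (g : Z →ₐ[R] Y)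
    (hg : Function.Injective g) (h : ∀ x, ∃ z, g z = f x) :
    ∃ h : X →ₐ[R] Z, ∀ x, g (h x) = f x := by
  let e := AlgEquiv.ofInjective g hg
  refine ⟨e.symm.toAlgHom.comp (f.codRestrict g.range h), fun x => ?_⟩
  exact congrArg Subtype.val (e.apply_symm_apply (f.codRestrict g.range h x))

variable {k K B : Type*} {A : Type u} [Field k] [Field K] [Algebra k K] [CommRing A] [Algebra k A]
  [CommRing B] [Algebra k B]

section

variable [Algebra K B] [IsScalarTower k K B]

/-- The tensor product of two `k`-algebra maps to `K`-algebras. -/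
noncomputable def tensorHom {A' B' : Type*} [CommRing A'] [Algebra k A'] [CommRing B']
    [Algebra k B'] [Algebra K B'] [IsScalarTower k K B'] (ι : A →ₐ[k] B) (ι' : A' →ₐ[k] B') :
    A ⊗[k] A' →ₐ[k] B ⊗[K] B' :=
  Algebra.TensorProduct.lift
    ((Algebra.TensorProduct.includeLeft (R := K) (S := k) (A := B) (B := B')).comp ι)
    (((Algebra.TensorProduct.includeRight (R := K) (A := B) (B := B')).restrictScalars k).comp ι')
    fun _ _ => Commute.all _ _

@[simp]
theorem tensorHom_tmul {A' B' : Type*} [CommRing A'] [Algebra k A'] [CommRing B'] [Algebra k B']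
    [Algebra K B'] [IsScalarTower k K B'] (ι : A →ₐ[k] B) (ι' : A' →ₐ[k] B') (a : A) (a' : A') :
    tensorHom (K := K) ι ι' (a ⊗ₜ a') = ι a ⊗ₜ ι' a' := by
  simp [tensorHom]

theorem isBaseChange_tensorHom {A' B' : Type*} [CommRing A'] [Algebra k A'] [CommRing B']
    [Algebra k B'] [Algebra K B'] [IsScalarTower k K B'] {ι : A →ₐ[k] B} {ι' : A' →ₐ[k] B'}
    (h : IsBaseChange K ι.toLinearMap) (h' : IsBaseChange K ι'.toLinearMap) :
    IsBaseChange K (tensorHom (K := K) ι ι').toLinearMap :=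
  h.tensorProductMap h' _ fun a a' => tensorHom_tmul ι ι' a a'

end

variable [HopfAlgebra K B] [IsScalarTower k K B]

/-- The structure maps of a Hopf algebra over `K` that preserve a `k`-form of the algebra make this
form a Hopf algebra over `k`. -/
theorem exists_hopfAlgebra_of_isBaseChange (ι : A →ₐ[k] B) (hι : IsBaseChange K ι.toLinearMap)
    (hcomul : ∀ a, ∃ y, tensorHom (K := K) ι ι y = Coalgebra.comul (R := K) (ι a))
    (hcounit : ∀ a, ∃ c, algebraMap k K c = Coalgebra.counit (R := K) (ι a))
    (hantipode : ∀ a, ∃ a', ι a' = HopfAlgebra.antipode K (ι a)) :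
    ∃ (A' : Type u) (_ : CommRing A') (_ : HopfAlgebra k A') (j : A' ≃+* A)
      (e : (K ⊗[k] A') ≃ₐc[K] B), ∀ a, e (1 ⊗ₜ a) = ι (j a) := by
  have hinj : Function.Injective ι := hι.injective_of_field
  have hinj₂ : Function.Injective (tensorHom (K := K) ι ι) :=
    (isBaseChange_tensorHom hι hι).injective_of_field
  have hinj₃ : Function.Injective (tensorHom (K := K) ι (tensorHom (K := K) ι ι)) :=
    (isBaseChange_tensorHom hι (isBaseChange_tensorHom hι hι)).injective_of_field
  obtain ⟨Δ, hΔ⟩ := AlgHom.exists_lift_of_injective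
    (((Bialgebra.comulAlgHom K B).restrictScalars k).comp ι) _ hinj₂ hcomul
  obtain ⟨ε, hε⟩ := AlgHom.exists_lift_of_injective
    (((Bialgebra.counitAlgHom K B).restrictScalars k).comp ι) (Algebra.ofId k K)
    (algebraMap k K).injective hcounit
  replace hΔ : ∀ a, tensorHom (K := K) ι ι (Δ a) = Coalgebra.comul (R := K) (ι a) := hΔ
  replace hε : ∀ a, algebraMap k K (ε a) = Coalgebra.counit (R := K) (ι a) := hε
  have hι_smul : ∀ (c : k) (a : A), ι (c • a) = algebraMap k K c • ι a := fun c a => by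
    rw [map_smul, algebraMap_smul]
  let _ : Bialgebra k A := Bialgebra.ofAlgHom Δ ε
    (by
      refine AlgHom.ext fun a => hinj₃ ?_
      have h1 : ∀ y : A ⊗[k] A, tensorHom (K := K) ι (tensorHom (K := K) ι ι)
          (Algebra.TensorProduct.map (.id k A) Δ y) =
          (Coalgebra.comul (R := K) (A := B)).lTensor B (tensorHom (K := K) ι ι y) := fun y => by
        induction y with
        | zero => simp
        | add x y hx hy => simp only [map_add, hx, hy]
        | tmul a a' => simp [hΔ]
      have h3 : ∀ (x : A ⊗[k] A) (a : A), tensorHom (K := K) ι (tensorHom (K := K) ι ι)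
          (Algebra.TensorProduct.assoc k k k A A A (x ⊗ₜ a)) =
          TensorProduct.assoc K B B B (tensorHom (K := K) ι ι x ⊗ₜ ι a) := fun x a => by
        induction x with
        | zero => simp
        | add x y hx hy => simp only [TensorProduct.add_tmul, map_add, hx, hy]
        | tmul a a' => simp
      have h2 : ∀ y : A ⊗[k] A, tensorHom (K := K) ι (tensorHom (K := K) ι ι)
          (Algebra.TensorProduct.assoc k k k A A A (Algebra.TensorProduct.map Δ (.id k A) y)) =
          TensorProduct.assoc K B B B ((Coalgebra.comul (R := K) (A := B)).rTensor B
            (tensorHom (K := K) ι ι y)) := fun y => by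
        induction y with
        | zero => simp
        | add x y hx hy => simp only [map_add, hx, hy]
        | tmul a a' => simp [hΔ, h3]
      have h4 := h2 (Δ a)
      rw [hΔ, Coalgebra.coassoc_apply, ← hΔ, ← h1] at h4
      exact h4)
    (by
      refine AlgHom.ext fun a => (Algebra.TensorProduct.lid k A).injective (hinj ?_)
      have h1 : ∀ y : A ⊗[k] A, ι (Algebra.TensorProduct.lid k A
          (Algebra.TensorProduct.map ε (.id k A) y)) =
          TensorProduct.lid K B ((Coalgebra.counit (R := K) (A := B)).rTensor B
            (tensorHom (K := K) ι ι y)) := fun y => by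
        induction y with
        | zero => simp
        | add x y hx hy => simp only [map_add, hx, hy]
        | tmul a a' => simp [hι_smul, hε]
      have h2 := h1 (Δ a)
      rw [hΔ, Coalgebra.rTensor_counit_comul] at h2
      simpa using h2)
    (by
      refine AlgHom.ext fun a => (Algebra.TensorProduct.rid k k A).injective (hinj ?_)
      have h1 : ∀ y : A ⊗[k] A, ι (Algebra.TensorProduct.rid k k A
          (Algebra.TensorProduct.map (.id k A) ε y)) =
          TensorProduct.rid K B ((Coalgebra.counit (R := K) (A := B)).lTensor B
            (tensorHom (K := K) ι ι y)) := fun y => by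
        induction y with
        | zero => simp
        | add x y hx hy => simp only [map_add, hx, hy]
        | tmul a a' => simp [hι_smul, hε]
      have h2 := h1 (Δ a)
      rw [hΔ, Coalgebra.lTensor_counit_comul] at h2
      simpa using h2)
  have hcomul' : ∀ a, tensorHom (K := K) ι ι (Coalgebra.comul (R := k) a) =
    Coalgebra.comul (R := K) (ι a) := hΔ
  have hcounit' : ∀ a, algebraMap k K (Coalgebra.counit (R := k) a) =
    Coalgebra.counit (R := K) (ι a) := hε
  choose s hs using hantipode
  let S : A →ₗ[k] A :=
    { toFun := s
      map_add' := fun a b => hinj (by rw [hs, map_add, map_add, map_add, hs, hs])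
      map_smul' := fun c a => hinj (by
        rw [hs, hι_smul, map_smul, RingHom.id_apply, hι_smul, hs]) }
  have hS : ∀ a, ι (S a) = HopfAlgebra.antipode K (ι a) := hs
  have halg : ∀ c : k, ι (algebraMap k A c) = algebraMap K B (algebraMap k K c) := fun c => by
    rw [AlgHom.commutes, ← IsScalarTower.algebraMap_apply]
  let _ : HopfAlgebra k A :=
    { antipode := S
      mul_antipode_rTensor_comul := by
        refine LinearMap.ext fun a => hinj ?_
        have h1 : ∀ y : A ⊗[k] A, ι (LinearMap.mul' k A (S.rTensor A y)) =
            LinearMap.mul' K B ((HopfAlgebra.antipode K (A := B)).rTensor B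
              (tensorHom (K := K) ι ι y)) := fun y => by
          induction y with
          | zero => simp
          | add x y hx hy => simp only [map_add, hx, hy]
          | tmul a a' => simp [hS]
        have h2 := h1 (Coalgebra.comul (R := k) a)
        rw [hcomul', HopfAlgebra.mul_antipode_rTensor_comul_apply, ← hcounit', ← halg] at h2
        exact h2
      mul_antipode_lTensor_comul := by
        refine LinearMap.ext fun a => hinj ?_
        have h1 : ∀ y : A ⊗[k] A, ι (LinearMap.mul' k A (S.lTensor A y)) =
            LinearMap.mul' K B ((HopfAlgebra.antipode K (A := B)).lTensor B
              (tensorHom (K := K) ι ι y)) := fun y => by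
          induction y with
          | zero => simp
          | add x y hx hy => simp only [map_add, hx, hy]
          | tmul a a' => simp [hS]
        have h2 := h1 (Coalgebra.comul (R := k) a)
        rw [hcomul', HopfAlgebra.mul_antipode_lTensor_comul_apply, ← hcounit', ← halg] at h2
        exact h2 }
  let f : (K ⊗[k] A) →ₐ[K] B :=
    Algebra.TensorProduct.lift (Algebra.ofId K B) ι fun _ _ => Commute.all _ _
  have hf : ∀ c a, f (c ⊗ₜ a) = c • ι a := fun c a => by
    simp [f, Algebra.ofId_apply, Algebra.smul_def]
  have hfeq : ∀ x, f x = hι.equiv x := fun x => by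
    induction x with
    | zero => simp
    | add x y hx hy => simp only [map_add, hx, hy]
    | tmul c a => rw [hf, hι.equiv_tmul]; rfl
  let e := AlgEquiv.ofBijective f (by
    rw [show (f : K ⊗[k] A → B) = hι.equiv from funext hfeq]
    exact hι.equiv.bijective)
  have he : ∀ a, e (1 ⊗ₜ a) = ι a := fun a => (hf 1 a).trans (one_smul _ _)
  refine ⟨A, inferInstance, inferInstance, RingEquiv.refl A, BialgEquiv.ofAlgEquiv e ?_ ?_, he⟩
  · refine Algebra.TensorProduct.ext (Subsingleton.elim _ _) (AlgHom.ext fun a => ?_)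
    change Coalgebra.counit (R := K) (e (1 ⊗ₜ a)) = Coalgebra.counit (R := K) ((1 : K) ⊗ₜ[k] a)
    rw [he, TensorProduct.counit_tmul, ← hcounit', CommSemiring.counit_apply,
      Algebra.algebraMap_eq_smul_one]
  · refine Algebra.TensorProduct.ext (Subsingleton.elim _ _) (AlgHom.ext fun a => ?_)
    change Algebra.TensorProduct.map (e : K ⊗[k] A →ₐ[K] B) (e : K ⊗[k] A →ₐ[K] B)
      (Coalgebra.comul (R := K) ((1 : K) ⊗ₜ[k] a)) = Coalgebra.comul (R := K) (e (1 ⊗ₜ a))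
    rw [he, TensorProduct.comul_tmul, ← hcomul', CommSemiring.comul_apply]
    generalize Coalgebra.comul (R := k) a = y
    induction y with
    | zero => simp
    | add x y hx hy => simp only [TensorProduct.tmul_add, map_add, hx, hy]
    | tmul a a' =>
      rw [TensorProduct.AlgebraTensorModule.tensorTensorTensorComm_tmul,
        Algebra.TensorProduct.map_tmul, tensorHom_tmul]
      exact congrArg₂ (· ⊗ₜ[K] ·) (he a) (he a')

end HopfDescent

/-! ### Tori with a given lattice of characters -/

section ExistsTorus

variable {k K : Type u} [Field k] [Field K] [Algebra k K] {σ : K ≃ₐ[k] K} {p d : ℕ}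

/-- The semilinear automorphism of the Laurent polynomial ring given by `σ` on the coefficients and
`ρ` on the exponents. -/
noncomputable def AddMonoidAlgebra.twist (σ : K ≃ₐ[k] K) (ρ : (Fin d → ℤ) ≃+ (Fin d → ℤ)) :
    AddMonoidAlgebra K (Fin d → ℤ) ≃+* AddMonoidAlgebra K (Fin d → ℤ) :=
  (mapRingEquiv _ (σ : K ≃+* K)).trans (domCongr K K ρ).toRingEquiv

theorem AddMonoidAlgebra.twist_single (ρ : (Fin d → ℤ) ≃+ (Fin d → ℤ)) (m : Fin d → ℤ) (c : K) :
    twist σ ρ (single m c) = single (ρ m) (σ c) := by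
  simp [twist]

theorem AddMonoidAlgebra.twist_smul (ρ : (Fin d → ℤ) ≃+ (Fin d → ℤ)) (c : K)
    (x : AddMonoidAlgebra K (Fin d → ℤ)) : twist σ ρ (c • x) = σ c • twist σ ρ x := by
  induction x using AddMonoidAlgebra.induction_linear with
  | zero => simp
  | add x y hx hy => rw [smul_add, map_add, hx, hy, map_add, smul_add]
  | single m a => rw [smul_single, twist_single, twist_single, smul_single, smul_eq_mul, map_mul,
      smul_eq_mul]

theorem AddMonoidAlgebra.iterate_twist (hσ : orderOf σ = p) (ρ : (Fin d → ℤ) ≃+ (Fin d → ℤ))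
    (hρ : ∀ m, ρ^[p] m = m) (x : AddMonoidAlgebra K (Fin d → ℤ)) : (twist σ ρ)^[p] x = x := by
  have h : ∀ i m (c : K), (twist σ ρ)^[i] (single m c) = single (ρ^[i] m) (σ^[i] c) :=
    fun i m c => by
      induction i with
      | zero => rfl
      | succ i ih => simp only [Function.iterate_succ_apply', ih, twist_single]
  induction x using AddMonoidAlgebra.induction_linear with
  | zero => exact Function.iterate_fixed (map_zero _) p
  | add x y hx hy => rw [iterate_map_add, hx, hy]
  | single m c => rw [h, hρ, iterate_algEquiv_orderOf hσ]

/-- The fixed ring of the semilinear automorphism, an algebra over `k`. -/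
def AddMonoidAlgebra.fixedSubalgebra (σ : K ≃ₐ[k] K) (ρ : (Fin d → ℤ) ≃+ (Fin d → ℤ)) :
    Subalgebra k (AddMonoidAlgebra K (Fin d → ℤ)) where
  carrier := {x | twist σ ρ x = x}
  mul_mem' {x y} hx hy := (map_mul _ x y).trans (congrArg₂ _ hx hy)
  add_mem' {x y} hx hy := (map_add _ x y).trans (congrArg₂ _ hx hy)
  algebraMap_mem' c := by
    have h : algebraMap k (AddMonoidAlgebra K (Fin d → ℤ)) c = (algebraMap k K c) • 1 := by
      rw [algebraMap_smul, Algebra.algebraMap_eq_smul_one]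
    change twist σ ρ _ = _
    rw [h, twist_smul, map_one, σ.commutes]

/-- Every automorphism of order `p` of `ℤ^d` is the action of the Galois group on the characters of
a torus. -/
theorem exists_torus [FiniteDimensional k K] [IsGalois k K]
    (hgen : ∀ g : K ≃ₐ[k] K, g ∈ Subgroup.zpowers σ) (hσ : orderOf σ = p) (hp : 0 < p)
    (ρ : (Fin d → ℤ) ≃+ (Fin d → ℤ)) (hρ : ∀ m, ρ^[p] m = m) :
    ∃ (A : Type u) (_ : CommRing A) (_ : HopfAlgebra k A) (F : TwistedForm σ d A),
      Nonempty ((K ⊗[k] A) ≃ₐc[K] AddMonoidAlgebra K (Fin d → ℤ)) ∧ ∀ m, F.ρ m = ρ m := by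
  have hsmul := AddMonoidAlgebra.twist_smul (σ := σ) ρ
  have hfix : ∀ a : AddMonoidAlgebra.fixedSubalgebra σ ρ, AddMonoidAlgebra.twist σ ρ a = a :=
    fun a => a.2
  have hbase : IsBaseChange K (AddMonoidAlgebra.fixedSubalgebra σ ρ).val.toLinearMap := by
    refine isBaseChange_of_fixed hgen hσ hp (AddMonoidAlgebra.twist σ ρ : _ →+ _) hsmul
      Subtype.val_injective hfix (top_unique fun x _ => ?_)
    refine Submodule.span_mono ?_ (mem_span_cyclicTrace hσ hp (AddMonoidAlgebra.twist σ ρ) hsmul x)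
    rintro _ ⟨c, rfl⟩
    exact ⟨⟨_, map_cyclicTrace _ (AddMonoidAlgebra.iterate_twist hσ ρ hρ) _⟩, rfl⟩
  let τ : AddMonoidAlgebra K (Fin d → ℤ) →ₛₗ[(σ : K →+* K)] AddMonoidAlgebra K (Fin d → ℤ) :=
    { toFun := AddMonoidAlgebra.twist σ ρ
      map_add' := map_add _
      map_smul' := hsmul }
  have hτ : ∀ x, τ x = AddMonoidAlgebra.twist σ ρ x := fun x => rfl
  have hcomul : ∀ x, TensorProduct.map τ τ (Coalgebra.comul (R := K) x) =
      Coalgebra.comul (R := K) (AddMonoidAlgebra.twist σ ρ x) := fun x => by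
    induction x using AddMonoidAlgebra.induction_linear with
    | zero => simp
    | add x y hx hy => simp only [map_add, hx, hy]
    | single m c =>
      simp [AddMonoidAlgebra.twist_single, CommSemiring.comul_apply, hτ]
  have hcounit : ∀ x, Coalgebra.counit (R := K) (AddMonoidAlgebra.twist σ ρ x) =
      σ (Coalgebra.counit (R := K) x) := fun x => by
    induction x using AddMonoidAlgebra.induction_linear with
    | zero => simp
    | add x y hx hy => simp only [map_add, hx, hy]
    | single m c => simp [AddMonoidAlgebra.twist_single, CommSemiring.counit_apply]
  have hantipode : ∀ x, AddMonoidAlgebra.twist σ ρ (HopfAlgebra.antipode K x) =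
      HopfAlgebra.antipode K (AddMonoidAlgebra.twist σ ρ x) := fun x => by
    induction x using AddMonoidAlgebra.induction_linear with
    | zero => simp
    | add x y hx hy => simp only [map_add, hx, hy]
    | single m c => simp [AddMonoidAlgebra.twist_single]
  obtain ⟨A, _, _, j, e, he⟩ := exists_hopfAlgebra_of_isBaseChange _ hbase
    (fun a => (isBaseChange_tensorHom hbase hbase).exists_eq_of_fixed hgen hσ hp
      (TensorProduct.map τ τ).toAddMonoidHom (fun c x => map_smulₛₗ (TensorProduct.map τ τ) c x)
      (fun y => by
        induction y with
        | zero => simp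
        | add x y hx hy => rw [map_add, map_add, hx, hy]
        | tmul a b =>
          change TensorProduct.map τ τ (tensorHom (K := K) _ _ (a ⊗ₜ b)) =
            tensorHom (K := K) _ _ (a ⊗ₜ b)
          rw [tensorHom_tmul, TensorProduct.map_tmul]
          exact congrArg₂ _ (hfix a) (hfix b)) (by
        change TensorProduct.map τ τ _ = _
        exact (hcomul _).trans (congrArg _ (hfix a))))
    (fun a => exists_algebraMap_of_fixed hgen
      ((hcounit _).symm.trans (congrArg _ (hfix a))))
    (fun a => ⟨⟨_, (hantipode _).trans (congrArg _ (hfix a))⟩, rfl⟩)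
  exact ⟨A, inferInstance, inferInstance, .ofAlgEquiv ρ.toAddMonoidHom.toIntLinearMap
    (AddMonoidAlgebra.twist σ ρ) (AddMonoidAlgebra.twist_single ρ) e.toAlgEquiv fun a =>
      (congrArg _ (he a)).trans ((hfix (j a)).trans (he a).symm), ⟨e⟩, fun m => rfl⟩

end ExistsTorus

/-! ### Tori and ideals of the cyclotomic ring -/

section IdealClasses

/-- A module over a Dedekind domain is free if its ideal class is trivial. -/
theorem Module.exists_linearEquiv_pi_of_forall_isPrincipal {R : Type*} [CommRing R]
    [IsDedekindDomain R] (L : Type*) [AddCommGroup L] [Module R L] [Module.Finite R L]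
    [Module.IsTorsionFree R L]
    (h : ∀ (n : ℕ) (I : Ideal R), I ≠ ⊥ → (L ≃ₗ[R] (Fin n → R) × I) → I.IsPrincipal) :
    ∃ r : ℕ, Nonempty (L ≃ₗ[R] (Fin r → R)) := by
  suffices Module.Free R L from ⟨_, ⟨(Module.finBasis R L).equivFun⟩⟩
  rcases hL : Module.finrank R L with _ | n
  · have := Module.finrank_zero_iff.1 hL
    infer_instance
  · obtain ⟨I, hI, ⟨e⟩⟩ := Module.exists_linearEquiv_pi_prod_ideal n L hL
    obtain ⟨a, rfl⟩ := h n I hI e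
    have ha : a ≠ 0 := fun ha => hI (by rw [ha]; exact Submodule.span_zero_singleton R)
    have : Module.Free R (Submodule.span R {a}) :=
      .of_equiv (LinearEquiv.toSpanNonzeroSingleton R R a ha)
    exact .of_equiv e.symm

open Polynomial

variable {p : ℕ} [hp : Fact p.Prime]

section

variable (M : Type*) [AddCommGroup M] [Module ℤ[X] M] [Module.Finite ℤ M] [Module.Free ℤ M]

instance CycPart.instFinite : Module.Finite (CycRing p) (CycPart p M) := by
  have : Module.Finite ℤ (CycPart p M) := Module.Finite.of_injective
    ((Submodule.torsionBy ℤ[X] M (cyclotomic p ℤ)).subtype.restrictScalars ℤ)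
    Subtype.val_injective
  exact .of_restrictScalars_finite ℤ _ _

instance CycPart.instIsTorsionFree : Module.IsTorsionFree (CycRing p) (CycPart p M) := by
  refine .of_smul_eq_zero fun r m hm => or_iff_not_imp_left.2 fun hr => ?_
  obtain ⟨n, hn, s, hs⟩ := (Algebra.IsAlgebraic.isAlgebraic (R := ℤ) r).exists_nonzero_dvd
    (mem_nonZeroDivisors_of_ne_zero hr)
  have h : (n : CycRing p) • m = 0 := by
    rw [show (n : CycRing p) = s * r by rw [mul_comm, ← hs]; rfl, mul_smul, hm, smul_zero]
  rw [Int.cast_smul_eq_zsmul] at h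
  exact Subtype.ext ((smul_eq_zero.1 (congrArg Subtype.val h)).resolve_left hn)

end

variable {k K : Type u} [Field k] [Field K] [Algebra k K] {σ : K ≃ₐ[k] K}

/-- Multiplication by `ζ`, as an automorphism of the additive group. -/
noncomputable def CycRing.zetaAddEquiv (N : Type*) [AddCommGroup N] [Module (CycRing p) N] :
    N ≃+ N where
  toFun x := CycRing.zeta p • x
  invFun x := CycRing.zeta p ^ (p - 1) • x
  left_inv x := by
    dsimp only
    rw [smul_smul, pow_sub_one_mul hp.out.ne_zero, CycRing.zeta_pow, one_smul]
  right_inv x := by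
    dsimp only
    rw [smul_smul, mul_pow_sub_one hp.out.ne_zero, CycRing.zeta_pow, one_smul]
  map_add' := smul_add _

/-- Every nonzero lattice over `ℤ[X] / (Φ_p)` is the lattice of characters of a torus. -/
theorem exists_torus_of_lattice [FiniteDimensional k K] [IsGalois k K]
    (hgen : ∀ g : K ≃ₐ[k] K, g ∈ Subgroup.zpowers σ) (hσ : orderOf σ = p)
    (N : Type*) [AddCommGroup N] [Module (CycRing p) N] [Module.Finite ℤ N] [Module.Free ℤ N]
    [Nontrivial N] :
    ∃ (A : Type u) (_ : CommRing A) (_ : HopfAlgebra k A) (d : ℕ) (F : TwistedForm σ d A),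
      IsTorusSplitBy k A K ∧ Nonempty (CycPart p F.Lattice ≃ₗ[CycRing p] N) := by
  let φ : N ≃+ (Fin (Module.finrank ℤ N) → ℤ) := (Module.finBasis ℤ N).equivFun.toAddEquiv
  let ρ := (φ.symm.trans (CycRing.zetaAddEquiv (p := p) N)).trans φ
  have hρ : ∀ x, ρ (φ x) = φ (CycRing.zeta p • x) := fun x =>
    congrArg (fun y => φ (CycRing.zeta p • y)) (φ.symm_apply_apply x)
  have hρi : ∀ (i : ℕ) x, ρ^[i] (φ x) = φ (CycRing.zeta p ^ i • x) := fun i x => by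
    induction i with
    | zero => simp
    | succ i ih => rw [Function.iterate_succ_apply', ih, hρ, smul_smul, pow_succ']
  obtain ⟨A, _, _, F, e, hF⟩ := exists_torus hgen hσ hp.out.pos ρ fun m => by
    obtain ⟨x, rfl⟩ := φ.surjective m
    rw [hρi, CycRing.zeta_pow, one_smul]
  refine ⟨A, _, _, _, F, ⟨_, Module.finrank_pos, e⟩, ?_⟩
  let Ψ : N ≃+ F.Lattice := φ.trans (Module.AEval'.of F.ρ).toAddEquiv
  let _ : Module ℤ[X] N := Module.compHom N (Ideal.Quotient.mk (Ideal.span {cyclotomic p ℤ}))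
  have hsmul : ∀ (r : ℤ[X]) (x : N), r • x = (Ideal.Quotient.mk _ r : CycRing p) • x :=
    fun _ _ => rfl
  have : IsScalarTower ℤ[X] (CycRing p) N := ⟨fun r s x => by
    rw [hsmul, smul_smul]
    rfl⟩
  let f : N →ₗ[ℤ[X]] F.Lattice := Ψ.toAddMonoidHom.toPolynomialLinearMap fun x => by
    change Module.AEval'.of F.ρ (φ _) = (X : ℤ[X]) • Module.AEval'.of F.ρ (φ x)
    rw [Module.AEval'.X_smul_of, hF, hρ, hsmul]
    rfl
  have h0 : (Ideal.Quotient.mk _ (cyclotomic p ℤ) : CycRing p) = 0 :=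
    Ideal.Quotient.eq_zero_iff_mem.2 (Ideal.mem_span_singleton_self _)
  have hf : ∀ x, f x ∈ Submodule.torsionBy ℤ[X] F.Lattice (cyclotomic p ℤ) := fun x => by
    rw [Submodule.mem_torsionBy_iff, ← map_smul, hsmul,
      (congrArg (fun r : CycRing p => r • x) h0).trans (zero_smul (CycRing p) x), map_zero]
  let g : N →ₗ[CycRing p] CycPart p F.Lattice :=
    LinearMap.extendScalarsOfSurjective (R := ℤ[X]) Ideal.Quotient.mk_surjective
      (f.codRestrict _ hf)
  exact ⟨(LinearEquiv.ofBijective g ⟨fun x y h => Ψ.injective (congrArg Subtype.val h),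
    fun y => ⟨Ψ.symm y, Subtype.ext (Ψ.apply_symm_apply _)⟩⟩).symm⟩

/-- If all tori split by `K` are stably rational, then those whose lattice of characters is an ideal
show that every ideal is principal. -/
theorem isPrincipalIdealRing_of_isStablyRationalOver [FiniteDimensional k K] [IsGalois k K]
    (hgen : ∀ g : K ≃ₐ[k] K, g ∈ Subgroup.zpowers σ) (hσ : orderOf σ = p)
    (h : ∀ (A : Type u) [CommRing A] [HopfAlgebra k A], IsTorusSplitBy k A K →
      IsStablyRationalOver k (FractionRing A)) : IsPrincipalIdealRing (CycRing p) := by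
  refine ⟨fun I => ?_⟩
  by_cases hI : I = ⊥
  · rw [hI]
    infer_instance
  have : Module.Finite ℤ I := Module.Finite.of_injective
    (I.subtype.restrictScalars ℤ) Subtype.val_injective
  have : Module.IsTorsionFree ℤ I := .of_smul_eq_zero fun n x hx => by
    have h1 : n • (x : CycRing p) = 0 := congrArg Subtype.val hx
    exact (smul_eq_zero.1 h1).imp_right fun h => Subtype.ext h
  have : Nontrivial I := Submodule.nontrivial_iff_ne_bot.2 hI
  have : Module.Free ℤ I := Module.free_of_finite_type_torsion_free'
  obtain ⟨A, _, _, d, F, hA, ⟨e⟩⟩ := exists_torus_of_lattice hgen hσ I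
  have := hA.isDomain
  exact F.isPrincipal_of_isStablyRationalOver hσ (h A hA) hI
    -- The structure theorem with `n = 0`.
    (e.trans (LinearEquiv.uniqueProd (M₂ := Fin 0 → CycRing p)).symm)

/-- Either hypothesis makes the part of the lattice of characters killed by `Φ_p` free. -/
theorem IsTorusSplitBy.isRationalOver [FiniteDimensional k K] [IsGalois k K]
    (hgen : ∀ g : K ≃ₐ[k] K, g ∈ Subgroup.zpowers σ) (hσ : orderOf σ = p)
    {A : Type u} [CommRing A] [HopfAlgebra k A] (hA : IsTorusSplitBy k A K)
    (h : IsPrincipalIdealRing (CycRing p) ∨ IsStablyRationalOver k (FractionRing A)) :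
    IsRationalOver k (FractionRing A) := by
  have := hA.isDomain
  obtain ⟨d, -, ⟨e⟩⟩ := hA
  obtain ⟨F⟩ := nonempty_twistedForm σ e
  obtain ⟨r, ⟨e'⟩⟩ := Module.exists_linearEquiv_pi_of_forall_isPrincipal (R := CycRing p)
    (CycPart p F.Lattice) fun n I hI e' => h.elim (fun h => h.principal I)
      fun h => F.isPrincipal_of_isStablyRationalOver hσ h hI e'
  exact F.isRationalOver hgen hσ e'

end IdealClasses

/-! ### Rationality and stable rationality -/

/-- No variables need to be adjoined. -/
theorem IsRationalOver.isStablyRationalOver {k L : Type u} [Field k] [Field L] [Algebra k L]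
    (h : IsRationalOver k L) : IsStablyRationalOver k L := by
  obtain ⟨n, ⟨e⟩⟩ := h
  have e₁ : L ≃ₐ[k] MvPolynomial (Fin 0) L :=
    (MvPolynomial.isEmptyAlgEquiv L (Fin 0)).symm.restrictScalars k
  have e₂ : L ≃ₐ[k] RatFunField 0 L := IsFractionRing.algEquivOfAlgEquiv e₁
  exact ⟨0, n, ⟨e₂.symm.trans e⟩⟩

theorem exists_generator_of_mulEquiv {H G : Type*} [Group H] [Group G] [IsCyclic G] (e : H ≃* G) :
    ∃ σ : H, (∀ g, g ∈ Subgroup.zpowers σ) ∧ orderOf σ = Nat.card G := by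
  have : IsCyclic H := isCyclic_of_surjective e.symm e.symm.surjective
  obtain ⟨σ, hσ⟩ := IsCyclic.exists_generator (α := H)
  exact ⟨σ, hσ, (orderOf_eq_card_of_forall_mem_zpowers hσ).trans (Nat.card_congr e.toEquiv)⟩

theorem theorem6p6 (p : ℕ) [Fact p.Prime] (G : Type v) [Group G] [IsCyclic G]
    (hG : Nat.card G = p) (k : Type u) [Field k] (hk : AdmitsExtension G k) :
    (∀ (A : Type u) [CommRing A] [HopfAlgebra k A],
        IsGTorus G k A → IsStablyRationalTorus k A → IsRationalTorus k A) ∧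
      (NumberField.classNumber (CyclotomicField p ℚ) = 1 ↔
        ∀ (A : Type u) [CommRing A] [HopfAlgebra k A],
          IsGTorus G k A → IsStablyRationalTorus k A) ∧
      (NumberField.classNumber (CyclotomicField p ℚ) = 1 ↔
        ∀ (A : Type u) [CommRing A] [HopfAlgebra k A],
          IsGTorus G k A → IsRationalTorus k A) := by
  have hrat : ∀ (A : Type u) [CommRing A] [HopfAlgebra k A], IsGTorus G k A →
      IsPrincipalIdealRing (CycRing p) ∨ IsStablyRationalTorus k A → IsRationalTorus k A := by
    rintro A _ _ ⟨K, _, _, _, _, ⟨e⟩, hA⟩ h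
    obtain ⟨σ, hgen, hσ⟩ := exists_generator_of_mulEquiv e
    exact hA.isRationalOver hgen (hσ.trans hG) h
  have hstab : ∀ (A : Type u) [CommRing A] [HopfAlgebra k A], IsGTorus G k A →
      IsRationalTorus k A → IsStablyRationalTorus k A := by
    rintro A _ _ ⟨K, _, _, _, _, -, hA⟩ h
    have := hA.isDomain
    exact h.isStablyRationalOver
  have hprinc : (∀ (A : Type u) [CommRing A] [HopfAlgebra k A], IsGTorus G k A →
      IsStablyRationalTorus k A) → IsPrincipalIdealRing (CycRing p) := fun h => by
    obtain ⟨K, _, _, _, _, ⟨e⟩⟩ := hk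
    obtain ⟨σ, hgen, hσ⟩ := exists_generator_of_mulEquiv e
    exact isPrincipalIdealRing_of_isStablyRationalOver hgen (hσ.trans hG) fun A _ _ hA =>
      h A ⟨K, _, _, inferInstance, inferInstance, ⟨e⟩, hA⟩
  rw [CycRing.classNumber_eq_one_iff]
  exact ⟨fun A _ _ hA h => hrat A hA (.inr h),
    ⟨fun h A _ _ hA => hstab A hA (hrat A hA (.inl h)), hprinc⟩,
    ⟨fun h A _ _ hA => hrat A hA (.inl h), fun h => hprinc fun A _ _ hA => hstab A hA (h A hA)⟩⟩
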